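/- Let $\mathbb{T}=\mathbb{R}/2\pi\mathbb{Z}$, let $n\in\{2,3\}$, and write $x=(x_{\mathrm H},z)\in\mathbb{T}^{n-1}\times\mathbb{T}=\mathbb{T}^n$. All velocities $v=(v^1,v^2)$ are $\mathbb{R}^2$-valued. Let $\operatorname{div}_{\mathrm H}v=\sum_{i=1}^{n-1}\partial_{x_i}v^i$, so that $\operatorname{div}_{\mathrm H}v=\partial_{x_1}v^1+\partial_{x_2}v^2$ for $n=3$ and $\operatorname{div}_{\mathrm H}v=\partial_{x_1}v^1$ for $n=2$. Let $$\mathcal{H}=\Big\{v\in L^2(\mathbb{T}^n;\mathbb{R}^2)\ :\ v \text{ is even in } z \text{ and } \operatorname{div}_{\mathrm H}\int_{-\pi}^{\pi}v(\cdot,z)\,dz=0 \text{ in the sense of distributions}\Big\}.$$ For $v\in H^1\cap\mathcal{H}$ let $w(x_{\mathrm H},z)=\int_z^\pi \operatorname{div}_{\mathrm H}v(x_{\mathrm H},\zeta)\,d\zeta$ for $z\in(-\pi,\pi]$, and let $u=(v^1,v^2,w)$ if $n=3$, $u=(v^1,w)$ if $n=2$. A *weak solution* of the $n$-dimensional primitive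 equations with initial value $v_0\in\mathcal{H}$ is a function $v\in C_w([0,\infty);\mathcal{H})\cap L^2_{\mathrm{loc}}([0,\infty);H^1\cap\mathcal{H})$ with $v(0)=v_0$ such that $$-\int_0^\infty\!\!\int_{\mathbb{T}^n}v\cdot\partial_\tau\phi\,dx\,d\tau+\int_0^\infty\!\!\int_{\mathbb{T}^n}\nabla v:\nabla\phi\,dx\,d\tau-\int_0^\infty\!\!\int_{\mathbb{T}^n}(u\otimes v):\nabla\phi\,dx\,d\tau=\int_{\mathbb{T}^n}v_0\cdot\phi(0)\,dx$$ for every $\phi\in C([0,\infty);C^1(\mathbb{T}^n)\cap\mathcal{H})\cap C^1([0,\infty);C(\mathbb{T}^n))$ with compact support in time, where $\nabla=(\partial_{x_1},\dots,\partial_{x_{n-1}},\partial_z)$ and $(u\otimes v):\nabla\phi=\sum_j u_j\,v\cdot\partial_j\phi$. Let $\chi\in C_0^\infty(\mathbb{R})$ be even with $\chi(\xi)=1$ for $|\xi|\le 1/2$ and $\chi(\xi)=0$ for $|\xi|\ge1$, let $\rho(\xi)=\chi(\xi/2)-\chi(\xi)$, and for $j\in\mathbb{Z}$ let $\varphi_j(z)=\sum_{k\in\mathbb{Z}}\rho(2^{-j}k)e^{ikz}$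 and $(\varphi_j*_z f)(x_{\mathrm H},z)=\int_{-\pi}^{\pi}\varphi_j(z-\zeta)f(x_{\mathrm H},\zeta)\,d\zeta$. For $s\in\mathbb{R}$ and $1\le p\le\infty$ let $$\|f\|_{\dot B^{s}_{p,\infty,z}L^\infty_{\mathrm H}}=\sup_{j\in\mathbb{Z}}2^{sj}\Big\|\,\|(\varphi_j*_z f)(\cdot,z)\|_{L^\infty(\mathbb{T}^{n-1})}\Big\|_{L^p_z(\mathbb{T})}.$$ **Theorem (energy equality).** Let $v$ be a weak solution of the $n$-dimensional primitive equations, $n=3$ or $n=2$, with $v(0)=v_0\in\mathcal{H}$. Suppose that for some $T>0$ $$v\in L^\beta(0,T;\dot B^{-1/p}_{p,\infty,z}L^\infty_{\mathrm H})\cap L^\gamma(0,T;\dot B^{2/\gamma}_{2,\infty,z}L^\infty_{\mathrm H}),$$ where $\frac2\beta+\frac2p=1$ with $2<p,\beta<\infty$, and $2<\gamma<\infty$. Then $$\frac12\|v(t)\|_{L^2(\mathbb{T}^n)}^2+\int_0^t\|\nabla v(\tau)\|_{L^2(\mathbb{T}^n)}^2\,d\tau=\frac12\|v_0\|_{L^2(\mathbb{T}^n)}^2\qquad\text{for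 all } 0<t\le T.$$ -/

import Mathlib

namespace PrimitiveEq

open MeasureTheory Set
open scoped ENNReal ContDiff

noncomputable section

instance factTwoPiPos : Fact (0 < 2 * Real.pi) := ⟨Real.two_pi_pos⟩

/-- The circle `ℝ / 2πℤ`. Its `volume` is the arc length, of total mass `2π`. -/
abbrev Circle2Pi : Type := AddCircle (2 * Real.pi)

/-- The horizontal torus `𝕋^d`. -/
abbrev HTorus (d : ℕ) : Type := Fin d → Circle2Pi

/-- The spatial domain `𝕋^d × 𝕋 ∋ (x_H, z)`; here `d = 2` in the three-dimensional case and
`d = 1` in the two-dimensional case. -/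
abbrev Torus (d : ℕ) : Type := HTorus d × Circle2Pi

/-- The values `(v¹, v²) ∈ ℝ²` of the horizontal velocity. -/
abbrev Vel : Type := EuclideanSpace ℝ (Fin 2)

/-- `L²(𝕋^d × 𝕋; ℝ²)`. -/
abbrev L2 (d : ℕ) : Type := Lp Vel 2 (volume : Measure (Torus d))

/-! ### Derivatives -/

/-- The translation by `s` in a coordinate direction: `some i` is the `i`-th horizontal direction
and `none` is the vertical direction `z`. -/
def shift {d : ℕ} : Option (Fin d) → ℝ → Torus d
  | some i, s => (Pi.single i (s : Circle2Pi), 0)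
  | none, s => (0, (s : Circle2Pi))

/-- The classical partial derivative `∂_j f (x)`. -/
def partialDeriv {d : ℕ} {F : Type*} [NormedAddCommGroup F] [NormedSpace ℝ F]
    (j : Option (Fin d)) (f : Torus d → F) (x : Torus d) : F :=
  deriv (fun s : ℝ => f (x + shift j s)) 0

/-- The classical partial derivative `∂_i ψ (x)` of a function of the horizontal variable only. -/
def partialDerivH {d : ℕ} (i : Fin d) (ψ : HTorus d → ℝ) (x : HTorus d) : ℝ :=
  deriv (fun s : ℝ => ψ (x + Pi.single i (s : Circle2Pi))) 0

/-- `ψ ∈ C^∞(𝕋^d × 𝕋)`: the periodic lift of `ψ` is smooth. -/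
def IsSmooth {d : ℕ} (ψ : Torus d → ℝ) : Prop :=
  ContDiff ℝ ∞ (fun y : (Fin d → ℝ) × ℝ => ψ (fun i => (y.1 i : Circle2Pi), (y.2 : Circle2Pi)))

/-- `ψ ∈ C^∞(𝕋^d)`: the periodic lift of `ψ` is smooth. -/
def IsSmoothH {d : ℕ} (ψ : HTorus d → ℝ) : Prop :=
  ContDiff ℝ ∞ (fun y : Fin d → ℝ => ψ (fun i => (y i : Circle2Pi)))

/-- `g ∈ L²` is the weak partial derivative `∂_j f` of `f ∈ L²`. -/
def IsWeakPartial {d : ℕ} (j : Option (Fin d)) (f g : L2 d) : Prop :=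
  ∀ ψ : Torus d → ℝ, IsSmooth ψ →
    ∫ x, partialDeriv j ψ x • f x = - ∫ x, ψ x • g x

/-- `f ∈ H¹(𝕋^d × 𝕋; ℝ²)`. -/
def MemH1 {d : ℕ} (f : L2 d) : Prop :=
  ∀ j : Option (Fin d), ∃ g : L2 d, IsWeakPartial j f g

open Classical in
/-- The weak partial derivative `∂_j f` of `f ∈ H¹` (it is unique). It is only used for `f` with
`MemH1 f`. -/
def weakPartial {d : ℕ} (j : Option (Fin d)) (f : L2 d) : L2 d :=
  if h : ∃ g : L2 d, IsWeakPartial j f g then h.choose else 0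

/-- `‖∇ f‖²_{L²}`, for the full gradient in `(x_H, z)`. -/
def gradNormSq {d : ℕ} (f : L2 d) : ℝ :=
  ∑ j : Option (Fin d), ‖weakPartial j f‖ ^ 2

/-! ### The hydrostatic solenoidal space -/

/-- `f ∈ 𝓗`: `f ∈ L²`, `f` is even in `z`, and `∑_{i ≤ d} ∂_i ∫ fⁱ(·, z) dz = 0` in the sense of
distributions on `𝕋^d`. For `d = 2` this is `div_H ∫ f dz = 0`, for `d = 1` it is
`∂_{x₁} ∫ f¹ dz = 0`. -/
def MemSolenoidal {d : ℕ} (hd : d ≤ 2) (f : Torus d → Vel) : Prop :=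
  MemLp f 2 volume ∧
  (∀ᵐ x : Torus d, f (x.1, -x.2) = f x) ∧
  ∀ ψ : HTorus d → ℝ, IsSmoothH ψ →
    ∫ x : HTorus d, ∑ i : Fin d,
      (∫ z : Circle2Pi, f (x, z) (Fin.castLE hd i)) * partialDerivH i ψ x = 0

/-! ### The primitive equations -/

/-- `div_H v = ∑_{i ≤ d} ∂_i vⁱ`. -/
def divH {d : ℕ} (hd : d ≤ 2) (f : L2 d) (x : Torus d) : ℝ :=
  ∑ i : Fin d, weakPartial (some i) f x (Fin.castLE hd i)

/-- The vertical velocity `w(x_H, z) = ∫_z^π div_H v(x_H, ζ) dζ`, with `z ∈ (-π, π]`. -/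
def vertVel {d : ℕ} (hd : d ≤ 2) (f : L2 d) (x : Torus d) : ℝ :=
  ∫ ζ in ((AddCircle.equivIoc (2 * Real.pi) (-Real.pi) x.2 : ℝ))..Real.pi,
    divH hd f (x.1, (ζ : Circle2Pi))

/-- The components of the transporting velocity: `u = (v¹, v², w)` for `d = 2` and
`u = (v¹, w)` for `d = 1`. -/
def transport {d : ℕ} (hd : d ≤ 2) (f : L2 d) : Option (Fin d) → Torus d → ℝ
  | some i, x => f x (Fin.castLE hd i)
  | none, x => vertVel hd f x

/-- `φ ∈ C([0,∞); C¹ ∩ 𝓗) ∩ C¹([0,∞); C(𝕋^d × 𝕋))` with compact support in time, with time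
derivative `φ'` and spatial partial derivatives `Dφ j`. Only times `t ≥ 0` matter. -/
structure IsTestFunction {d : ℕ} (hd : d ≤ 2) (φ φ' : ℝ → C(Torus d, Vel))
    (Dφ : Option (Fin d) → ℝ → C(Torus d, Vel)) : Prop where
  solenoidal : ∀ t, 0 ≤ t → MemSolenoidal hd (φ t)
  time_deriv : ∀ t, 0 ≤ t → HasDerivWithinAt φ (φ' t) (Ici 0) t
  time_deriv_cont : ContinuousOn φ' (Ici 0)
  space_deriv : ∀ j t x, 0 ≤ t →
    HasDerivAt (fun s : ℝ => φ t (x + shift j s)) (Dφ j t x) 0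
  space_deriv_cont : ∀ j, ContinuousOn (Dφ j) (Ici 0)
  compact_support : ∃ R : ℝ, ∀ t, R ≤ t → φ t = 0

/-- `v` is a weak solution of the primitive equations with initial value `v₀`:
the three-dimensional ones for `d = 2`, the two-dimensional ones for `d = 1`. -/
structure IsWeakSolution {d : ℕ} (hd : d ≤ 2) (v : ℝ → L2 d) (v₀ : L2 d) : Prop where
  /-- `v(t) ∈ 𝓗` for all `t ≥ 0` -/
  solenoidal : ∀ t, 0 ≤ t → MemSolenoidal hd (v t)
  /-- `v ∈ C_w([0,∞); L²)` -/
  weak_cont : ∀ g : L2 d, ContinuousOn (fun t => inner ℝ (v t) g) (Ici 0)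
  /-- `v ∈ L²_loc([0,∞); H¹)` -/
  mem_H1 : ∀ᵐ t : ℝ, 0 < t → MemH1 (v t)
  memLp : ∀ R : ℝ, MemLp v 2 (volume.restrict (Ioo 0 R))
  memLp_grad : ∀ (R : ℝ) (j : Option (Fin d)),
    MemLp (fun t => weakPartial j (v t)) 2 (volume.restrict (Ioo 0 R))
  /-- the equation in the weak sense -/
  weak_form : ∀ (φ φ' : ℝ → C(Torus d, Vel)) (Dφ : Option (Fin d) → ℝ → C(Torus d, Vel)),
    IsTestFunction hd φ φ' Dφ →
      - (∫ τ in Ioi (0 : ℝ), ∫ x, inner ℝ (v τ x) (φ' τ x))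
      + (∫ τ in Ioi (0 : ℝ), ∫ x, ∑ j : Option (Fin d),
          inner ℝ (weakPartial j (v τ) x) (Dφ j τ x))
      - (∫ τ in Ioi (0 : ℝ), ∫ x, ∑ j : Option (Fin d),
          transport hd (v τ) j x * inner ℝ (v τ x) (Dφ j τ x))
      = ∫ x, inner ℝ (v₀ x) (φ 0 x)

/-! ### Anisotropic homogeneous toroidal Besov norms -/

/-- A cutoff function for the Littlewood–Paley decomposition. -/
structure IsCutoff (χ : ℝ → ℝ) : Prop where
  smooth : ContDiff ℝ ∞ χ
  even : ∀ ξ, χ (-ξ) = χ ξ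
  eq_one : ∀ ξ, |ξ| ≤ 1 / 2 → χ ξ = 1
  eq_zero : ∀ ξ, 1 ≤ |ξ| → χ ξ = 0

/-- `ρ_j(ξ) = ρ(2^{-j} ξ)` with `ρ(ξ) = χ(ξ/2) - χ(ξ)`. -/
def lpSymbol (χ : ℝ → ℝ) (j : ℤ) (ξ : ℝ) : ℝ :=
  χ ((2 : ℝ) ^ (-j) * ξ / 2) - χ ((2 : ℝ) ^ (-j) * ξ)

/-- `φ_j(z) = ∑_k ρ_j(k) e^{ikz}`. Only finitely many terms are nonzero, and the sum is real
because `ρ_j` is even. -/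
def lpKernel (χ : ℝ → ℝ) (j : ℤ) (z : Circle2Pi) : ℝ :=
  (∑' k : ℤ, (lpSymbol χ j k : ℂ) * fourier k z).re

/-- `(φ_j *_z f)(x_H, z) = ∫ φ_j(z - ζ) f(x_H, ζ) dζ`. -/
def lpBlock {d : ℕ} (χ : ℝ → ℝ) (j : ℤ) (f : Torus d → Vel) (x : Torus d) : Vel :=
  ∫ ζ : Circle2Pi, lpKernel χ j (x.2 - ζ) • f (x.1, ζ)

/-- `‖f‖_{L^p_z L^∞_H}`, the `L^p` norm in `z` of the `L^∞` norm in `x_H`. -/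
def mixedNorm {d : ℕ} (p : ℝ) (f : Torus d → Vel) : ℝ≥0∞ :=
  eLpNorm (fun z : Circle2Pi => eLpNorm (fun x : HTorus d => f (x, z)) ∞ volume)
    (ENNReal.ofReal p) volume

/-- The norm of `Ḃ^s_{p,∞,z} L^∞_H`: `sup_{j ∈ ℤ} 2^{sj} ‖φ_j *_z f‖_{L^p_z L^∞_H}`. -/
def besovNorm {d : ℕ} (χ : ℝ → ℝ) (s p : ℝ) (f : Torus d → Vel) : ℝ≥0∞ :=
  ⨆ j : ℤ, ENNReal.ofReal ((2 : ℝ) ^ (s * (j : ℝ))) * mixedNorm p (lpBlock χ j f)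

/-- `v ∈ L^r(0, T; Ḃ^s_{p,∞,z} L^∞_H)`. -/
def MemLpBesov {d : ℕ} (χ : ℝ → ℝ) (r T s p : ℝ) (v : ℝ → L2 d) : Prop :=
  MemLp (fun t => besovNorm χ s p (v t)) (ENNReal.ofReal r) (volume.restrict (Ioo 0 T))

end

end PrimitiveEq

set_option linter.unusedSectionVars false
set_option linter.overlappingInstances false

namespace PrimitiveEq

open MeasureTheory Set Filter Topology Measure
open scoped ENNReal ContDiff

noncomputable section

/-! ### Convolution and correlation on compact abelian groups -/

/-! The proof has two independent halves: the Besov condition with exponent `γ` puts `v` in `L⁴` of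
space-time, and every weak solution in `L⁴` satisfies the energy equality.

For the second half, test the equation with `κ * v`, where `κ` is a smooth even kernel. Two
applications of the equation, at times `a` and `b`, together with the symmetry of `κ`, give a
formula for the increment of `⟨v, κ * v⟩` over `[a, b]`. Refining partitions and using only weak
continuity yields the mollified energy identity (`energy_of_symm_diff`,
`IsWeakSolution.energy_conv`); no regularisation in time is needed.

The difficulty in removing `κ` is the vertical transport `w v · ∂_z v`. The component `w` is merely
in `L²`, and its only controlled derivative is `∂_z w = -div_H v`, also in `L²`. So `κ` is a
vertical Steklov average of width `h` of an approximate identity with index `m`, and `m → ∞` is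
taken first. Every pairing with a mollified field is an average of a correlation `y ↦ ∫ F(x) · g(x -
y) dx` against the kernel (`integral_inner_conv`). Correlations are continuous, so `m → ∞` merely
evaluates them at displacement zero. What remains is a symmetric vertical difference quotient at
scale `h`. A change of variables moves the difference from `v` to `w` (`corr_smul_sub`), which gives
the bound `‖div_H v‖₂ ‖v‖₄²` uniformly in `h` and the limit `½ ∫ div_H v |v|²`. The horizontal terms
converge to the negative of this (`integral_apply_mul_inner`), so the transport disappears
(`tendsto_corrTransport`). Dominated convergence in time needs exactly `∇v ∈ L²` and `v ∈ L⁴` in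
space-time.

For the `L⁴` bound, split `v` into its vertical mean and the vertical Littlewood–Paley blocks `Δ_j
v`, `j ≥ 0`. The mean is a function on a torus of dimension at most two, so Ladyzhenskaya's
inequality applies. For a block, `‖Δ_j v‖₄⁴ ≤ sup_z ‖Δ_j v(·, z)‖²_{L²_H} · M²` with `M = ‖Δ_j
v‖_{L²_z L^∞_H}`. The supremum is bounded both by `C 2^j ‖v‖₂²` and by `C 2^{-j} ‖∂_z v‖₂²`. If `M ≤
1`, the second bound suffices. If `M > 1`, then `M² ≤ M^γ` and `2^j M^γ = 2^{-j} (2^{2j/γ} M)^γ`,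
where the last bracket is controlled by the Besov norm. Either way a factor `2^{-j}` is gained, the
fourth roots are summable, and `‖v‖₄⁴` is dominated by quantities integrable in time
(`IsCutoff.exists_block_bound`, `IsCutoff.exists_memLp_four_bound`). -/

/-- The convolution `∫ κ(x - y) f(y) dy`. -/
def conv {G E : Type*} [AddCommGroup G] [MeasureSpace G] [NormedAddCommGroup E] [NormedSpace ℝ E]
    (κ : G → ℝ) (f : G → E) (x : G) : E := ∫ y, κ (x - y) • f y

/-- The correlation `∫ ⟪F(x), g(x - h)⟫ dx`. -/
def corr {G E : Type*} [AddCommGroup G] [MeasureSpace G] [NormedAddCommGroup E]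
    [InnerProductSpace ℝ E] (F g : G → E) (h : G) : ℝ := ∫ x, inner ℝ (F x) (g (x - h))

/-- The normalised powers `c ^ m / ∫ c ^ m`. -/
def peakKernel {G : Type*} [MeasureSpace G] (c : G → ℝ) (m : ℕ) (x : G) : ℝ :=
  (∫ y, c y ^ m)⁻¹ * c x ^ m

theorem exists_abs_le_of_continuous {G : Type*} [TopologicalSpace G] [CompactSpace G] {κ : G → ℝ}
    (hκ : Continuous κ) : ∃ C, 0 ≤ C ∧ ∀ x, |κ x| ≤ C := by
  obtain ⟨C, hC⟩ := isCompact_univ.exists_bound_of_continuousOn hκ.continuousOn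
  exact ⟨max C 0, le_max_right _ _, fun x => (hC x (mem_univ _)).trans (le_max_left _ _)⟩

section Group

variable {G : Type*} [AddCommGroup G] [TopologicalSpace G] [IsTopologicalAddGroup G]
  [CompactSpace G] [SecondCountableTopology G] [MeasureSpace G] [BorelSpace G]
  [IsAddHaarMeasure (volume : Measure G)] [Regular (volume : Measure G)]
  {E : Type*} [NormedAddCommGroup E] [InnerProductSpace ℝ E] [CompleteSpace E]

theorem conv_eq_integral_shift (κ : G → ℝ) (f : G → E) (x : G) :
    conv κ f x = ∫ h, κ h • f (x - h) := by
  have h := integral_sub_left_eq_self (fun h => κ h • f (x - h)) (volume : Measure G) x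
  simp only [sub_sub_cancel] at h
  exact h

theorem integrable_kernel_smul {κ : G → ℝ} (hκ : Continuous κ) {f : G → E} (hf : Integrable f)
    (x : G) : Integrable fun y => κ (x - y) • f y := by
  obtain ⟨C, -, hC⟩ := exists_abs_le_of_continuous hκ
  refine hf.bdd_smul C ?_ (ae_of_all _ fun y => hC _)
  exact (hκ.comp (continuous_const.sub continuous_id)).aestronglyMeasurable

theorem continuous_conv {κ : G → ℝ} (hκ : Continuous κ) {f : G → E} (hf : Integrable f) :
    Continuous (conv κ f) := by
  obtain ⟨C, -, hC⟩ := exists_abs_le_of_continuous hκ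
  refine continuous_of_dominated (bound := fun y => C * ‖f y‖)
    (fun x => (integrable_kernel_smul hκ hf x).1) (fun x => ae_of_all _ fun y => ?_)
    (hf.norm.const_mul C) (ae_of_all _ fun y => ?_)
  · rw [norm_smul]; exact mul_le_mul_of_nonneg_right (hC _) (norm_nonneg _)
  · exact (hκ.comp (continuous_id.sub continuous_const)).smul continuous_const

theorem norm_conv_le {κ : G → ℝ} {C : ℝ} (hC : ∀ x, |κ x| ≤ C) {f : G → E} (hf : Integrable f)
    (x : G) : ‖conv κ f x‖ ≤ C * ∫ y, ‖f y‖ := by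
  rw [← integral_const_mul]
  refine norm_integral_le_of_norm_le (hf.norm.const_mul C) (ae_of_all _ fun y => ?_)
  rw [norm_smul]
  exact mul_le_mul_of_nonneg_right (hC _) (norm_nonneg _)

theorem integrable_inner_shift_prod {F g : G → E} (hF : Integrable F) (hg : Integrable g) :
    Integrable (fun q : G × G => inner ℝ (F q.2) (g (q.2 - q.1)))
      ((volume : Measure G).prod volume) := by
  have h := hF.convolution_integrand (innerSL ℝ : E →L[ℝ] E →L[ℝ] ℝ) hg.comp_neg
    (μ := volume) (ν := volume)
  refine h.congr (ae_of_all _ fun q => ?_)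
  simp only [neg_sub]
  rfl

/-- Fubini after the substitution `y = x - h`. Removing a mollifier thereby becomes evaluating a
continuous function at the origin, and all limits in the kernel rest on this. -/
theorem integral_inner_conv {κ : G → ℝ} (hκ : Continuous κ) {F g : G → E} (hF : Integrable F)
    (hg : Integrable g) : ∫ x, inner ℝ (F x) (conv κ g x) = ∫ h, κ h * corr F g h := by
  obtain ⟨C, -, hC⟩ := exists_abs_le_of_continuous hκ
  have hint : Integrable (fun q : G × G => κ q.1 * inner ℝ (F q.2) (g (q.2 - q.1)))
      ((volume : Measure G).prod volume) :=
    (integrable_inner_shift_prod hF hg).bdd_mul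
      (hκ.comp continuous_fst).aestronglyMeasurable (ae_of_all _ fun q => hC q.1)
  calc ∫ x, inner ℝ (F x) (conv κ g x)
      = ∫ x, ∫ h, κ h * inner ℝ (F x) (g (x - h)) := by
        refine integral_congr_ae (ae_of_all _ fun x => ?_)
        simp only [conv_eq_integral_shift]
        rw [← integral_inner]
        · simp only [real_inner_smul_right]
        · have := (integrable_kernel_smul hκ hg x).comp_sub_left x
          simpa using this
    _ = ∫ h, ∫ x, κ h * inner ℝ (F x) (g (x - h)) := (integral_integral_swap hint).symm
    _ = ∫ h, κ h * corr F g h := by simp only [integral_const_mul, corr]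

theorem corr_neg (F g : G → E) (h : G) : corr F g (-h) = corr g F h := by
  unfold corr
  rw [← integral_sub_right_eq_self _ h]
  simp [real_inner_comm]

theorem integral_inner_conv_symm {κ : G → ℝ} (hκ : Continuous κ) (hev : ∀ x, κ (-x) = κ x)
    {F g : G → E} (hF : Integrable F) (hg : Integrable g) :
    ∫ x, inner ℝ (F x) (conv κ g x) = ∫ x, inner ℝ (g x) (conv κ F x) := by
  rw [integral_inner_conv hκ hF hg, integral_inner_conv hκ hg hF,
    ← integral_neg_eq_self (fun h => κ h * corr g F h)]
  simp [hev, corr_neg]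

theorem memLp_comp_sub_right {p : ℝ≥0∞} {g : G → E} (hg : MemLp g p) (h : G) :
    MemLp (fun x => g (x - h)) p :=
  hg.comp_measurePreserving (measurePreserving_sub_right volume h)

theorem eLpNorm_comp_sub_right {p : ℝ≥0∞} {g : G → E} (hg : AEStronglyMeasurable g) (h : G) :
    eLpNorm (fun x => g (x - h)) p = eLpNorm g p :=
  eLpNorm_comp_measurePreserving hg (measurePreserving_sub_right volume h)

theorem abs_integral_inner_le {α : Type*} [MeasurableSpace α] {μ : Measure α} {p q : ℝ≥0∞}
    [hpq : ENNReal.HolderConjugate q p]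
    {F g : α → E} (hF : MemLp F q μ) (hg : MemLp g p μ) :
    |∫ x, inner ℝ (F x) (g x) ∂μ| ≤ (eLpNorm F q μ).toReal * (eLpNorm g p μ).toReal := by
  have h1 : ‖∫ x, inner ℝ (F x) (g x) ∂μ‖ₑ ≤ eLpNorm F q μ * eLpNorm g p μ := by
    refine (enorm_integral_le_lintegral_enorm _).trans ?_
    rw [← eLpNorm_one_eq_lintegral_enorm]
    have := eLpNorm_le_eLpNorm_mul_eLpNorm_of_nnnorm (p := q) (q := p) (r := 1) hF.1 hg.1
      (fun a b : E => inner ℝ a b) 1 (ae_of_all _ fun x => ?_)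
    · simpa using this
    · simpa using nnnorm_inner_le_nnnorm (𝕜 := ℝ) (F x) (g x)
  rw [← Real.norm_eq_abs, ← toReal_enorm, ← ENNReal.toReal_mul]
  exact ENNReal.toReal_mono (ENNReal.mul_ne_top hF.2.ne hg.2.ne) h1

theorem abs_corr_le {p q : ℝ≥0∞} [hpq : ENNReal.HolderConjugate q p]
    {F g : G → E} (hF : MemLp F q) (hg : MemLp g p) (h : G) :
    |corr F g h| ≤ (eLpNorm F q).toReal * (eLpNorm g p).toReal := by
  have := abs_integral_inner_le hF (memLp_comp_sub_right hg h)
  rwa [eLpNorm_comp_sub_right hg.1] at this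

/-- Translation is continuous in `L^p`. -/
theorem continuous_toLp_sub {p : ℝ≥0∞} [Fact (1 ≤ p)] (hp : p ≠ ⊤) {g : G → E}
    (hg : MemLp g p) :
    Continuous fun h : G => (memLp_comp_sub_right hg h).toLp (fun x => g (x - h)) := by
  have : Fact (p ≠ ⊤) := ⟨hp⟩
  have h1 : Continuous fun h : G => (DomAddAct.mk (-h)) +ᵥ (hg.toLp g) :=
    (DomAddAct.continuous_mk.comp continuous_neg).vadd continuous_const
  refine h1.congr fun h => ?_
  rw [DomAddAct.mk_vadd_toLp]
  congr 1
  ext x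
  simp [sub_eq_neg_add]

/-- The correlation is the Hölder pairing of a fixed class with a translate, and translation is
continuous in `L^p` for finite `p`. Only the translated factor has to have a finite exponent. -/
theorem continuous_corr {p q : ℝ≥0∞} [Fact (1 ≤ p)] [Fact (1 ≤ q)]
    [hpq : ENNReal.HolderConjugate q p] (hp : p ≠ ⊤)
    {F g : G → E} (hF : MemLp F q) (hg : MemLp g p) : Continuous (corr F g) := by
  have h1 : Continuous fun h : G =>
      (innerSL ℝ : E →L[ℝ] E →L[ℝ] ℝ).lpPairing volume q p (hF.toLp F)
        ((memLp_comp_sub_right hg h).toLp (fun x => g (x - h))) :=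
    (ContinuousLinearMap.continuous _).comp (continuous_toLp_sub hp hg)
  refine h1.congr fun h => ?_
  rw [ContinuousLinearMap.lpPairing_eq_integral]
  refine integral_congr_ae ?_
  filter_upwards [hF.coeFn_toLp, (memLp_comp_sub_right hg h).coeFn_toLp] with x h1 h2
  rw [h1, h2]; rfl

theorem memLp_conv {κ : G → ℝ} (hκ : Continuous κ) {g : G → E} (hg : Integrable g) (p : ℝ≥0∞) :
    MemLp (conv κ g) p := by
  have h := continuous_conv hκ hg
  obtain ⟨C, hC⟩ := isCompact_univ.exists_bound_of_continuousOn h.continuousOn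
  exact MemLp.of_bound h.aestronglyMeasurable C (ae_of_all _ fun x => hC x (mem_univ _))

/-- A nonnegative continuous even function with a strict maximum at the origin. -/
structure IsPeak (c : G → ℝ) : Prop where
  cont : Continuous c
  nonneg : ∀ x, 0 ≤ c x
  pos : 0 < c 0
  lt : ∀ x, x ≠ 0 → c x < c 0
  even : ∀ x, c (-x) = c x

/-! ### Approximate identities formed by normalised powers of a peak function -/

namespace IsPeak

variable {c : G → ℝ}

theorem continuous_peakKernel (hc : IsPeak c) (m : ℕ) : Continuous (peakKernel c m) :=
  continuous_const.mul (hc.cont.pow m)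

theorem peakKernel_neg (hc : IsPeak c) (m : ℕ) (x : G) : peakKernel c m (-x) = peakKernel c m x := by
  simp [peakKernel, hc.even]

theorem integral_pow_pos (hc : IsPeak c) (m : ℕ) : 0 < ∫ x, c x ^ m := by
  have hcont : Continuous fun x => c x ^ m := hc.cont.pow m
  refine hcont.integral_pos_of_hasCompactSupport_nonneg_nonzero
    (HasCompactSupport.of_compactSpace _) (fun x => pow_nonneg (hc.nonneg x) m) (x := 0) ?_
  exact (pow_pos hc.pos m).ne'

theorem peakKernel_nonneg (hc : IsPeak c) (m : ℕ) (x : G) : 0 ≤ peakKernel c m x :=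
  mul_nonneg (inv_nonneg.2 (hc.integral_pow_pos m).le) (pow_nonneg (hc.nonneg x) m)

theorem integral_peakKernel (hc : IsPeak c) (m : ℕ) : ∫ x, peakKernel c m x = 1 := by
  simp only [peakKernel, integral_const_mul]
  exact inv_mul_cancel₀ (hc.integral_pow_pos m).ne'

/-- Laplace's method: on a compact space the powers of a nonnegative function with a strict global
maximum concentrate at the maximum point. -/
theorem tendsto_peakKernel [T2Space G] (hc : IsPeak c) {Φ : G → ℝ} (hΦ : Continuous Φ) :
    Tendsto (fun m => ∫ x, peakKernel c m x * Φ x) atTop (𝓝 (Φ 0)) := by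
  have : TopologicalSpace.MetrizableSpace G :=
    TopologicalSpace.metrizableSpace_of_t3_secondCountable G
  have h := tendsto_setIntegral_pow_smul_of_unique_maximum_of_isCompact_of_continuousOn
    (μ := (volume : Measure G)) (x₀ := (0 : G)) (g := Φ) isCompact_univ hc.cont.continuousOn
    (fun y _ hy => hc.lt y hy) (fun x _ => hc.nonneg x) hc.pos (by simp) hΦ.continuousOn
  refine h.congr fun m => ?_
  simp only [peakKernel, mul_assoc, integral_const_mul, smul_eq_mul, setIntegral_univ]

theorem abs_integral_peakKernel_mul_le (hc : IsPeak c) (m : ℕ) {Φ : G → ℝ} {B : ℝ}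
    (hB : ∀ x, |Φ x| ≤ B) : |∫ x, peakKernel c m x * Φ x| ≤ B := by
  have hint : Integrable (peakKernel c m) :=
    (hc.continuous_peakKernel m).integrable_of_hasCompactSupport (HasCompactSupport.of_compactSpace _)
  calc |∫ x, peakKernel c m x * Φ x| ≤ ∫ x, peakKernel c m x * B := by
        rw [← Real.norm_eq_abs]
        refine norm_integral_le_of_norm_le (hint.mul_const B) (ae_of_all _ fun x => ?_)
        rw [norm_mul, Real.norm_of_nonneg (hc.peakKernel_nonneg m x)]
        exact mul_le_mul_of_nonneg_left (hB x) (hc.peakKernel_nonneg m x)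
    _ = B := by rw [integral_mul_const, hc.integral_peakKernel, one_mul]

theorem tendsto_integral_inner_conv [T2Space G] (hc : IsPeak c) {F g : G → E} (hF : MemLp F 2)
    (hg : MemLp g 2) :
    Tendsto (fun m => ∫ x, inner ℝ (F x) (conv (peakKernel c m) g x)) atTop
      (𝓝 (∫ x, inner ℝ (F x) (g x))) := by
  have h := hc.tendsto_peakKernel (continuous_corr (p := 2) (q := 2) ENNReal.ofNat_ne_top hF hg)
  have h0 : corr F g 0 = ∫ x, inner ℝ (F x) (g x) := by simp only [corr, sub_zero]
  rw [h0] at h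
  refine h.congr fun m => ?_
  rw [integral_inner_conv (hc.continuous_peakKernel m) (hF.integrable one_le_two)
    (hg.integrable one_le_two)]

/-- Duality in place of Young's inequality: with `u` the mollified function, `‖u‖²` is an average of
the correlation of `u` with `g`, hence at most `‖u‖ ‖g‖`. -/
theorem eLpNorm_conv_le (hc : IsPeak c) (m : ℕ) {g : G → E} (hg : MemLp g 2) :
    eLpNorm (conv (peakKernel c m) g) 2 ≤ eLpNorm g 2 := by
  have hgi : Integrable g := hg.integrable one_le_two
  have hκ := hc.continuous_peakKernel m
  set u := conv (peakKernel c m) g with hu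
  have hum : MemLp u 2 := memLp_conv hκ hgi 2
  have h1 : ∫ x, inner ℝ (u x) (u x) ≤ (eLpNorm u 2).toReal * (eLpNorm g 2).toReal := by
    rw [hu, integral_inner_conv hκ (hum.integrable one_le_two) hgi]
    exact (le_abs_self _).trans
      (hc.abs_integral_peakKernel_mul_le m fun h => abs_corr_le hum hg h)
  have h2 : ∫ x, inner ℝ (u x) (u x) = (eLpNorm u 2).toReal ^ 2 := by
    have h3 := L2.inner_def (𝕜 := ℝ) (hum.toLp u) (hum.toLp u)
    rw [real_inner_self_eq_norm_sq, Lp.norm_toLp] at h3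
    rw [h3]
    refine integral_congr_ae ?_
    filter_upwards [hum.coeFn_toLp] with x hx
    rw [hx]
  rw [h2] at h1
  rw [← ENNReal.toReal_le_toReal hum.2.ne hg.2.ne]
  rcases (ENNReal.toReal_nonneg (a := eLpNorm u 2)).eq_or_lt with h0 | h0
  · rw [← h0]; exact ENNReal.toReal_nonneg
  · nlinarith

/-- In a Hilbert space `‖u_m‖ ≤ ‖g‖` and `⟨g, u_m⟩ → ‖g‖²` force strong convergence, because `‖u_m -
g‖² ≤ 2‖g‖² - 2⟨g, u_m⟩`. -/
theorem tendsto_eLpNorm_conv_sub [T2Space G] (hc : IsPeak c) {g : G → E} (hg : MemLp g 2) :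
    Tendsto (fun m => eLpNorm (fun x => conv (peakKernel c m) g x - g x) 2) atTop (𝓝 0) := by
  have hgi : Integrable g := hg.integrable one_le_two
  have hu : ∀ m, MemLp (conv (peakKernel c m) g) 2 := fun m =>
    memLp_conv (hc.continuous_peakKernel m) hgi 2
  set gL := hg.toLp g
  set uL : ℕ → Lp E 2 (volume : Measure G) := fun m => (hu m).toLp _
  have hin : Tendsto (fun m => inner ℝ gL (uL m)) atTop (𝓝 (‖gL‖ ^ 2)) := by
    rw [← real_inner_self_eq_norm_sq, L2.inner_def]
    have h := hc.tendsto_integral_inner_conv hg hg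
    have h0 : ∫ x, inner ℝ (gL x) (gL x) = ∫ x, inner ℝ (g x) (g x) := by
      refine integral_congr_ae ?_
      filter_upwards [hg.coeFn_toLp] with x hx
      rw [hx]
    rw [h0]
    refine h.congr fun m => ?_
    rw [L2.inner_def]
    refine integral_congr_ae ?_
    filter_upwards [hg.coeFn_toLp, (hu m).coeFn_toLp] with x hx hx'
    rw [hx, hx']
  have hle : ∀ m, ‖uL m‖ ≤ ‖gL‖ := fun m => by
    rw [Lp.norm_toLp, Lp.norm_toLp]
    exact ENNReal.toReal_mono hg.2.ne (hc.eLpNorm_conv_le m hg)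
  have hsq : Tendsto (fun m => ‖uL m - gL‖ ^ 2) atTop (𝓝 0) := by
    refine squeeze_zero (g := fun m => 2 * ‖gL‖ ^ 2 - 2 * inner ℝ gL (uL m))
      (fun m => sq_nonneg _) (fun m => ?_) ?_
    · rw [norm_sub_sq_real, real_inner_comm]
      nlinarith [hle m, norm_nonneg (uL m), norm_nonneg gL]
    · have := (hin.const_mul 2).const_sub (2 * ‖gL‖ ^ 2)
      rwa [sub_self] at this
  have hn : Tendsto (fun m => ‖uL m - gL‖) atTop (𝓝 0) := by
    have := hsq.sqrt
    simpa [Real.sqrt_sq (norm_nonneg _)] using this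
  have h3 := ENNReal.tendsto_ofReal hn
  rw [ENNReal.ofReal_zero] at h3
  refine h3.congr fun m => ?_
  rw [← MemLp.toLp_sub, Lp.norm_toLp, ENNReal.ofReal_toReal ((hu m).sub hg).2.ne]
  rfl

/-- Makes it possible to prove almost everywhere identities by testing with the trigonometric
kernels only. -/
theorem ae_eq_zero_of_conv_eq_zero [T2Space G] (hc : IsPeak c) {g : G → E} (hg : MemLp g 2)
    (h : ∀ m x, conv (peakKernel c m) g x = 0) : g =ᵐ[volume] 0 := by
  have h1 := hc.tendsto_eLpNorm_conv_sub hg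
  simp only [h, zero_sub] at h1
  have h2 := tendsto_nhds_unique h1 tendsto_const_nhds
  have h3 : eLpNorm g 2 = 0 := by
    rw [← eLpNorm_neg]; exact h2.symm
  exact (eLpNorm_eq_zero_iff hg.1 two_ne_zero).1 h3

end IsPeak

end Group

/-- A uniform `L^q` bound passes to an `L²` limit. -/
theorem eLpNorm_le_of_tendsto_eLpNorm_two {α E : Type*} [MeasurableSpace α] {μ : Measure α}
    [NormedAddCommGroup E] {u : ℕ → α → E} {g : α → E} (hu : ∀ n, AEStronglyMeasurable (u n) μ)
    (hg : AEStronglyMeasurable g μ)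
    (h : Tendsto (fun n => eLpNorm (fun x => u n x - g x) 2 μ) atTop (𝓝 0)) {q B : ℝ≥0∞}
    (hB : ∀ n, eLpNorm (u n) q μ ≤ B) : eLpNorm g q μ ≤ B := by
  obtain ⟨ns, -, hns⟩ := (tendstoInMeasure_of_tendsto_eLpNorm two_ne_zero hu hg h).exists_seq_tendsto_ae
  refine (Lp.eLpNorm_lim_le_liminf_eLpNorm (fun n => hu (ns n)) g hns).trans ?_
  exact liminf_le_of_le (by isBoundedDefault) fun b hb => by
    obtain ⟨n, hn⟩ := hb.exists
    exact hn.trans (hB _)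

end

noncomputable section

/-! ### Smooth functions on the torus -/

instance instIsAddHaarMeasureTorus (d : ℕ) : IsAddHaarMeasure (volume : Measure (Torus d)) :=
  Measure.prod.instIsAddHaarMeasure volume volume

instance instRegularTorus (d : ℕ) : Regular (volume : Measure (Torus d)) :=
  Regular.of_sigmaCompactSpace_of_isLocallyFiniteMeasure volume

/-- The covering map `ℝ^d × ℝ → 𝕋^d × 𝕋`. -/
def coverMap {d : ℕ} (y : (Fin d → ℝ) × ℝ) : Torus d :=
  (fun i => (y.1 i : Circle2Pi), (y.2 : Circle2Pi))

/-- The coordinate vectors of `ℝ^d × ℝ`. -/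
def dirVec {d : ℕ} : Option (Fin d) → (Fin d → ℝ) × ℝ
  | some i => (Pi.single i 1, 0)
  | none => (0, 1)

variable {d : ℕ}

/-- Continuity on the torus can be checked on the periodic lift, and every point has a lift, so
calculus is done in `ℝ^d × ℝ`. -/
theorem isOpenQuotientMap_coverMap : IsOpenQuotientMap (coverMap (d := d)) := by
  have h1 : IsOpenQuotientMap (fun y : ℝ => (y : Circle2Pi)) := QuotientAddGroup.isOpenQuotientMap_mk
  have h2 : IsOpenQuotientMap (fun (y : Fin d → ℝ) (i : Fin d) => (y i : Circle2Pi)) :=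
    ⟨fun x => ⟨fun i => (h1.surjective (x i)).choose,
        funext fun i => (h1.surjective (x i)).choose_spec⟩,
      continuous_pi fun i => h1.continuous.comp (continuous_apply i),
      IsOpenMap.piMap (fun _ => h1.isOpenMap) (by simp)⟩
  exact h2.prodMap h1

theorem coverMap_add (y y' : (Fin d → ℝ) × ℝ) : coverMap (y + y') = coverMap y + coverMap y' := by
  simp only [coverMap, Prod.fst_add, Prod.snd_add, Pi.add_apply, AddCircle.coe_add]
  rfl

theorem coverMap_sub (y y' : (Fin d → ℝ) × ℝ) : coverMap (y - y') = coverMap y - coverMap y' := by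
  simp only [coverMap, Prod.fst_sub, Prod.snd_sub, Pi.sub_apply, AddCircle.coe_sub]
  rfl

theorem coverMap_smul_dirVec (j : Option (Fin d)) (s : ℝ) : coverMap (s • dirVec j) = shift j s := by
  rcases j with _ | i
  · simp only [coverMap, dirVec, shift, Prod.smul_fst, Prod.smul_snd, smul_zero, smul_eq_mul,
      mul_one, Pi.zero_apply, AddCircle.coe_zero]
    rfl
  · simp only [coverMap, dirVec, shift, Prod.smul_fst, Prod.smul_snd, smul_zero,
      AddCircle.coe_zero, Prod.mk.injEq, and_true]
    ext k
    by_cases hk : k = i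
    · subst hk; simp
    · simp [hk]

theorem shift_add (j : Option (Fin d)) (s t : ℝ) : shift j (s + t) = shift j s + shift j t := by
  rw [← coverMap_smul_dirVec, ← coverMap_smul_dirVec, ← coverMap_smul_dirVec, add_smul, coverMap_add]

theorem shift_zero (j : Option (Fin d)) : shift j 0 = 0 := by
  have := shift_add j 0 0
  simpa using this

theorem shift_neg (j : Option (Fin d)) (s : ℝ) : shift j (-s) = -shift j s := by
  rw [eq_neg_iff_add_eq_zero, ← shift_add, neg_add_cancel, shift_zero]

theorem continuous_shift (j : Option (Fin d)) : Continuous (shift j) := by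
  have h : Continuous fun s : ℝ => coverMap (s • dirVec j) :=
    isOpenQuotientMap_coverMap.continuous.comp (continuous_id.smul continuous_const)
  exact h.congr (coverMap_smul_dirVec j)

namespace IsSmooth

variable {ψ : Torus d → ℝ}

theorem continuous (hψ : IsSmooth ψ) : Continuous ψ :=
  isOpenQuotientMap_coverMap.continuous_comp_iff.1 (ContDiff.continuous hψ)

theorem hasDerivAt_coverMap (hψ : IsSmooth ψ) (j : Option (Fin d)) (y : (Fin d → ℝ) × ℝ) :
    HasDerivAt (fun s : ℝ => ψ (coverMap y + shift j s))
      (fderiv ℝ (ψ ∘ coverMap) y (dirVec j)) 0 := by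
  have h1 : HasFDerivAt (ψ ∘ coverMap) (fderiv ℝ (ψ ∘ coverMap) y) (y + (0 : ℝ) • dirVec j) := by
    rw [zero_smul, add_zero]
    exact ((ContDiff.differentiable hψ (by simp)) y).hasFDerivAt
  have h2 : HasDerivAt (fun s : ℝ => y + s • dirVec j) (dirVec j) 0 := by
    simpa using ((hasDerivAt_id (0 : ℝ)).smul_const (dirVec j)).const_add y
  have h3 := h1.comp_hasDerivAt (0 : ℝ) h2
  refine h3.congr_of_eventuallyEq (Eventually.of_forall fun s => ?_)
  simp only [Function.comp, coverMap_add, coverMap_smul_dirVec]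

theorem partialDeriv_coverMap (hψ : IsSmooth ψ) (j : Option (Fin d)) (y : (Fin d → ℝ) × ℝ) :
    partialDeriv j ψ (coverMap y) = fderiv ℝ (ψ ∘ coverMap) y (dirVec j) :=
  (hψ.hasDerivAt_coverMap j y).deriv

theorem hasDerivAt_zero (hψ : IsSmooth ψ) (j : Option (Fin d)) (x : Torus d) :
    HasDerivAt (fun s : ℝ => ψ (x + shift j s)) (partialDeriv j ψ x) 0 := by
  obtain ⟨y, rfl⟩ := isOpenQuotientMap_coverMap.surjective x
  rw [hψ.partialDeriv_coverMap]
  exact hψ.hasDerivAt_coverMap j y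

theorem hasDerivAt (hψ : IsSmooth ψ) (j : Option (Fin d)) (x : Torus d) (t : ℝ) :
    HasDerivAt (fun s : ℝ => ψ (x + shift j s)) (partialDeriv j ψ (x + shift j t)) t := by
  have h := hψ.hasDerivAt_zero j (x + shift j t)
  rw [← sub_self t] at h
  have h3 := HasDerivAt.comp_sub_const t t h
  refine h3.congr_of_eventuallyEq (Eventually.of_forall fun s => ?_)
  simp only [add_assoc, ← shift_add, add_sub_cancel]

theorem continuous_partialDeriv (hψ : IsSmooth ψ) (j : Option (Fin d)) :
    Continuous (partialDeriv j ψ) := by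
  rw [← isOpenQuotientMap_coverMap.continuous_comp_iff]
  have h : Continuous fun y => fderiv ℝ (ψ ∘ coverMap) y (dirVec j) :=
    (ContDiff.continuous_fderiv hψ (by simp)).clm_apply continuous_const
  exact h.congr fun y => (hψ.partialDeriv_coverMap j y).symm

theorem comp_sub_left (hψ : IsSmooth ψ) (x : Torus d) : IsSmooth fun y => ψ (x - y) := by
  obtain ⟨a, rfl⟩ := isOpenQuotientMap_coverMap.surjective x
  have h : ContDiff ℝ ∞ fun y => (ψ ∘ coverMap) (a - y) :=
    ContDiff.comp (g := ψ ∘ coverMap) hψ (contDiff_const.sub contDiff_id)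
  simp only [Function.comp, coverMap_sub] at h
  exact h

theorem partialDeriv_comp_sub_left (hψ : IsSmooth ψ) (j : Option (Fin d)) (x y : Torus d) :
    partialDeriv j (fun y => ψ (x - y)) y = -partialDeriv j ψ (x - y) := by
  have h := hψ.hasDerivAt_zero j (x - y)
  rw [← neg_zero] at h
  have h3 := HasDerivAt.comp (0 : ℝ) h (hasDerivAt_neg (0 : ℝ))
  rw [mul_neg_one] at h3
  refine HasDerivAt.deriv (h3.congr_of_eventuallyEq (Eventually.of_forall fun s => ?_))
  simp only [Function.comp, shift_neg]
  congr 1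
  abel

theorem hasDerivAt_conv (hψ : IsSmooth ψ) {E : Type*} [NormedAddCommGroup E] [InnerProductSpace ℝ E]
    [CompleteSpace E] {f : Torus d → E} (hf : Integrable f) (j : Option (Fin d)) (x : Torus d)
    (t : ℝ) : HasDerivAt (fun s : ℝ => conv ψ f (x + shift j s))
      (conv (partialDeriv j ψ) f (x + shift j t)) t := by
  obtain ⟨C, -, hC⟩ := exists_abs_le_of_continuous (hψ.continuous_partialDeriv j)
  refine (hasDerivAt_integral_of_dominated_loc_of_deriv_le (s := univ)
    (F := fun s y => ψ (x + shift j s - y) • f y)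
    (F' := fun s y => partialDeriv j ψ (x + shift j s - y) • f y)
    (bound := fun y => C * ‖f y‖) univ_mem
    (Eventually.of_forall fun s => (integrable_kernel_smul hψ.continuous hf _).1)
    (integrable_kernel_smul hψ.continuous hf _)
    (integrable_kernel_smul (hψ.continuous_partialDeriv j) hf _).1
    (ae_of_all _ fun y s _ => ?_) (hf.norm.const_mul C) (ae_of_all _ fun y s _ => ?_)).2
  · rw [norm_smul]; exact mul_le_mul_of_nonneg_right (hC _) (norm_nonneg _)
  · have h := hψ.hasDerivAt j (x - y) s
    simp only [sub_add_eq_add_sub] at h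
    exact h.smul_const (f y)

/-- The reflected and translated kernel `y ↦ ψ(x - y)` is the test function. The reflection changes
the sign of its derivative, which cancels the minus sign in the weak derivative. -/
theorem conv_partialDeriv (hψ : IsSmooth ψ) {j : Option (Fin d)} {f g : L2 d}
    (hfg : IsWeakPartial j f g) (x : Torus d) : conv (partialDeriv j ψ) f x = conv ψ g x := by
  have h := hfg _ (hψ.comp_sub_left x)
  simp only [hψ.partialDeriv_comp_sub_left, neg_smul, integral_neg, neg_inj] at h
  exact h

end IsSmooth

/-! ### Trigonometric peak kernels -/

/-- The cosine on the circle. -/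
def cosC : Circle2Pi → ℝ := Real.cos_periodic.lift

@[simp] theorem cosC_coe (x : ℝ) : cosC (x : Circle2Pi) = Real.cos x := rfl

theorem continuous_cosC : Continuous cosC :=
  (QuotientAddGroup.isOpenQuotientMap_mk (G := ℝ)).continuous_comp_iff.1 Real.continuous_cos

theorem cosC_neg (x : Circle2Pi) : cosC (-x) = cosC x := by
  obtain ⟨y, rfl⟩ := QuotientAddGroup.mk_surjective x
  exact Real.cos_neg y

theorem cosC_zero : cosC 0 = 1 := Real.cos_zero

theorem cosC_le_one (x : Circle2Pi) : cosC x ≤ 1 := by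
  obtain ⟨y, rfl⟩ := QuotientAddGroup.mk_surjective x
  exact Real.cos_le_one y

theorem neg_one_le_cosC (x : Circle2Pi) : -1 ≤ cosC x := by
  obtain ⟨y, rfl⟩ := QuotientAddGroup.mk_surjective x
  exact Real.neg_one_le_cos y

theorem cosC_lt_one {x : Circle2Pi} (hx : x ≠ 0) : cosC x < 1 := by
  refine lt_of_le_of_ne (cosC_le_one x) fun h => hx ?_
  obtain ⟨y, rfl⟩ := QuotientAddGroup.mk_surjective x
  obtain ⟨n, hn⟩ := (Real.cos_eq_one_iff y).1 h
  refine (AddCircle.coe_eq_zero_iff (2 * Real.pi)).2 ⟨n, ?_⟩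
  rw [← hn]; simp

/-- The function `∏ (1 + cos x_i)` on the horizontal torus. -/
def hPeak (d : ℕ) (x : HTorus d) : ℝ := ∏ i, (1 + cosC (x i))

/-- The function `∏ (1 + cos x_i) (1 + cos z)` on the torus. -/
def torusPeak (d : ℕ) (x : Torus d) : ℝ := hPeak d x.1 * (1 + cosC x.2)

theorem hPeak_nonneg (x : HTorus d) : 0 ≤ hPeak d x :=
  Finset.prod_nonneg fun i _ => by linarith [neg_one_le_cosC (x i)]

theorem hPeak_le (x : HTorus d) : hPeak d x ≤ 2 ^ d := by
  have := Finset.prod_le_prod (s := Finset.univ) (f := fun i : Fin d => 1 + cosC (x i))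
    (g := fun _ => (2 : ℝ)) (fun i _ => by linarith [neg_one_le_cosC (x i)])
    (fun i _ => by linarith [cosC_le_one (x i)])
  simpa [hPeak] using this

theorem hPeak_zero : hPeak d 0 = 2 ^ d := by
  simp only [hPeak, Pi.zero_apply, cosC_zero, Finset.prod_const, Finset.card_univ, Fintype.card_fin]
  norm_num

theorem hPeak_lt {x : HTorus d} (hx : x ≠ 0) : hPeak d x < 2 ^ d := by
  obtain ⟨i, hi⟩ := Function.ne_iff.1 hx
  have h1 : ∏ k ∈ Finset.univ.erase i, (1 + cosC (x k)) ≤ 2 ^ (d - 1) := by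
    have := Finset.prod_le_prod (s := Finset.univ.erase i) (f := fun i : Fin d => 1 + cosC (x i))
      (g := fun _ => (2 : ℝ)) (fun i _ => by linarith [neg_one_le_cosC (x i)])
      (fun i _ => by linarith [cosC_le_one (x i)])
    simpa [Finset.card_erase_of_mem] using this
  have h2 : (2 : ℝ) ^ d = 2 * 2 ^ (d - 1) := by
    rw [← pow_succ']; congr 1; have := i.pos; omega
  have h3 := cosC_lt_one hi
  rw [hPeak, ← Finset.mul_prod_erase _ _ (Finset.mem_univ i), h2]
  have h4 : (0 : ℝ) < 2 ^ (d - 1) := by positivity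
  have h5 := neg_one_le_cosC (x i)
  nlinarith

theorem continuous_hPeak : Continuous (hPeak d) :=
  continuous_finsetProd _ fun i _ =>
    continuous_const.add (continuous_cosC.comp (continuous_apply i))

theorem isPeak_hPeak : IsPeak (hPeak d) where
  cont := continuous_hPeak
  nonneg := hPeak_nonneg
  pos := by rw [hPeak_zero]; positivity
  lt x hx := by rw [hPeak_zero]; exact hPeak_lt hx
  even x := by simp [hPeak, cosC_neg]

theorem isPeak_torusPeak : IsPeak (torusPeak d) where
  cont := (continuous_hPeak.comp continuous_fst).mul
    (continuous_const.add (continuous_cosC.comp continuous_snd))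
  nonneg x := mul_nonneg (hPeak_nonneg _) (by linarith [neg_one_le_cosC x.2])
  pos := by
    simp only [torusPeak, Prod.fst_zero, Prod.snd_zero, hPeak_zero, cosC_zero]; positivity
  lt x hx := by
    simp only [torusPeak, Prod.fst_zero, Prod.snd_zero, hPeak_zero, cosC_zero]
    have h1 := hPeak_le x.1
    have h2 := hPeak_nonneg x.1
    have h3 := cosC_le_one x.2
    have h4 := neg_one_le_cosC x.2
    have h5 : (0 : ℝ) < 2 ^ d := by positivity
    by_cases hz : x.2 = 0
    · have h6 : x.1 ≠ 0 := fun h => hx (Prod.ext h hz)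
      nlinarith [hPeak_lt h6]
    · nlinarith [cosC_lt_one hz]
  even x := by
    simp only [torusPeak, Prod.fst_neg, Prod.snd_neg, cosC_neg]
    rw [isPeak_hPeak.even]

theorem torusPeak_neg_snd (x : Torus d) : torusPeak d (x.1, -x.2) = torusPeak d x := by
  simp [torusPeak, cosC_neg]

/-! ### Vertical Steklov averages and smoothness of the mollifiers -/

/-- The Steklov average in the vertical direction. -/
def steklov (h : ℝ) (κ : Torus d → ℝ) (x : Torus d) : ℝ :=
  (2 * h)⁻¹ * ∫ s in (-h)..h, κ (x + shift none s)

theorem continuous_steklov (h : ℝ) {κ : Torus d → ℝ} (hκ : Continuous κ) :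
    Continuous (steklov h κ) := by
  refine continuous_const.mul
    (intervalIntegral.continuous_parametric_intervalIntegral_of_continuous' ?_ _ _)
  exact hκ.comp (continuous_fst.add ((continuous_shift none).comp continuous_snd))

theorem abs_steklov_le {h : ℝ} (hh : 0 < h) {κ : Torus d → ℝ} {B : ℝ} (hB : ∀ x, |κ x| ≤ B)
    (x : Torus d) : |steklov h κ x| ≤ B := by
  have h1 := intervalIntegral.norm_integral_le_of_norm_le_const (a := -h) (b := h)
    (f := fun s => κ (x + shift none s)) (fun s _ => hB (x + shift none s))
  rw [steklov, abs_mul, abs_of_pos (by positivity : 0 < (2 * h)⁻¹), inv_mul_le_iff₀ (by positivity)]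
  have h2 : |h - -h| = 2 * h := by rw [sub_neg_eq_add, abs_of_pos (by positivity)]; ring
  rw [h2, Real.norm_eq_abs] at h1
  linarith

/-- Averaging over the symmetric interval `[-h, h]` is self-adjoint, so the average can be moved
from the kernel to the correlation. -/
theorem integral_steklov_mul (h : ℝ) {κ Φ : Torus d → ℝ} (hκ : Continuous κ) (hΦ : Continuous Φ) :
    ∫ y, steklov h κ y * Φ y = ∫ y, κ y * steklov h Φ y := by
  have hint : ∀ {κ Φ : Torus d → ℝ}, Continuous κ → Continuous Φ →
      ∫ y, steklov h κ y * Φ y = (2 * h)⁻¹ * ∫ s in (-h)..h, ∫ y, κ (y + shift none s) * Φ y := by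
    intro κ Φ hκ hΦ
    obtain ⟨A, -, hA⟩ := exists_abs_le_of_continuous hκ
    obtain ⟨B, -, hB⟩ := exists_abs_le_of_continuous hΦ
    have hc : Continuous fun q : ℝ × Torus d => κ (q.2 + shift none q.1) * Φ q.2 :=
      (hκ.comp (continuous_snd.add ((continuous_shift none).comp continuous_fst))).mul
        (hΦ.comp continuous_snd)
    have hi : Integrable (Function.uncurry fun (s : ℝ) (y : Torus d) => κ (y + shift none s) * Φ y)
        ((volume.restrict (Set.uIoc (-h) h)).prod volume) := by
      have : IsFiniteMeasure (volume.restrict (Set.uIoc (-h) h)) := by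
        rw [Set.uIoc]; infer_instance
      refine Integrable.of_bound hc.aestronglyMeasurable (A * B) (ae_of_all _ fun q => ?_)
      rw [Function.uncurry, norm_mul]
      exact mul_le_mul (hA _) (hB _) (norm_nonneg _) ((abs_nonneg _).trans (hA 0))
    rw [intervalIntegral_integral_swap hi, ← integral_const_mul]
    refine integral_congr_ae (ae_of_all _ fun y => ?_)
    simp only [steklov, intervalIntegral.integral_mul_const, mul_assoc]
  rw [hint hκ hΦ]
  have h2 : ∫ y, κ y * steklov h Φ y = ∫ y, steklov h Φ y * κ y := by simp only [mul_comm]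
  rw [h2, hint hΦ hκ]
  congr 1
  have h3 := intervalIntegral.integral_comp_neg (a := -h) (b := h)
    (fun s => ∫ y, κ (y + shift none s) * Φ y)
  rw [neg_neg] at h3
  rw [← h3]
  refine intervalIntegral.integral_congr fun s _ => ?_
  simp only [shift_neg]
  rw [← integral_add_right_eq_self _ (shift none s)]
  simp [mul_comm]

theorem hasDerivAt_integral_shift {Φ : Torus d → ℝ} (hΦ : Continuous Φ) (x : Torus d) (t : ℝ) :
    HasDerivAt (fun h => ∫ s in (0 : ℝ)..h, Φ (x + shift none s)) (Φ (x + shift none t)) t := by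
  have hc : Continuous fun s => Φ (x + shift none s) :=
    hΦ.comp (continuous_const.add (continuous_shift none))
  exact intervalIntegral.integral_hasDerivAt_right (hc.intervalIntegrable _ _)
    (hc.stronglyMeasurableAtFilter _ _) hc.continuousAt

theorem integral_shift_sub {Φ : Torus d → ℝ} (hΦ : Continuous Φ) (x : Torus d) (a b : ℝ) :
    ∫ s in a..b, Φ (x + shift none s) = (∫ s in (0 : ℝ)..b, Φ (x + shift none s)) -
      ∫ s in (0 : ℝ)..a, Φ (x + shift none s) := by
  have hc : Continuous fun s => Φ (x + shift none s) :=
    hΦ.comp (continuous_const.add (continuous_shift none))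
  exact (intervalIntegral.integral_interval_sub_left (hc.intervalIntegrable _ _)
    (hc.intervalIntegrable _ _)).symm

theorem tendsto_steklov {Φ : Torus d → ℝ} (hΦ : Continuous Φ) (x : Torus d) :
    Tendsto (fun h => steklov h Φ x) (𝓝[>] 0) (𝓝 (Φ x)) := by
  have h1 : HasDerivAt (fun h => ∫ s in (-h)..h, Φ (x + shift none s)) (2 * Φ x) 0 := by
    have ha := hasDerivAt_integral_shift hΦ x 0
    have hb : HasDerivAt (fun h => ∫ s in (0 : ℝ)..h, Φ (x + shift none s))
      (Φ (x + shift none 0)) (-0) := by rw [neg_zero]; exact ha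
    have hc := ha.sub (HasDerivAt.comp (0 : ℝ) hb (hasDerivAt_neg 0))
    rw [shift_zero, add_zero, mul_neg_one, sub_neg_eq_add, ← two_mul] at hc
    refine hc.congr_of_eventuallyEq (Eventually.of_forall fun h => ?_)
    exact integral_shift_sub hΦ x (-h) h
  have h2 := h1.hasDerivWithinAt (s := Ioi 0)
  rw [hasDerivWithinAt_iff_tendsto_slope' (by simp)] at h2
  have h3 := h2.const_mul (2⁻¹ : ℝ)
  rw [← mul_assoc, inv_mul_cancel₀ two_ne_zero, one_mul] at h3
  refine h3.congr fun h => ?_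
  simp [slope, steklov]
  ring

/-- By the fundamental theorem of calculus the vertical derivative of the averaged kernel is a
difference quotient with no derivative of `κ` left. This is why `κ` may degenerate to a Dirac mass
while `h` stays fixed. -/
theorem partialDeriv_steklov {κ : Torus d → ℝ} (hκ : Continuous κ) (h : ℝ) (x : Torus d) :
    partialDeriv none (steklov h κ) x =
      (2 * h)⁻¹ * (κ (x + shift none h) - κ (x - shift none h)) := by
  have h1 : ∀ a : ℝ, HasDerivAt (fun t => ∫ s in (0 : ℝ)..(t + a), κ (x + shift none s))
      (κ (x + shift none a)) 0 := fun a => by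
    have hb : HasDerivAt (fun h => ∫ s in (0 : ℝ)..h, κ (x + shift none s))
      (κ (x + shift none a)) (0 + a) := by rw [zero_add]; exact hasDerivAt_integral_shift hκ x a
    exact HasDerivAt.comp_add_const 0 a hb
  have h2 := ((h1 h).sub (h1 (-h))).const_mul (2 * h)⁻¹
  rw [shift_neg, ← sub_eq_add_neg] at h2
  refine HasDerivAt.deriv (h2.congr_of_eventuallyEq (Eventually.of_forall fun t => ?_))
  have h3 : ∫ s in (-h)..h, κ (x + shift none t + shift none s) =
      ∫ s in (-h)..h, (fun u => κ (x + shift none u)) (t + s) := by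
    simp only [shift_add, add_assoc]
  simp only [steklov, h3]
  rw [intervalIntegral.integral_comp_add_left (fun u => κ (x + shift none u)) t,
    integral_shift_sub hκ]
  rfl

theorem steklov_neg (h : ℝ) {κ : Torus d → ℝ} (hev : ∀ x, κ (-x) = κ x) (x : Torus d) :
    steklov h κ (-x) = steklov h κ x := by
  have h3 := intervalIntegral.integral_comp_neg (a := -h) (b := h)
    (fun s => κ (-x + shift none s))
  rw [neg_neg] at h3
  simp only [steklov, ← h3, shift_neg, ← neg_add, hev]

theorem steklov_neg_snd (h : ℝ) {κ : Torus d → ℝ} (hev : ∀ x : Torus d, κ (x.1, -x.2) = κ x)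
    (x : Torus d) : steklov h κ (x.1, -x.2) = steklov h κ x := by
  have h3 := intervalIntegral.integral_comp_neg (a := -h) (b := h)
    (fun s => κ ((x.1, -x.2) + shift none s))
  rw [neg_neg] at h3
  simp only [steklov, ← h3, shift_neg]
  congr 1
  refine intervalIntegral.integral_congr fun s _ => ?_
  have := hev (x + shift none s)
  simp only [shift, Prod.fst_add, Prod.snd_add, add_zero, neg_add] at this
  simp only [shift]
  rw [← sub_eq_add_neg, Prod.mk_sub_mk, sub_zero, sub_eq_add_neg, this]

theorem isSmooth_peak_mul (m : ℕ) (a : ℝ) {q : ℝ → ℝ} (hq : ContDiff ℝ ∞ q) {κ : Torus d → ℝ}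
    (hκ : ∀ y : (Fin d → ℝ) × ℝ, κ (coverMap y) = a * (∏ i, (1 + Real.cos (y.1 i))) ^ m * q y.2) :
    IsSmooth κ := by
  have h : ContDiff ℝ ∞ fun y : (Fin d → ℝ) × ℝ =>
      a * (∏ i, (1 + Real.cos (y.1 i))) ^ m * q y.2 := by
    refine (contDiff_const.mul (ContDiff.pow (contDiff_prod fun i _ => ?_) m)).mul
      (hq.comp contDiff_snd)
    exact contDiff_const.add (Real.contDiff_cos.comp
      ((contDiff_apply ℝ ℝ i).comp contDiff_fst))
  have h2 : κ ∘ coverMap = _ := funext hκ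
  rw [← h2] at h
  exact h

theorem isSmooth_peakKernel (m : ℕ) : IsSmooth (peakKernel (torusPeak d) m) := by
  refine isSmooth_peak_mul m (∫ y, torusPeak d y ^ m)⁻¹ (q := fun z => (1 + Real.cos z) ^ m)
    (ContDiff.pow (contDiff_const.add Real.contDiff_cos) m) fun y => ?_
  simp only [peakKernel, torusPeak, hPeak, coverMap, cosC_coe, mul_pow, mul_assoc]

/-- The vertical factor is a difference of two values of a primitive of `(1 + cos)^m`. The primitive
need not be periodic; smoothness of the lift is all that matters. -/
theorem isSmooth_steklov_peakKernel (h : ℝ) (m : ℕ) :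
    IsSmooth (steklov h (peakKernel (torusPeak d) m)) := by
  have hq : ContDiff ℝ ∞ fun z : ℝ => (1 + Real.cos z) ^ m :=
    ContDiff.pow (contDiff_const.add Real.contDiff_cos) m
  have hI : ContDiff ℝ ∞ fun z => ∫ s in (0 : ℝ)..z, (1 + Real.cos s) ^ m := by
    have hd : ∀ z, HasDerivAt (fun z => ∫ s in (0 : ℝ)..z, (1 + Real.cos s) ^ m)
        ((1 + Real.cos z) ^ m) z := fun z =>
      intervalIntegral.integral_hasDerivAt_right (hq.continuous.intervalIntegrable _ _)
        (hq.continuous.stronglyMeasurableAtFilter _ _) hq.continuous.continuousAt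
    rw [contDiff_infty_iff_deriv]
    refine ⟨fun z => (hd z).differentiableAt, ?_⟩
    rwa [funext fun z => (hd z).deriv]
  refine isSmooth_peak_mul m ((2 * h)⁻¹ * (∫ y, torusPeak d y ^ m)⁻¹)
    (q := fun z => (∫ s in (0 : ℝ)..(z + h), (1 + Real.cos s) ^ m) -
      ∫ s in (0 : ℝ)..(z - h), (1 + Real.cos s) ^ m)
    ((hI.comp (contDiff_id.add contDiff_const)).sub (hI.comp (contDiff_id.sub contDiff_const)))
    fun y => ?_
  have h1 : ∀ s : ℝ, peakKernel (torusPeak d) m (coverMap y + shift none s) =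
      (∫ y, torusPeak d y ^ m)⁻¹ * (∏ i, (1 + Real.cos (y.1 i))) ^ m *
        (1 + Real.cos (y.2 + s)) ^ m := fun s => by
    rw [← coverMap_smul_dirVec, ← coverMap_add]
    simp only [peakKernel, torusPeak, hPeak, coverMap, cosC_coe, mul_pow, mul_assoc, dirVec]
    simp
  simp only [steklov, h1, intervalIntegral.integral_const_mul]
  rw [intervalIntegral.integral_comp_add_left (fun u => (1 + Real.cos u) ^ m),
    ← intervalIntegral.integral_interval_sub_left (hq.continuous.intervalIntegrable 0 _)
      (hq.continuous.intervalIntegrable _ _)]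
  simp only [sub_eq_add_neg]
  ring

end

noncomputable section

variable {d : ℕ}

/-! ### Convolution preserves the solenoidal space -/

theorem IsSmoothH.comp_fst {ψ : HTorus d → ℝ} (hψ : IsSmoothH ψ) :
    IsSmooth fun x : Torus d => ψ x.1 :=
  ContDiff.comp (g := fun y : Fin d → ℝ => ψ (fun i => (y i : Circle2Pi))) hψ contDiff_fst

theorem partialDeriv_comp_fst (ψ : HTorus d → ℝ) (i : Fin d) (x : Torus d) :
    partialDeriv (some i) (fun x : Torus d => ψ x.1) x = partialDerivH i ψ x.1 := rfl

theorem IsSmoothH.continuous_partialDerivH {ψ : HTorus d → ℝ} (hψ : IsSmoothH ψ) (i : Fin d) :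
    Continuous (partialDerivH i ψ) := by
  have h := hψ.comp_fst.continuous_partialDeriv (some i)
  exact h.comp (continuous_id.prodMk (continuous_const (y := (0 : Circle2Pi))))

theorem IsSmoothH.comp_add_right {ψ : HTorus d → ℝ} (hψ : IsSmoothH ψ) (a : HTorus d) :
    IsSmoothH fun x => ψ (x + a) := by
  obtain ⟨b, hb⟩ := isOpenQuotientMap_coverMap.surjective ((a, 0) : Torus d)
  have h : ContDiff ℝ ∞ fun y : Fin d → ℝ => (fun y : Fin d → ℝ => ψ (fun i => (y i : Circle2Pi)))
      (y + b.1) := ContDiff.comp (g := fun y : Fin d → ℝ => ψ (fun i => (y i : Circle2Pi))) hψ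
        (contDiff_id.add contDiff_const)
  have ha : a = fun i => (b.1 i : Circle2Pi) := (congrArg Prod.fst hb).symm
  rw [ha]
  exact h

theorem partialDerivH_comp_add_right (ψ : HTorus d → ℝ) (a : HTorus d) (i : Fin d) (x : HTorus d) :
    partialDerivH i (fun x => ψ (x + a)) x = partialDerivH i ψ (x + a) := by
  simp only [partialDerivH, add_right_comm]

/-- The horizontal gradient of `ψ`, as a velocity field on the torus. -/
def gradVel (hd : d ≤ 2) (ψ : HTorus d → ℝ) (x : Torus d) : Vel :=
  ∑ i : Fin d, partialDerivH i ψ x.1 • EuclideanSpace.single (Fin.castLE hd i) (1 : ℝ)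

theorem continuous_gradVel (hd : d ≤ 2) {ψ : HTorus d → ℝ} (hψ : IsSmoothH ψ) :
    Continuous (gradVel hd ψ) :=
  continuous_finsetSum _ fun i _ =>
    ((hψ.continuous_partialDerivH i).comp continuous_fst).smul continuous_const

theorem inner_gradVel (hd : d ≤ 2) (ψ : HTorus d → ℝ) (x : Torus d) (a : Vel) :
    inner ℝ (gradVel hd ψ x) a = ∑ i : Fin d, a (Fin.castLE hd i) * partialDerivH i ψ x.1 := by
  simp only [gradVel, sum_inner, real_inner_smul_left, EuclideanSpace.inner_single_left]
  simp [mul_comm]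

/-- Expresses the distributional constraint as orthogonality to horizontal gradient fields on the
whole torus, a form that behaves well under translation. -/
theorem integral_div_eq_integral_inner (hd : d ≤ 2) {ψ : HTorus d → ℝ} (hψ : IsSmoothH ψ)
    {f : Torus d → Vel} (hf : Integrable f) :
    ∫ x : HTorus d, ∑ i : Fin d,
      (∫ z : Circle2Pi, f (x, z) (Fin.castLE hd i)) * partialDerivH i ψ x =
    ∫ x, inner ℝ (gradVel hd ψ x) (f x) := by
  have hcomp : ∀ i, Integrable fun x : Torus d => f x i := fun i =>
    (EuclideanSpace.proj i : Vel →L[ℝ] ℝ).integrable_comp hf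
  have hterm : ∀ i : Fin d, Integrable fun x : Torus d =>
      f x (Fin.castLE hd i) * partialDerivH i ψ x.1 := fun i => by
    have hc := (hψ.continuous_partialDerivH i).comp (continuous_fst (X := HTorus d) (Y := Circle2Pi))
    obtain ⟨C, -, hC⟩ := exists_abs_le_of_continuous hc
    exact (hcomp _).mul_bdd hc.aestronglyMeasurable (ae_of_all _ fun x => hC x)
  simp only [inner_gradVel]
  rw [volume_eq_prod, integral_prod _ (by
    rw [← volume_eq_prod]; exact integrable_finsetSum _ fun i _ => hterm i)]
  refine integral_congr_ae ?_
  have hs : ∀ᵐ x : HTorus d, ∀ i : Fin d, Integrable fun z : Circle2Pi =>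
      f (x, z) (Fin.castLE hd i) * partialDerivH i ψ x :=
    ae_all_iff.2 fun i => (hterm i).prod_right_ae
  filter_upwards [hs] with x hx
  rw [integral_finsetSum _ fun i _ => hx i]
  simp only [integral_mul_const]

/-- The reflection `(x_H, z) ↦ (x_H, -z)`. -/
def reflectZ : Torus d ≃ᵐ Torus d :=
  MeasurableEquiv.prodCongr (MeasurableEquiv.refl _) (MeasurableEquiv.neg _)

theorem measurePreserving_reflectZ : MeasurePreserving (reflectZ (d := d)) :=
  (MeasurePreserving.id volume).prod (measurePreserving_neg volume)

/-- Evenness follows from the reflection `z ↦ -z` under the integral. For the divergence, the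
correlation of a gradient field with `f` at any displacement is the constraint for a translated
potential, so it vanishes identically. -/
theorem memSolenoidal_conv (hd : d ≤ 2) {κ : Torus d → ℝ} (hκ : Continuous κ)
    (hev : ∀ x : Torus d, κ (x.1, -x.2) = κ x) {f : Torus d → Vel} (hf : MemSolenoidal hd f) :
    MemSolenoidal hd (conv κ f) := by
  have hfi : Integrable f := hf.1.integrable one_le_two
  refine ⟨memLp_conv hκ hfi 2, ae_of_all _ fun x => ?_, fun ψ hψ => ?_⟩
  · unfold conv
    rw [← measurePreserving_reflectZ.integral_comp']
    refine integral_congr_ae ?_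
    filter_upwards [hf.2.1] with y hy
    have h1 : reflectZ y = (y.1, -y.2) := rfl
    rw [h1, hy, ← hev (x - y)]
    congr 2
    ext <;> simp [sub_eq_add_neg, add_comm]
  · have hg := continuous_gradVel hd hψ
    have hgi : Integrable (gradVel hd ψ) :=
      hg.integrable_of_hasCompactSupport (HasCompactSupport.of_compactSpace _)
    rw [integral_div_eq_integral_inner hd hψ ((memLp_conv hκ hfi 1).integrable le_rfl),
      integral_inner_conv hκ hgi hfi]
    have h0 : ∀ h, corr (gradVel hd ψ) f h = 0 := fun h => by
      have h1 := hf.2.2 _ (hψ.comp_add_right h.1)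
      rw [integral_div_eq_integral_inner hd (hψ.comp_add_right h.1) hfi] at h1
      rw [corr, ← integral_add_right_eq_self _ h, ← h1]
      refine integral_congr_ae (ae_of_all _ fun x => ?_)
      simp only [add_sub_cancel_right, inner_gradVel, partialDerivH_comp_add_right, Prod.fst_add]
    simp [h0]

/-! ### Differences of functions with a weak derivative -/

theorem corr_conv_tendsto {P f : Torus d → Vel} (hP : MemLp P 2) (hf : MemLp f 2) (h : Torus d) :
    Tendsto (fun m => corr P (conv (peakKernel (torusPeak d) m) f) h) atTop (𝓝 (corr P f h)) := by
  have hP' : MemLp (fun x => P (x + h)) 2 := by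
    simpa using memLp_comp_sub_right hP (-h)
  have key : ∀ g : Torus d → Vel, corr P g h = ∫ x, inner ℝ (P (x + h)) (g x) := fun g => by
    rw [corr, ← integral_add_right_eq_self _ h]; simp
  simp only [key]
  exact isPeak_torusPeak.tendsto_integral_inner_conv hP' hf

theorem corr_conv_sub_shift {κ : Torus d → ℝ} (hκ : IsSmooth κ) {j : Option (Fin d)} {f g : L2 d}
    (hfg : IsWeakPartial j f g) {P : Torus d → Vel} (hP : MemLp P 2) (y : ℝ) :
    corr P (conv κ f) 0 - corr P (conv κ f) (shift j y) =
      ∫ s in (0 : ℝ)..y, corr P (conv κ g) (shift j s) := by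
  have hfi : Integrable f := (Lp.memLp f).integrable one_le_two
  have hgi : Integrable g := (Lp.memLp g).integrable one_le_two
  have hPi : Integrable P := hP.integrable one_le_two
  have hgc := continuous_conv hκ.continuous hgi
  have hfc := continuous_conv hκ.continuous hfi
  obtain ⟨C, hC⟩ := isCompact_univ.exists_bound_of_continuousOn hgc.continuousOn
  have hline : ∀ x, conv κ f x - conv κ f (x - shift j y) =
      ∫ s in (0 : ℝ)..y, conv κ g (x - shift j s) := fun x => by
    have hd : ∀ s, HasDerivAt (fun s => -conv κ f (x - shift j s)) (conv κ g (x - shift j s)) s :=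
      fun s => by
        have h1 := hκ.hasDerivAt_conv hfi j x (-s)
        rw [hκ.conv_partialDeriv hfg] at h1
        have h2 := (h1.scomp s (hasDerivAt_neg s)).neg
        simp only [Function.comp_def, shift_neg, ← sub_eq_add_neg, neg_smul, one_smul, neg_neg] at h2
        exact h2
    have hcs : Continuous fun s => conv κ g (x - shift j s) :=
      hgc.comp (continuous_const.sub (continuous_shift j))
    rw [intervalIntegral.integral_eq_sub_of_hasDerivAt (fun s _ => hd s)
      (hcs.intervalIntegrable _ _)]
    simp [shift_zero, sub_eq_add_neg, add_comm]
  have hint : ∀ u : Torus d → Vel, Continuous u → ∀ h, Integrable fun x => inner ℝ (P x) (u (x - h)) :=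
    fun u hu h => by
      obtain ⟨B, hB⟩ := isCompact_univ.exists_bound_of_continuousOn hu.continuousOn
      refine (hPi.norm.mul_const B).mono' (hP.1.inner
        (hu.comp (continuous_id.sub continuous_const)).aestronglyMeasurable)
        (ae_of_all _ fun x => (norm_inner_le_norm _ _).trans ?_)
      exact mul_le_mul_of_nonneg_left (hB _ (mem_univ _)) (norm_nonneg _)
  have hfub : Integrable (Function.uncurry fun (s : ℝ) (x : Torus d) =>
      inner ℝ (P x) (conv κ g (x - shift j s)))
      ((volume.restrict (Set.uIoc 0 y)).prod volume) := by
    have : IsFiniteMeasure (volume.restrict (Set.uIoc 0 y)) := by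
      rw [Set.uIoc]; infer_instance
    refine ((hPi.norm.mul_const C).comp_snd _).mono' (AEStronglyMeasurable.inner hP.1.comp_snd
      (Continuous.aestronglyMeasurable ?_)) (ae_of_all _ fun q => ?_)
    · exact hgc.comp (continuous_snd.sub ((continuous_shift j).comp continuous_fst))
    · exact (norm_inner_le_norm _ _).trans
        (mul_le_mul_of_nonneg_left (hC _ (mem_univ _)) (norm_nonneg _))
  simp only [corr]
  rw [intervalIntegral_integral_swap hfub, ← integral_sub (hint _ hfc 0) (hint _ hfc _)]
  refine integral_congr_ae (ae_of_all _ fun x => ?_)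
  simp only [sub_zero, ← inner_sub_right]
  rw [hline]
  have hcs : Continuous fun s => conv κ g (x - shift j s) :=
    hgc.comp (continuous_const.sub (continuous_shift j))
  exact ((innerSL ℝ (P x)).intervalIntegral_comp_comm (hcs.intervalIntegrable 0 y)).symm

/-- For a mollified field this is the fundamental theorem of calculus along translation lines,
integrated against `P`. Both sides are correlations bounded uniformly in the mollifier, so they pass
to the limit. -/
theorem corr_sub_shift {j : Option (Fin d)} {f g : L2 d}
    (hfg : IsWeakPartial j f g) {P : Torus d → Vel} (hP : MemLp P 2) (y : ℝ) :
    corr P f 0 - corr P f (shift j y) = ∫ s in (0 : ℝ)..y, corr P g (shift j s) := by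
  have hf2 := Lp.memLp f
  have hg2 := Lp.memLp g
  have h1 := (corr_conv_tendsto hP hf2 0).sub (corr_conv_tendsto hP hf2 (shift j y))
  refine tendsto_nhds_unique h1 ?_
  simp only [corr_conv_sub_shift (isSmooth_peakKernel _) hfg hP y]
  refine intervalIntegral.tendsto_integral_filter_of_dominated_convergence
    (fun _ => (eLpNorm P 2).toReal * (eLpNorm g 2).toReal)
    (Eventually.of_forall fun m => ?_) (Eventually.of_forall fun m => ae_of_all _ fun s _ => ?_)
    (by simp) (ae_of_all _ fun s _ => corr_conv_tendsto hP hg2 _)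
  · have hm := memLp_conv (isPeak_torusPeak.continuous_peakKernel (G := Torus d) m)
      (hg2.integrable one_le_two) 2
    exact ((continuous_corr (p := 2) (q := 2) ENNReal.ofNat_ne_top hP hm).comp
      (continuous_shift j)).aestronglyMeasurable
  · have hm := memLp_conv (isPeak_torusPeak.continuous_peakKernel (G := Torus d) m)
      (hg2.integrable one_le_two) 2
    refine (abs_corr_le hP hm _).trans (mul_le_mul_of_nonneg_left ?_ ENNReal.toReal_nonneg)
    exact ENNReal.toReal_mono hg2.2.ne (isPeak_torusPeak.eLpNorm_conv_le m hg2)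

end

noncomputable section

variable {d : ℕ}

/-! ### The commutator estimate -/

instance holderTriple_four_four_two : ENNReal.HolderTriple 4 4 2 where
  inv_add_inv_eq_inv := by
    rw [← ENNReal.toReal_eq_toReal_iff' (by simp) (by simp), ENNReal.toReal_add (by simp) (by simp)]
    simp
    norm_num

/-- The product `w v` with `w ∈ L²` and `v ∈ L⁴` lies in `L^{4/3}`, the dual exponent of the other
factor `v ∈ L⁴`. -/
instance holderTriple_two_four : ENNReal.HolderTriple 2 4 (4 / 3) where
  inv_add_inv_eq_inv := by
    rw [ENNReal.inv_div (by simp) (by simp),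
      ← ENNReal.toReal_eq_toReal_iff' (by simp) (by simp [ENNReal.div_eq_top]),
      ENNReal.toReal_add (by simp) (by simp)]
    simp
    norm_num

instance holderConjugate_four_thirds : ENNReal.HolderConjugate (4 / 3) 4 where
  inv_add_inv_eq_inv := by
    rw [ENNReal.inv_div (by simp) (by simp),
      ← ENNReal.toReal_eq_toReal_iff' (by simp [ENNReal.div_eq_top]) (by simp),
      ENNReal.toReal_add (by simp [ENNReal.div_eq_top]) (by simp)]
    simp
    norm_num

instance fact_one_le_four : Fact ((1 : ℝ≥0∞) ≤ 4) := ⟨by norm_num⟩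

instance fact_one_le_four_thirds : Fact ((1 : ℝ≥0∞) ≤ 4 / 3) :=
  ⟨by rw [ENNReal.le_div_iff_mul_le (by simp) (by simp)]; norm_num⟩

/-! ### Hölder estimates for products of vector fields -/

section Products

variable {α : Type*} [MeasurableSpace α] {μ : Measure α}

theorem eLpNorm_inner_le {f g : α → Vel} (hf : AEStronglyMeasurable f μ)
    (hg : AEStronglyMeasurable g μ) :
    eLpNorm (fun x => inner ℝ (f x) (g x)) 2 μ ≤ eLpNorm f 4 μ * eLpNorm g 4 μ := by
  have := eLpNorm_le_eLpNorm_mul_eLpNorm_of_nnnorm (p := 4) (q := 4) (r := 2) hf hg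
    (fun a b : Vel => inner ℝ a b) 1 (ae_of_all _ fun x => by
      simpa using nnnorm_inner_le_nnnorm (𝕜 := ℝ) (f x) (g x))
  simpa using this

theorem memLp_inner {f g : α → Vel} (hf : MemLp f 4 μ) (hg : MemLp g 4 μ) :
    MemLp (fun x => inner ℝ (f x) (g x)) 2 μ :=
  ⟨hf.1.inner hg.1, (eLpNorm_inner_le hf.1 hg.1).trans_lt (ENNReal.mul_lt_top hf.2 hg.2)⟩

theorem eLpNorm_smul_four_thirds_le {a : α → ℝ} {f : α → Vel} (ha : MemLp a 2 μ)
    (hf : MemLp f 4 μ) :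
    eLpNorm (fun x => a x • f x) (4 / 3) μ ≤ eLpNorm a 2 μ * eLpNorm f 4 μ := by
  have := eLpNorm_le_eLpNorm_mul_eLpNorm_of_nnnorm (p := 2) (q := 4) (r := 4 / 3) ha.1 hf.1
    (fun (a : ℝ) (b : Vel) => a • b) 1 (ae_of_all _ fun x => by simp [nnnorm_smul])
  simpa using this

theorem memLp_smul_four_thirds {a : α → ℝ} {f : α → Vel} (ha : MemLp a 2 μ) (hf : MemLp f 4 μ) :
    MemLp (fun x => a x • f x) (4 / 3) μ :=
  ⟨ha.1.smul hf.1, (eLpNorm_smul_four_thirds_le ha hf).trans_lt (ENNReal.mul_lt_top ha.2 hf.2)⟩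

theorem eLpNorm_apply_le (f : α → Vel) (i : Fin 2) (p : ℝ≥0∞) :
    eLpNorm (fun x => f x i) p μ ≤ eLpNorm f p μ :=
  eLpNorm_mono fun x => PiLp.norm_apply_le (f x) i

theorem memLp_apply {f : α → Vel} {p : ℝ≥0∞} (hf : MemLp f p μ) (i : Fin 2) :
    MemLp (fun x => f x i) p μ :=
  ⟨(EuclideanSpace.proj i : Vel →L[ℝ] ℝ).continuous.comp_aestronglyMeasurable hf.1,
    (eLpNorm_apply_le f i p).trans_lt hf.2⟩

theorem memLp_apply_smul {f : α → Vel} (hf : MemLp f 4 μ) (i : Fin 2) :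
    MemLp (fun x => f x i • f x) 2 μ :=
  hf.smul (p := 4) (q := 4) (r := 2) (memLp_apply hf i)

theorem eLpNorm_apply_smul_le {f : α → Vel} (hf : MemLp f 4 μ) (i : Fin 2) :
    eLpNorm (fun x => f x i • f x) 2 μ ≤ eLpNorm f 4 μ * eLpNorm f 4 μ :=
  (eLpNorm_smul_le_mul_eLpNorm (p := 4) (q := 4) (r := 2) hf.1 (memLp_apply hf i).1).trans
    (mul_le_mul_left (eLpNorm_apply_le f i 4) _)

end Products

/-- `g` is the derivative of `a` in the direction `j`, tested against `L²` functions. -/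
def HasDiffQuot (j : Option (Fin d)) (a g : Torus d → ℝ) : Prop :=
  ∀ P : Torus d → ℝ, MemLp P 2 → ∀ y : ℝ, 0 ≤ y →
    corr P a 0 - corr P a (shift j y) = ∫ s in (0 : ℝ)..y, corr P g (shift j s)

theorem IsWeakPartial.hasDiffQuot {j : Option (Fin d)} {f g : L2 d} (hfg : IsWeakPartial j f g)
    (i : Fin 2) : HasDiffQuot j (fun x => f x i) (fun x => g x i) := by
  intro P hP y _
  have hP' : MemLp (fun x => P x • EuclideanSpace.single i (1 : ℝ)) 2 := by
    refine MemLp.of_le hP (hP.1.smul_const _) (ae_of_all _ fun x => ?_)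
    simp [norm_smul]
  have key : ∀ u : Torus d → Vel, corr (fun x => P x • EuclideanSpace.single i (1 : ℝ)) u =
      corr P fun x => u x i := fun u => by
    funext h
    simp only [corr, real_inner_smul_left, EuclideanSpace.inner_single_left]
    simp [mul_comm]
  have h := corr_sub_shift hfg hP' y
  simpa only [key] using h

/-- Substituting `x ↦ x - k` in the first correlation shows that both carry the same product `f(x) ·
f(x - k)` and differ only in where `a` is evaluated. The difference thus falls on `a` alone, and `f`
needs no derivative. -/
theorem corr_smul_sub (a : Torus d → ℝ) (f : Torus d → Vel) (k : Torus d) :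
    corr (fun x => a x • f x) f (-k) - corr (fun x => a x • f x) f k =
      -(corr (fun x => inner ℝ (f x) (f (x - k))) a 0 -
        corr (fun x => inner ℝ (f x) (f (x - k))) a k) := by
  have h1 : corr (fun x => a x • f x) f (-k) = corr (fun x => inner ℝ (f x) (f (x - k))) a k := by
    rw [corr, ← integral_sub_right_eq_self _ k, corr]
    refine integral_congr_ae (ae_of_all _ fun x => ?_)
    simp only [sub_neg_eq_add, sub_add_cancel, real_inner_smul_left]
    rw [real_inner_comm]
    simp
  have h2 : corr (fun x => a x • f x) f k = corr (fun x => inner ℝ (f x) (f (x - k))) a 0 := by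
    refine integral_congr_ae (ae_of_all _ fun x => ?_)
    simp [real_inner_smul_left]
  rw [h1, h2]; ring

/-- The difference of `a` is an integral of `g` over an interval of length `h`, which cancels
`(2h)⁻¹`, so the bound does not depend on `h`. -/
theorem abs_commutator_le {j : Option (Fin d)} {a g : Torus d → ℝ} {f : Torus d → Vel}
    (hg : MemLp g 2) (hf : MemLp f 4) (hdiff : HasDiffQuot j a g) {h : ℝ} (hh : 0 < h) :
    |(2 * h)⁻¹ * (corr (fun x => a x • f x) f (-shift j h) -
      corr (fun x => a x • f x) f (shift j h))| ≤
      (eLpNorm g 2).toReal * (eLpNorm f 4).toReal ^ 2 := by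
  have hP := memLp_inner hf (memLp_comp_sub_right hf (shift j h))
  have hPn : (eLpNorm (fun x => inner ℝ (f x) (f (x - shift j h))) 2).toReal ≤
      (eLpNorm f 4).toReal ^ 2 := by
    have := eLpNorm_inner_le hf.1 (memLp_comp_sub_right hf (shift j h)).1
    rw [eLpNorm_comp_sub_right hf.1] at this
    have := ENNReal.toReal_mono (ENNReal.mul_ne_top hf.2.ne hf.2.ne) this
    rwa [ENNReal.toReal_mul, ← sq] at this
  rw [corr_smul_sub, hdiff _ hP h hh.le]
  have h1 := intervalIntegral.norm_integral_le_of_norm_le_const (a := 0) (b := h)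
    (f := fun s => corr (fun x => inner ℝ (f x) (f (x - shift j h))) g (shift j s))
    (fun s _ => abs_corr_le hP hg (shift j s))
  rw [sub_zero, abs_of_pos hh, Real.norm_eq_abs] at h1
  rw [abs_mul, abs_neg, abs_of_pos (by positivity : 0 < (2 * h)⁻¹), inv_mul_le_iff₀ (by positivity)]
  refine h1.trans ?_
  have h2 : (eLpNorm (fun x => inner ℝ (f x) (f (x - shift j h))) 2).toReal *
      (eLpNorm g 2).toReal ≤ (eLpNorm g 2).toReal * (eLpNorm f 4).toReal ^ 2 := by
    rw [mul_comm]; exact mul_le_mul_of_nonneg_left hPn ENNReal.toReal_nonneg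
  have h3 : 0 ≤ (eLpNorm g 2).toReal * (eLpNorm f 4).toReal ^ 2 := by positivity
  nlinarith

theorem tendsto_eLpNorm_sub_shift {p : ℝ≥0∞} [Fact (1 ≤ p)] (hp : p ≠ ⊤) {f : Torus d → Vel}
    (hf : MemLp f p) (j : Option (Fin d)) :
    Tendsto (fun h => (eLpNorm (fun x => f (x - shift j h) - f x) p).toReal) (𝓝 0) (𝓝 0) := by
  have h1 := ((continuous_toLp_sub hp hf).comp (continuous_shift j)).tendsto 0
  have h2 := (h1.sub_const (hf.toLp f)).norm
  have h0 : (memLp_comp_sub_right hf (shift j 0)).toLp (fun x => f (x - shift j 0)) = hf.toLp f := by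
    congr 1
    simp [shift_zero]
  simp only [Function.comp, h0, sub_self, norm_zero] at h2
  refine h2.congr fun h => ?_
  rw [← MemLp.toLp_sub, Lp.norm_toLp]
  rfl

theorem tendsto_average {φ : ℝ → ℝ} (hφ : Continuous φ) :
    Tendsto (fun h => h⁻¹ * ∫ s in (0 : ℝ)..h, φ s) (𝓝[>] 0) (𝓝 (φ 0)) := by
  have h1 : HasDerivAt (fun h => ∫ s in (0 : ℝ)..h, φ s) (φ 0) 0 :=
    intervalIntegral.integral_hasDerivAt_right (hφ.intervalIntegrable _ _)
      (hφ.stronglyMeasurableAtFilter _ _) hφ.continuousAt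
  have h2 := h1.hasDerivWithinAt (s := Ioi 0)
  rw [hasDerivWithinAt_iff_tendsto_slope' (by simp)] at h2
  refine h2.congr fun h => ?_
  simp [slope]

theorem tendsto_commutator {j : Option (Fin d)} {a g : Torus d → ℝ} {f : Torus d → Vel}
    (hg : MemLp g 2) (hf : MemLp f 4) (hdiff : HasDiffQuot j a g) :
    Tendsto (fun h => (2 * h)⁻¹ * (corr (fun x => a x • f x) f (-shift j h) -
      corr (fun x => a x • f x) f (shift j h))) (𝓝[>] 0)
      (𝓝 (-(1 / 2) * ∫ x, g x * ‖f x‖ ^ 2)) := by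
  set P : ℝ → Torus d → ℝ := fun h x => inner ℝ (f x) (f (x - shift j h)) with hPdef
  have hP : ∀ h, MemLp (P h) 2 := fun h => memLp_inner hf (memLp_comp_sub_right hf (shift j h))
  have hcont : ∀ h, Continuous fun s => corr (P h) g (shift j s) := fun h =>
    (continuous_corr (p := 2) (q := 2) ENNReal.ofNat_ne_top (hP h) hg).comp (continuous_shift j)
  have hPi : ∀ h k, Integrable fun x => inner ℝ (P h x) (g (x - k)) := fun h k => by
    have := (memLp_comp_sub_right hg k).integrable_mul (hP h)
    exact this
  -- the averages of the correlation of `|f|²` with `g`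
  have hmain : Tendsto (fun h => h⁻¹ * ∫ s in (0 : ℝ)..h, corr (P 0) g (shift j s)) (𝓝[>] 0)
      (𝓝 (∫ x, g x * ‖f x‖ ^ 2)) := by
    have h1 := tendsto_average (hcont 0)
    have h2 : corr (P 0) g (shift j 0) = ∫ x, g x * ‖f x‖ ^ 2 := by
      simp [corr, hPdef, shift_zero]
    rwa [h2] at h1
  -- Replacing `f(x) · f(x - h)` by `|f|²` costs `‖f‖₄ ‖f(· - h) - f‖₄ ‖g‖₂`, which vanishes by
  -- continuity of translations in `L⁴`.
  have herr : Tendsto (fun h => h⁻¹ * ∫ s in (0 : ℝ)..h,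
      (corr (P h) g (shift j s) - corr (P 0) g (shift j s))) (𝓝[>] 0) (𝓝 0) := by
    have hlim : Tendsto (fun h => (eLpNorm f 4).toReal *
        (eLpNorm (fun x => f (x - shift j h) - f x) 4).toReal * (eLpNorm g 2).toReal)
        (𝓝[>] 0) (𝓝 0) := by
      have := ((tendsto_eLpNorm_sub_shift ENNReal.ofNat_ne_top hf j).const_mul
        (eLpNorm f 4).toReal).mul_const (eLpNorm g 2).toReal
      rw [mul_zero, zero_mul] at this
      exact this.mono_left nhdsWithin_le_nhds
    refine squeeze_zero_norm' ?_ hlim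
    filter_upwards [self_mem_nhdsWithin] with h hh
    rw [mem_Ioi] at hh
    have hsub := (memLp_comp_sub_right hf (shift j h)).sub hf
    have hb : ∀ s, ‖corr (P h) g (shift j s) - corr (P 0) g (shift j s)‖ ≤
        (eLpNorm f 4).toReal * (eLpNorm (fun x => f (x - shift j h) - f x) 4).toReal *
          (eLpNorm g 2).toReal := fun s => by
      have h1 : corr (P h) g (shift j s) - corr (P 0) g (shift j s) =
          corr (fun x => inner ℝ (f x) (f (x - shift j h) - f x)) g (shift j s) := by
        rw [corr, corr, ← integral_sub (hPi _ _) (hPi _ _)]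
        refine integral_congr_ae (ae_of_all _ fun x => ?_)
        simp only [hPdef, inner_sub_right, inner_sub_left, shift_zero, sub_zero]
      rw [h1]
      refine (abs_corr_le (memLp_inner hf hsub) hg _).trans
        (mul_le_mul_of_nonneg_right ?_ ENNReal.toReal_nonneg)
      rw [← ENNReal.toReal_mul]
      exact ENNReal.toReal_mono (ENNReal.mul_ne_top hf.2.ne hsub.2.ne)
        (eLpNorm_inner_le hf.1 hsub.1)
    have h1 := intervalIntegral.norm_integral_le_of_norm_le_const (a := 0) (b := h)
      (fun s _ => hb s)
    rw [norm_mul, norm_inv, Real.norm_of_nonneg hh.le, inv_mul_le_iff₀ hh]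
    rw [sub_zero, abs_of_pos hh] at h1
    linarith
  have hsum := (hmain.add herr).const_mul (-(1 / 2) : ℝ)
  rw [add_zero] at hsum
  refine hsum.congr' ?_
  filter_upwards [self_mem_nhdsWithin] with h hh
  rw [mem_Ioi] at hh
  rw [corr_smul_sub, hdiff _ (hP h) h hh.le, intervalIntegral.integral_sub
    ((hcont h).intervalIntegrable _ _) ((hcont 0).intervalIntegrable _ _), mul_inv]
  ring

/-- The horizontal transport term, for a field in `H¹ ∩ L⁴`. -/
theorem integral_apply_mul_inner {j : Option (Fin d)} {f g : L2 d} (hfg : IsWeakPartial j f g)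
    (hf : MemLp f 4) (i : Fin 2) :
    ∫ x, inner ℝ (f x i • f x) (g x) = -(1 / 2) * ∫ x, g x i * ‖f x‖ ^ 2 := by
  have h1 := tendsto_commutator (memLp_apply (Lp.memLp g) i) hf (hfg.hasDiffQuot i)
  have hF := memLp_apply_smul hf i
  have hc : Continuous fun s => corr (fun x => f x i • f x) g (shift j s) :=
    (continuous_corr (p := 2) (q := 2) ENNReal.ofNat_ne_top hF (Lp.memLp g)).comp
      (continuous_shift j)
  have h0 : corr (fun x => f x i • f x) g (shift j 0) = ∫ x, inner ℝ (f x i • f x) (g x) := by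
    simp [corr, shift_zero]
  -- The same symmetric quotient is computed a second time with the derivative placed on `f`. This
  -- is possible because `f_i f ∈ L²` may be paired with the weak derivative.
  refine tendsto_nhds_unique ?_ h1
  rw [← h0]
  have h2 := tendsto_average hc
  have h3 := tendsto_average (hc.comp continuous_neg)
  simp only [Function.comp, neg_zero] at h3
  have h4 := (h2.add h3).const_mul (1 / 2 : ℝ)
  rw [← two_mul, ← mul_assoc, one_div, inv_mul_cancel₀ two_ne_zero, one_mul] at h4
  refine h4.congr fun h => ?_
  have ha := corr_sub_shift hfg hF h
  have hb := corr_sub_shift hfg hF (-h)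
  have hn := intervalIntegral.integral_comp_neg (a := 0) (b := h)
    (fun s => corr (fun x => f x i • f x) g (shift j s))
  rw [neg_zero, intervalIntegral.integral_symm 0 (-h)] at hn
  rw [shift_neg] at hb
  rw [hn, ← ha, ← hb, mul_inv]
  ring

end

noncomputable section

variable {d : ℕ}

/-! ### The vertical velocity -/

section Norms

variable {α E ε : Type*} [MeasurableSpace α] {μ : Measure α} [NormedAddCommGroup E] [ENorm ε]

theorem eLpNorm_pow_natCast (f : α → ε) {n : ℕ} (hn : n ≠ 0) :
    eLpNorm f n μ ^ n = ∫⁻ x, ‖f x‖ₑ ^ n ∂μ := by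
  have h := eLpNorm_nnreal_pow_eq_lintegral (μ := μ) (f := f) (p := (n : NNReal)) (by simpa using hn)
  simpa using h

theorem eLpNorm_two_sq (f : α → ε) : eLpNorm f 2 μ ^ 2 = ∫⁻ x, ‖f x‖ₑ ^ 2 ∂μ :=
  eLpNorm_pow_natCast f two_ne_zero

theorem eLpNorm_four_pow (f : α → ε) : eLpNorm f 4 μ ^ 4 = ∫⁻ x, ‖f x‖ₑ ^ 4 ∂μ :=
  eLpNorm_pow_natCast f four_ne_zero

theorem lintegral_enorm_sq_le {f : α → E} (hf : AEStronglyMeasurable f μ) :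
    (∫⁻ x, ‖f x‖ₑ ∂μ) ^ 2 ≤ μ univ * ∫⁻ x, ‖f x‖ₑ ^ 2 ∂μ := by
  have h := eLpNorm_le_eLpNorm_mul_rpow_measure_univ (μ := μ) (p := 1) (q := 2) one_le_two hf
  rw [eLpNorm_one_eq_lintegral_enorm] at h
  calc (∫⁻ x, ‖f x‖ₑ ∂μ) ^ 2
      ≤ (eLpNorm f 2 μ * μ univ ^ (1 / (1 : ℝ≥0∞).toReal - 1 / (2 : ℝ≥0∞).toReal)) ^ 2 := by
        gcongr
    _ = μ univ * ∫⁻ x, ‖f x‖ₑ ^ 2 ∂μ := by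
        rw [mul_pow, eLpNorm_two_sq, mul_comm, ← ENNReal.rpow_natCast, ← ENNReal.rpow_mul]
        norm_num

end Norms

theorem volume_circle : (volume : Measure Circle2Pi) univ = ENNReal.ofReal (2 * Real.pi) :=
  AddCircle.measure_univ _

theorem ae_comp_fst {p : HTorus d → Prop} (h : ∀ᵐ x, p x) : ∀ᵐ x : Torus d, p x.1 :=
  quasiMeasurePreserving_fst.ae h

theorem lintegral_torus {f : Torus d → ℝ≥0∞} (hf : AEMeasurable f) :
    ∫⁻ x, f x = ∫⁻ x : HTorus d, ∫⁻ z : Circle2Pi, f (x, z) :=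
  lintegral_prod f hf

theorem lintegral_comp_fst {f : HTorus d → ℝ≥0∞} (hf : AEMeasurable f) :
    ∫⁻ x : Torus d, f x.1 = ENNReal.ofReal (2 * Real.pi) * ∫⁻ x, f x := by
  have hm : AEMeasurable fun x : Torus d => f x.1 :=
    hf.comp_quasiMeasurePreserving quasiMeasurePreserving_fst
  rw [lintegral_torus hm]
  simp only [lintegral_const, volume_circle]
  rw [lintegral_mul_const' _ _ ENNReal.ofReal_ne_top, mul_comm]

/-- The vertical mean of an `L²` function is in `L²`. -/
theorem eLpNorm_integral_snd_sq_le {E : Type*} [NormedAddCommGroup E] [NormedSpace ℝ E]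
    {G : Torus d → E} (hG : AEStronglyMeasurable G) :
    eLpNorm (fun x : HTorus d => ∫ z : Circle2Pi, G (x, z)) 2 ^ 2 ≤
      ENNReal.ofReal (2 * Real.pi) * eLpNorm G 2 ^ 2 := by
  rw [eLpNorm_two_sq, eLpNorm_two_sq, lintegral_torus (hG.enorm.pow_const 2),
    ← lintegral_const_mul' _ _ ENNReal.ofReal_ne_top]
  refine lintegral_mono_ae ?_
  filter_upwards [hG.prodMk_left] with x hx
  calc ‖∫ z : Circle2Pi, G (x, z)‖ₑ ^ 2 ≤ (∫⁻ z : Circle2Pi, ‖G (x, z)‖ₑ) ^ 2 := by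
        gcongr; exact enorm_integral_le_lintegral_enorm _
    _ ≤ _ := by
        have := lintegral_enorm_sq_le hx
        rwa [volume_circle] at this

theorem memLp_integral_snd {E : Type*} [NormedAddCommGroup E] [NormedSpace ℝ E]
    {G : Torus d → E} (hG : MemLp G 2) :
    MemLp (fun x : HTorus d => ∫ z : Circle2Pi, G (x, z)) 2 := by
  refine ⟨hG.1.integral_prod_right', ?_⟩
  have h := (eLpNorm_integral_snd_sq_le hG.1).trans_lt
    (ENNReal.mul_lt_top ENNReal.ofReal_lt_top (ENNReal.pow_lt_top hG.2))
  by_contra hne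
  rw [not_lt, top_le_iff] at hne
  rw [hne] at h
  simp at h

/-- The primitive `∫_z^π G(x_H, ζ) dζ`. -/
def vertPrim (G : Torus d → ℝ) (x : Torus d) : ℝ :=
  ∫ ζ in ((AddCircle.equivIoc (2 * Real.pi) (-Real.pi) x.2 : ℝ))..Real.pi, G (x.1, (ζ : Circle2Pi))

theorem equivIoc_mem (z : Circle2Pi) :
    (AddCircle.equivIoc (2 * Real.pi) (-Real.pi) z : ℝ) ∈ Ioc (-Real.pi) Real.pi := by
  have h := (AddCircle.equivIoc (2 * Real.pi) (-Real.pi) z).2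
  exact ⟨h.1, h.2.trans_eq (by ring)⟩

theorem enorm_vertPrim_le (G : Torus d → ℝ) (x : Torus d) :
    ‖vertPrim G x‖ₑ ≤ ∫⁻ ζ : Circle2Pi, ‖G (x.1, ζ)‖ₑ := by
  have hz := equivIoc_mem x.2
  rw [vertPrim, intervalIntegral.integral_of_le hz.2]
  refine (enorm_integral_le_lintegral_enorm _).trans ?_
  rw [← AddCircle.lintegral_preimage (2 * Real.pi) (-Real.pi)]
  exact lintegral_mono_set (Ioc_subset_Ioc hz.1.le (by linarith))

theorem stronglyMeasurable_vertPrim {G : Torus d → ℝ} (hG : StronglyMeasurable G) :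
    StronglyMeasurable (vertPrim G) := by
  have he : Measurable fun x : Torus d =>
      (AddCircle.equivIoc (2 * Real.pi) (-Real.pi) x.2 : ℝ) :=
    measurable_subtype_coe.comp ((AddCircle.measurableEquivIoc (2 * Real.pi) (-Real.pi)).measurable.comp
      measurable_snd)
  -- The variable endpoint is encoded in a jointly measurable region, so measurability of the
  -- primitive is measurability of a parametric integral over all of `ℝ`.
  have hset : MeasurableSet {q : Torus d × ℝ |
      (AddCircle.equivIoc (2 * Real.pi) (-Real.pi) q.1.2 : ℝ) < q.2 ∧ q.2 ≤ Real.pi} :=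
    (measurableSet_lt (he.comp measurable_fst) measurable_snd).inter
      (measurableSet_le measurable_snd measurable_const)
  have hm : StronglyMeasurable fun q : Torus d × ℝ => G (q.1.1, (q.2 : Circle2Pi)) :=
    hG.comp_measurable ((measurable_fst.comp measurable_fst).prodMk
      (AddCircle.measurable_mk'.comp measurable_snd))
  have h1 := (hm.indicator hset).integral_prod_right' (ν := (volume : Measure ℝ))
  convert h1 using 1
  funext x
  rw [vertPrim, intervalIntegral.integral_of_le (equivIoc_mem x.2).2,
    ← integral_indicator measurableSet_Ioc]
  rfl

theorem eLpNorm_vertPrim_le {G : Torus d → ℝ} (hG : AEStronglyMeasurable G) :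
    eLpNorm (vertPrim G) 2 ≤ ENNReal.ofReal (2 * Real.pi) * eLpNorm G 2 := by
  have h : eLpNorm (vertPrim G) 2 ^ 2 ≤ (ENNReal.ofReal (2 * Real.pi) * eLpNorm G 2) ^ 2 := by
    rw [eLpNorm_two_sq, mul_pow, eLpNorm_two_sq]
    calc ∫⁻ x, ‖vertPrim G x‖ₑ ^ 2
        ≤ ∫⁻ x : Torus d, (fun y : HTorus d => ENNReal.ofReal (2 * Real.pi) *
            ∫⁻ ζ : Circle2Pi, ‖G (y, ζ)‖ₑ ^ 2) x.1 := by
          refine lintegral_mono_ae ?_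
          filter_upwards [ae_comp_fst hG.prodMk_left] with x hx
          calc ‖vertPrim G x‖ₑ ^ 2 ≤ (∫⁻ ζ : Circle2Pi, ‖G (x.1, ζ)‖ₑ) ^ 2 := by
                gcongr; exact enorm_vertPrim_le G x
            _ ≤ _ := by
                have := lintegral_enorm_sq_le hx
                rwa [volume_circle] at this
      _ = _ := by
          rw [lintegral_comp_fst (f := fun y : HTorus d => ENNReal.ofReal (2 * Real.pi) *
            ∫⁻ ζ : Circle2Pi, ‖G (y, ζ)‖ₑ ^ 2), lintegral_const_mul' _ _ ENNReal.ofReal_ne_top,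
            lintegral_torus (hG.enorm.pow_const 2)]
          · ring
          · exact (AEMeasurable.lintegral_prod_right' (hG.enorm.pow_const 2)).const_mul _
  exact (ENNReal.pow_le_pow_left_iff two_ne_zero).1 h

theorem intervalIntegrable_coe {g : Circle2Pi → ℝ} (hg : Integrable g) (a b : ℝ) :
    IntervalIntegrable (fun ζ : ℝ => g ζ) volume a b := by
  have hper : Function.Periodic (fun ζ : ℝ => g ζ) (2 * Real.pi) := fun ζ => by simp
  refine hper.intervalIntegrable₀ Real.two_pi_pos.ne' ?_ a b
  rw [intervalIntegrable_iff_integrableOn_Ioc_of_le Real.two_pi_pos.le]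
  have h := (AddCircle.measurePreserving_mk (2 * Real.pi) 0).integrable_comp_of_integrable hg
  rw [zero_add] at h
  exact h

/-- Two representatives of a vertical coordinate differ by whole periods, over which `G` integrates
to zero. So the primitive is periodic and has no jump at `z = π`. -/
theorem vertPrim_coe {G : Torus d → ℝ} {x : HTorus d}
    (hi : Integrable fun z : Circle2Pi => G (x, z)) (h0 : ∫ z : Circle2Pi, G (x, z) = 0) (a : ℝ) :
    vertPrim G (x, (a : Circle2Pi)) = ∫ ζ in a..Real.pi, G (x, (ζ : Circle2Pi)) := by
  set b : ℝ := (AddCircle.equivIoc (2 * Real.pi) (-Real.pi) (a : Circle2Pi) : ℝ) with hb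
  have hba : ((b - a : ℝ) : Circle2Pi) = 0 := by
    rw [AddCircle.coe_sub, sub_eq_zero]
    exact AddCircle.coe_equivIoc ..
  obtain ⟨n, hn⟩ := (AddCircle.coe_eq_zero_iff (2 * Real.pi)).1 hba
  have hper : Function.Periodic (fun ζ : ℝ => G (x, (ζ : Circle2Pi))) (2 * Real.pi) := fun ζ => by
    simp
  have hz : ∫ ζ in a..b, G (x, (ζ : Circle2Pi)) = 0 := by
    have h1 : b = a + n • (2 * Real.pi) := by rw [hn]; ring
    rw [h1, hper.intervalIntegral_add_zsmul_eq n a fun t₁ t₂ => intervalIntegrable_coe hi t₁ t₂]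
    have h2 := AddCircle.intervalIntegral_preimage (2 * Real.pi) 0 (fun z => G (x, z))
    rw [zero_add, h0] at h2
    rw [hper.intervalIntegral_add_eq a 0, zero_add, h2, smul_zero]
  have h3 := intervalIntegral.integral_add_adjacent_intervals
    (intervalIntegrable_coe hi a b) (intervalIntegrable_coe hi b Real.pi)
  rw [hz, zero_add] at h3
  exact h3

theorem vertPrim_sub_shift {G : Torus d → ℝ} {x : Torus d}
    (hi : Integrable fun z : Circle2Pi => G (x.1, z)) (h0 : ∫ z : Circle2Pi, G (x.1, z) = 0)
    (y : ℝ) : vertPrim G x - vertPrim G (x - shift none y) =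
      ∫ s in (0 : ℝ)..y, -G (x - shift none s) := by
  obtain ⟨xH, z⟩ := x
  obtain ⟨a, rfl⟩ := QuotientAddGroup.mk_surjective z
  have h1 : ∀ s : ℝ, ((xH, (a : Circle2Pi)) : Torus d) - shift none s = (xH, ((a - s : ℝ) : Circle2Pi)) :=
    fun s => by simp [shift]
  change vertPrim G (xH, (a : Circle2Pi)) - vertPrim G ((xH, (a : Circle2Pi)) - shift none y) =
    ∫ s in (0 : ℝ)..y, -G ((xH, (a : Circle2Pi)) - shift none s)
  simp only [h1]
  rw [vertPrim_coe hi h0, vertPrim_coe hi h0, intervalIntegral.integral_neg,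
    intervalIntegral.integral_comp_sub_left (fun ζ : ℝ => G (xH, (ζ : Circle2Pi))), sub_zero,
    ← intervalIntegral.integral_add_adjacent_intervals (intervalIntegrable_coe hi (a - y) a)
      (intervalIntegrable_coe hi a Real.pi)]
  simp only
  ring

/-- The difference formula is pointwise on almost every vertical line, so Fubini alone suffices. It
gives `∂_z w = -div_H v`, the only derivative of `w` that is available. -/
theorem hasDiffQuot_vertPrim {G : Torus d → ℝ} (hGm : StronglyMeasurable G) (hG : MemLp G 2)
    (h0 : ∀ᵐ x : HTorus d, ∫ z : Circle2Pi, G (x, z) = 0) :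
    HasDiffQuot none (vertPrim G) (fun x => -G x) := by
  intro P hP y hy
  have hw : MemLp (vertPrim G) 2 := ⟨(stronglyMeasurable_vertPrim hGm).aestronglyMeasurable,
    (eLpNorm_vertPrim_le hG.1).trans_lt (ENNReal.mul_lt_top ENNReal.ofReal_lt_top hG.2)⟩
  have hint : ∀ {u : Torus d → ℝ}, MemLp u 2 → ∀ k, Integrable fun x => inner ℝ (P x) (u (x - k)) :=
    fun {u} hu k => (memLp_comp_sub_right hu k).integrable_mul hP
  have hGn : MemLp (fun x => -G x) 2 := hG.neg
  have hfub : Integrable (Function.uncurry fun (s : ℝ) (x : Torus d) =>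
      inner ℝ (P x) (-G (x - shift none s))) ((volume.restrict (Set.uIoc 0 y)).prod volume) := by
    have : IsFiniteMeasure (volume.restrict (Set.uIoc 0 y)) := by
      rw [Set.uIoc]; infer_instance
    have hmeas : AEStronglyMeasurable (Function.uncurry fun (s : ℝ) (x : Torus d) =>
        inner ℝ (P x) (-G (x - shift none s))) ((volume.restrict (Set.uIoc 0 y)).prod volume) := by
      refine AEStronglyMeasurable.inner hP.1.comp_snd (StronglyMeasurable.aestronglyMeasurable ?_)
      exact (hGm.comp_measurable (measurable_snd.sub
        ((continuous_shift none).measurable.comp measurable_fst))).neg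
    rw [integrable_prod_iff hmeas]
    refine ⟨ae_of_all _ fun s => ?_, ?_⟩
    · have h1 := hint hGn (shift none s)
      simp only [Function.uncurry]
      exact h1
    refine Integrable.of_bound hmeas.norm.integral_prod_right'
      ((eLpNorm P 2).toReal * (eLpNorm G 2).toReal) (ae_of_all _ fun s => ?_)
    have h1 := abs_integral_inner_le (p := 2) (q := 2) hP.norm
      (memLp_comp_sub_right hG (shift none s)).norm
    rw [eLpNorm_norm, eLpNorm_norm, eLpNorm_comp_sub_right hG.1] at h1
    refine le_trans (le_of_eq ?_) h1
    rw [Real.norm_eq_abs]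
    congr 1
    refine integral_congr_ae (ae_of_all _ fun x => ?_)
    simp [Function.uncurry]
  simp only [corr]
  rw [intervalIntegral_integral_swap hfub, ← integral_sub (hint hw 0) (hint hw _)]
  refine integral_congr_ae ?_
  have hGi : Integrable G := hG.integrable one_le_two
  filter_upwards [ae_comp_fst h0, ae_comp_fst hGi.prod_right_ae] with x hx0 hxi
  simp only [sub_zero, ← inner_sub_right]
  rw [vertPrim_sub_shift hxi hx0]
  simp [mul_comm]

end

noncomputable section

variable {d : ℕ}

/-! ### The horizontal divergence -/

theorem MemH1.isWeakPartial {f : L2 d} (hf : MemH1 f) (j : Option (Fin d)) :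
    IsWeakPartial j f (weakPartial j f) := by
  rw [weakPartial, dif_pos (hf j)]
  exact (hf j).choose_spec

theorem eLpNorm_coe_toReal (f : L2 d) : (eLpNorm f 2).toReal = ‖f‖ := rfl

/-- The sum of the `L²` norms of the weak partial derivatives. -/
def gradSum (f : L2 d) : ℝ := ∑ j : Option (Fin d), ‖weakPartial j f‖

theorem gradSum_nonneg (f : L2 d) : 0 ≤ gradSum f := Finset.sum_nonneg fun _ _ => norm_nonneg _

theorem norm_weakPartial_le (f : L2 d) (j : Option (Fin d)) : ‖weakPartial j f‖ ≤ gradSum f :=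
  Finset.single_le_sum (f := fun j => ‖weakPartial j f‖) (fun _ _ => norm_nonneg _)
    (Finset.mem_univ j)

theorem sum_norm_weakPartial_le (f : L2 d) :
    ∑ i : Fin d, ‖weakPartial (some i) f‖ ≤ gradSum f := by
  rw [gradSum, Fintype.sum_option]
  linarith [norm_nonneg (weakPartial none f)]

theorem stronglyMeasurable_divH (hd : d ≤ 2) (f : L2 d) : StronglyMeasurable (divH hd f) :=
  Finset.stronglyMeasurable_fun_sum _ fun i _ =>
    (EuclideanSpace.proj (Fin.castLE hd i) : Vel →L[ℝ] ℝ).continuous.comp_stronglyMeasurable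
      (Lp.stronglyMeasurable (weakPartial (some i) f))

theorem memLp_divH (hd : d ≤ 2) (f : L2 d) : MemLp (divH hd f) 2 :=
  memLp_finsetSum _ fun i _ => memLp_apply (Lp.memLp (weakPartial (some i) f)) (Fin.castLE hd i)

theorem eLpNorm_divH_le (hd : d ≤ 2) (f : L2 d) : (eLpNorm (divH hd f) 2).toReal ≤ gradSum f := by
  have hm : ∀ i : Fin d, MemLp (fun x => weakPartial (some i) f x (Fin.castLE hd i)) 2 := fun i =>
    memLp_apply (Lp.memLp (weakPartial (some i) f)) (Fin.castLE hd i)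
  have h1 : eLpNorm (divH hd f) 2 ≤
      ∑ i : Fin d, eLpNorm (weakPartial (some i) f) 2 := by
    have h2 : divH hd f = ∑ i : Fin d, fun x => weakPartial (some i) f x (Fin.castLE hd i) := by
      funext x; simp [divH]
    rw [h2]
    refine (eLpNorm_sum_le (fun i _ => (hm i).1) one_le_two).trans
      (Finset.sum_le_sum fun i _ => eLpNorm_apply_le _ _ _)
  refine le_trans ?_ (sum_norm_weakPartial_le f)
  have h3 := ENNReal.toReal_mono (ENNReal.sum_ne_top.2 fun i _ => Lp.eLpNorm_ne_top _) h1
  rwa [ENNReal.toReal_sum fun i _ => Lp.eLpNorm_ne_top _] at h3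

theorem memLp_vertVel (hd : d ≤ 2) (f : L2 d) : MemLp (vertVel hd f) 2 :=
  ⟨(stronglyMeasurable_vertPrim (stronglyMeasurable_divH hd f)).aestronglyMeasurable,
    (eLpNorm_vertPrim_le (memLp_divH hd f).1).trans_lt
      (ENNReal.mul_lt_top ENNReal.ofReal_lt_top (memLp_divH hd f).2)⟩

theorem eLpNorm_vertVel_le (hd : d ≤ 2) (f : L2 d) :
    (eLpNorm (vertVel hd f) 2).toReal ≤ 2 * Real.pi * gradSum f := by
  have h1 := ENNReal.toReal_mono (ENNReal.mul_ne_top ENNReal.ofReal_ne_top (memLp_divH hd f).2.ne)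
    (eLpNorm_vertPrim_le (memLp_divH hd f).1)
  rw [ENNReal.toReal_mul, ENNReal.toReal_ofReal Real.two_pi_pos.le] at h1
  exact h1.trans (mul_le_mul_of_nonneg_left (eLpNorm_divH_le hd f) Real.two_pi_pos.le)

theorem memLp_transport (hd : d ≤ 2) (f : L2 d) (j : Option (Fin d)) :
    MemLp (transport hd f j) 2 := by
  rcases j with _ | i
  · exact memLp_vertVel hd f
  · exact memLp_apply (Lp.memLp f) _

theorem isSmoothH_peakKernel_sub (m : ℕ) (x : HTorus d) :
    IsSmoothH fun y => peakKernel (hPeak d) m (x - y) := by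
  obtain ⟨b, hb⟩ := isOpenQuotientMap_coverMap.surjective ((x, 0) : Torus d)
  have hx : x = fun i => (b.1 i : Circle2Pi) := (congrArg Prod.fst hb).symm
  have h : ContDiff ℝ ∞ fun y : Fin d → ℝ =>
      (∫ y, hPeak d y ^ m)⁻¹ * (∏ i, (1 + Real.cos (b.1 i - y i))) ^ m :=
    contDiff_const.mul (ContDiff.pow (contDiff_prod fun i _ => contDiff_const.add
      (Real.contDiff_cos.comp (contDiff_const.sub (contDiff_apply ℝ ℝ i)))) m)
  rw [hx]
  exact h

/-- The horizontal test functions see the weak horizontal derivatives of the vertical mean. -/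
theorem conv_integral_snd {E : Type*} [NormedAddCommGroup E] [NormedSpace ℝ E]
    {G : Torus d → E} (hG : Integrable G) {K : HTorus d → ℝ}
    (hK : Continuous K) (x : HTorus d) :
    conv K (fun y => ∫ z : Circle2Pi, G (y, z)) x = ∫ y : Torus d, K (x - y.1) • G y := by
  have hc : Continuous fun y : Torus d => K (x - y.1) :=
    hK.comp (continuous_const.sub continuous_fst)
  obtain ⟨C, -, hC⟩ := exists_abs_le_of_continuous hc
  have hi : Integrable (fun y : Torus d => K (x - y.1) • G y) :=
    hG.bdd_smul C hc.aestronglyMeasurable (ae_of_all _ fun y => hC y)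
  rw [volume_eq_prod] at hi ⊢
  rw [integral_prod _ hi]
  simp only [integral_smul]
  rfl

/-- The constraint is distributional. Convolving the vertical mean of `div_H f` with a horizontal
trigonometric kernel and integrating by parts gives exactly the constraint for that kernel, and
these kernels detect every `L²` function. -/
theorem ae_integral_divH_eq_zero (hd : d ≤ 2) {f : L2 d} (hf : MemSolenoidal hd f)
    (hf1 : MemH1 f) : ∀ᵐ x : HTorus d, ∫ z : Circle2Pi, divH hd f (x, z) = 0 := by
  have hdi : Integrable (divH hd f) := (memLp_divH hd f).integrable one_le_two
  refine isPeak_hPeak.ae_eq_zero_of_conv_eq_zero (memLp_integral_snd (memLp_divH hd f))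
    fun m x => ?_
  rw [conv_integral_snd hdi (isPeak_hPeak.continuous_peakKernel m)]
  set ψ : HTorus d → ℝ := fun y => peakKernel (hPeak d) m (x - y) with hψdef
  have hψ : IsSmoothH ψ := isSmoothH_peakKernel_sub m x
  have hfi : Integrable f := (Lp.memLp f).integrable one_le_two
  have hbi : ∀ {u : Torus d → ℝ}, Continuous u → ∀ g : L2 d, Integrable fun y => u y • g y :=
    fun {u} hu g => by
      obtain ⟨C, -, hC⟩ := exists_abs_le_of_continuous hu
      exact ((Lp.memLp g).integrable one_le_two).bdd_smul C hu.aestronglyMeasurable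
        (ae_of_all _ fun y => hC y)
  have hcψ : Continuous fun y : Torus d => ψ y.1 := hψ.comp_fst.continuous
  have happ : ∀ {u : Torus d → ℝ}, Continuous u → ∀ (g : L2 d) (i : Fin 2),
      Integrable (fun y => u y * g y i) ∧ ∫ y, u y * g y i = (∫ y, u y • g y) i :=
    fun {u} hu g i => ⟨(EuclideanSpace.proj i : Vel →L[ℝ] ℝ).integrable_comp (hbi hu g),
      (EuclideanSpace.proj i : Vel →L[ℝ] ℝ).integral_comp_comm (hbi hu g)⟩
  calc ∫ y : Torus d, ψ y.1 * divH hd f y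
      = ∑ i : Fin d, ∫ y : Torus d, ψ y.1 * weakPartial (some i) f y (Fin.castLE hd i) := by
        rw [← integral_finsetSum _ fun i _ => (happ hcψ _ _).1]
        simp only [divH, Finset.mul_sum]
    _ = ∑ i : Fin d, -∫ y : Torus d, partialDerivH i ψ y.1 * f y (Fin.castLE hd i) := by
        refine Finset.sum_congr rfl fun i _ => ?_
        have h1 := hf1.isWeakPartial (some i) _ hψ.comp_fst
        have hcd : Continuous fun y : Torus d => partialDerivH i ψ y.1 :=
          (hψ.continuous_partialDerivH i).comp continuous_fst
        rw [(happ hcψ _ _).2, (happ hcd _ _).2]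
        simp only [partialDeriv_comp_fst] at h1
        rw [h1]
        simp
    _ = -∫ y, inner ℝ (gradVel hd ψ y) (f y) := by
        have hcd : ∀ i, Continuous fun y : Torus d => partialDerivH i ψ y.1 := fun i =>
          (hψ.continuous_partialDerivH i).comp continuous_fst
        rw [Finset.sum_neg_distrib, ← integral_finsetSum _ fun i _ => (happ (hcd i) _ _).1]
        simp only [inner_gradVel, mul_comm]
    _ = 0 := by
        rw [← integral_div_eq_integral_inner hd hψ hfi, hf.2.2 ψ hψ, neg_zero]

/-! ### The transport term for mollified fields -/

section Transport

variable (hd : d ≤ 2) (f : L2 d)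

/-- The correlations entering the horizontal transport terms. -/
def corrH (i : Fin d) : Torus d → ℝ :=
  corr (fun x => f x (Fin.castLE hd i) • f x) (weakPartial (some i) f)

/-- The correlation entering the vertical transport term. -/
def corrV : Torus d → ℝ := corr (fun x => vertVel hd f x • f x) f

/-- The transport term, with the test field given by the correlation at `y`. -/
def corrTransport (h : ℝ) (y : Torus d) : ℝ :=
  ∑ i : Fin d, steklov h (corrH hd f i) y +
    (2 * h)⁻¹ * (corrV hd f (y - shift none h) - corrV hd f (y + shift none h))

variable {f}

theorem continuous_corrH (hf4 : MemLp f 4) (i : Fin d) : Continuous (corrH hd f i) :=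
  continuous_corr (p := 2) (q := 2) ENNReal.ofNat_ne_top (memLp_apply_smul hf4 _) (Lp.memLp _)

theorem continuous_corrV (hf4 : MemLp f 4) : Continuous (corrV hd f) :=
  continuous_corr (p := 4) (q := 4 / 3) ENNReal.ofNat_ne_top
    (memLp_smul_four_thirds (memLp_vertVel hd f) hf4) hf4

theorem abs_corrH_le (hf4 : MemLp f 4) (i : Fin d) (y : Torus d) :
    |corrH hd f i y| ≤ gradSum f * (eLpNorm f 4).toReal ^ 2 := by
  refine (abs_corr_le (p := 2) (q := 2) (memLp_apply_smul hf4 _) (Lp.memLp _) y).trans ?_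
  rw [mul_comm, eLpNorm_coe_toReal]
  refine mul_le_mul (norm_weakPartial_le f _) ?_ ENNReal.toReal_nonneg (gradSum_nonneg f)
  rw [sq, ← ENNReal.toReal_mul]
  exact ENNReal.toReal_mono (ENNReal.mul_ne_top hf4.2.ne hf4.2.ne) (eLpNorm_apply_smul_le hf4 _)

theorem abs_corrV_le (hf4 : MemLp f 4) (y : Torus d) :
    |corrV hd f y| ≤ 2 * Real.pi * gradSum f * (eLpNorm f 4).toReal ^ 2 := by
  refine (abs_corr_le (p := 4) (q := 4 / 3)
    (memLp_smul_four_thirds (memLp_vertVel hd f) hf4) hf4 y).trans ?_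
  have h1 := ENNReal.toReal_mono (ENNReal.mul_ne_top (memLp_vertVel hd f).2.ne hf4.2.ne)
    (eLpNorm_smul_four_thirds_le (memLp_vertVel hd f) hf4)
  rw [ENNReal.toReal_mul] at h1
  rw [sq, ← mul_assoc]
  refine mul_le_mul_of_nonneg_right (h1.trans ?_) ENNReal.toReal_nonneg
  exact mul_le_mul_of_nonneg_right (eLpNorm_vertVel_le hd f) ENNReal.toReal_nonneg

theorem continuous_corrTransport (hf4 : MemLp f 4) (h : ℝ) : Continuous (corrTransport hd f h) := by
  refine (continuous_finsetSum _ fun i _ => continuous_steklov h (continuous_corrH hd hf4 i)).add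
    (continuous_const.mul (Continuous.sub ?_ ?_))
  · exact (continuous_corrV hd hf4).comp (continuous_id.sub continuous_const)
  · exact (continuous_corrV hd hf4).comp (continuous_id.add continuous_const)

/-- Crude in `h`: each vertical correlation is estimated separately. It serves only as a majorant
for the limit in the kernel at fixed `h`, where displacements other than zero occur. -/
theorem abs_corrTransport_le (hf4 : MemLp f 4) {h : ℝ} (hh : 0 < h) (y : Torus d) :
    |corrTransport hd f h y| ≤
      (d + 2 * Real.pi * h⁻¹) * (gradSum f * (eLpNorm f 4).toReal ^ 2) := by
  have h1 : |∑ i : Fin d, steklov h (corrH hd f i) y| ≤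
      d * (gradSum f * (eLpNorm f 4).toReal ^ 2) := by
    refine (Finset.abs_sum_le_sum_abs _ _).trans ?_
    refine (Finset.sum_le_sum fun i _ => abs_steklov_le hh (abs_corrH_le hd hf4 i) y).trans ?_
    simp
  have h2 : |corrV hd f (y - shift none h) - corrV hd f (y + shift none h)| ≤
      2 * (2 * Real.pi * gradSum f * (eLpNorm f 4).toReal ^ 2) := by
    refine (abs_sub _ _).trans ?_
    linarith [abs_corrV_le hd hf4 (y - shift none h), abs_corrV_le hd hf4 (y + shift none h)]
  refine (abs_add_le _ _).trans ?_
  rw [add_mul]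
  refine add_le_add h1 ?_
  rw [abs_mul, abs_of_pos (by positivity : 0 < (2 * h)⁻¹)]
  refine (mul_le_mul_of_nonneg_left h2 (by positivity)).trans_eq ?_
  rw [mul_inv]
  ring

/-- At displacement zero the commutator structure is available and the factor `h⁻¹` disappears. This
is the majorant for the limit `h → 0`. -/
theorem abs_corrTransport_zero_le (hf : MemSolenoidal hd f) (hf1 : MemH1 f) (hf4 : MemLp f 4)
    {h : ℝ} (hh : 0 < h) :
    |corrTransport hd f h 0| ≤ (d + 1) * (gradSum f * (eLpNorm f 4).toReal ^ 2) := by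
  have hdiv := memLp_divH hd f
  have h1 : |∑ i : Fin d, steklov h (corrH hd f i) 0| ≤
      d * (gradSum f * (eLpNorm f 4).toReal ^ 2) := by
    refine (Finset.abs_sum_le_sum_abs _ _).trans ?_
    refine (Finset.sum_le_sum fun i _ => abs_steklov_le hh (abs_corrH_le hd hf4 i) 0).trans ?_
    simp
  have h2 := abs_commutator_le (g := fun x => -divH hd f x) hdiv.neg hf4
    (hasDiffQuot_vertPrim (stronglyMeasurable_divH hd f) hdiv
      (ae_integral_divH_eq_zero hd hf hf1)) hh
  have h3 : (eLpNorm (fun x => -divH hd f x) 2).toReal ≤ gradSum f := by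
    have : eLpNorm (fun x => -divH hd f x) 2 = eLpNorm (divH hd f) 2 := eLpNorm_neg _ _ _
    rw [this]; exact eLpNorm_divH_le hd f
  rw [corrTransport, zero_sub, zero_add]
  refine (abs_add_le _ _).trans ?_
  rw [add_mul, one_mul]
  refine add_le_add h1 (h2.trans ?_)
  exact mul_le_mul_of_nonneg_right h3 (sq_nonneg _)

/-- The horizontal part tends to `-½ ∫ div_H f |f|²` and the vertical commutator to `+½ ∫ div_H f
|f|²`, since `∂_z w = -div_H f`. The cancellation is the incompressibility of the transporting
velocity. -/
theorem tendsto_corrTransport (hf : MemSolenoidal hd f) (hf1 : MemH1 f) (hf4 : MemLp f 4) :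
    Tendsto (fun h => corrTransport hd f h 0) (𝓝[>] 0) (𝓝 0) := by
  have hdiv := memLp_divH hd f
  have h1 : Tendsto (fun h => ∑ i : Fin d, steklov h (corrH hd f i) 0) (𝓝[>] 0)
      (𝓝 (∑ i : Fin d, corrH hd f i 0)) :=
    tendsto_finsetSum _ fun i _ => tendsto_steklov (continuous_corrH hd hf4 i) 0
  have h2 := tendsto_commutator (g := fun x => -divH hd f x) hdiv.neg hf4
    (hasDiffQuot_vertPrim (stronglyMeasurable_divH hd f) hdiv
      (ae_integral_divH_eq_zero hd hf hf1))
  have h3 := h1.add h2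
  have hsq : MemLp (fun x => ‖f x‖ ^ 2) 2 := by
    have := memLp_inner hf4 hf4
    simpa only [real_inner_self_eq_norm_sq] using this
  have hz : (∑ i : Fin d, corrH hd f i 0) + -(1 / 2) * ∫ x, -divH hd f x * ‖f x‖ ^ 2 = 0 := by
    have ha : ∀ i : Fin d, corrH hd f i 0 =
        -(1 / 2) * ∫ x, weakPartial (some i) f x (Fin.castLE hd i) * ‖f x‖ ^ 2 := fun i => by
      rw [← integral_apply_mul_inner (hf1.isWeakPartial (some i)) hf4]
      simp only [corrH, corr, sub_zero]
    have hb : ∫ x, -divH hd f x * ‖f x‖ ^ 2 =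
        -∑ i : Fin d, ∫ x, weakPartial (some i) f x (Fin.castLE hd i) * ‖f x‖ ^ 2 := by
      have hi : ∀ i : Fin d, Integrable fun x =>
          weakPartial (some i) f x (Fin.castLE hd i) * ‖f x‖ ^ 2 := fun i =>
        (memLp_apply (Lp.memLp (weakPartial (some i) f)) (Fin.castLE hd i)).integrable_mul hsq
      rw [← integral_finsetSum _ fun i _ => hi i, ← integral_neg]
      simp only [divH, neg_mul, Finset.sum_mul]
    simp only [ha, hb, ← Finset.mul_sum]
    ring
  rw [hz] at h3
  refine h3.congr fun h => ?_
  rw [corrTransport, zero_sub, zero_add]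
  rfl

theorem integrable_transport_mul_inner (hd : d ≤ 2) (f : L2 d) {u : Torus d → Vel}
    (hu : Continuous u) (j : Option (Fin d)) :
    Integrable fun x => transport hd f j x * inner ℝ (f x) (u x) := by
  obtain ⟨C, hC⟩ := isCompact_univ.exists_bound_of_continuousOn hu.continuousOn
  have h1 : MemLp (fun x => inner ℝ (f x) (u x)) 2 := by
    refine MemLp.of_le_mul (c := C) (Lp.memLp f) ((Lp.memLp f).1.inner hu.aestronglyMeasurable)
      (ae_of_all _ fun x => (norm_inner_le_norm _ _).trans ?_)
    rw [mul_comm]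
    exact mul_le_mul_of_nonneg_right (hC x (mem_univ _)) (norm_nonneg _)
  exact (memLp_transport hd f j).integrable_mul h1

/-- Horizontal derivatives pass from the kernel to `f`, which has them in `L²`. The vertical one
stays on the kernel as a difference quotient and is transferred by translation to the correlation of
`w f ∈ L^{4/3}` with `f ∈ L⁴`. -/
theorem integral_transport_conv (hf1 : MemH1 f) (hf4 : MemLp f 4) (h : ℝ) (m : ℕ) :
    ∫ x, ∑ j : Option (Fin d), transport hd f j x *
      inner ℝ (f x) (conv (partialDeriv j (steklov h (peakKernel (torusPeak d) m))) f x) =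
    ∫ y, peakKernel (torusPeak d) m y * corrTransport hd f h y := by
  set κ := peakKernel (torusPeak d) m with hκdef
  have hκ : Continuous κ := isPeak_torusPeak.continuous_peakKernel m
  have hs : IsSmooth (steklov h κ) := isSmooth_steklov_peakKernel h m
  have hfi : Integrable f := (Lp.memLp f).integrable one_le_two
  have hci : ∀ {u : Torus d → ℝ}, Continuous u → Integrable u := fun {u} hu =>
    hu.integrable_of_hasCompactSupport (HasCompactSupport.of_compactSpace _)
  have hcm : ∀ {u w : Torus d → ℝ}, Continuous u → Continuous w → Integrable fun y => u y * w y :=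
    fun hu hw => hci (hu.mul hw)
  rw [integral_finsetSum _ fun j _ => integrable_transport_mul_inner hd f
    (continuous_conv (hs.continuous_partialDeriv j) hfi) j, Fintype.sum_option, add_comm]
  have hH : ∀ i : Fin d, ∫ x, transport hd f (some i) x *
      inner ℝ (f x) (conv (partialDeriv (some i) (steklov h κ)) f x) =
      ∫ y, κ y * steklov h (corrH hd f i) y := fun i => by
    have h1 : ∀ x, transport hd f (some i) x *
        inner ℝ (f x) (conv (partialDeriv (some i) (steklov h κ)) f x) =
        inner ℝ (f x (Fin.castLE hd i) • f x) (conv (steklov h κ) (weakPartial (some i) f) x) :=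
      fun x => by
        rw [hs.conv_partialDeriv (hf1.isWeakPartial (some i)), real_inner_smul_left]; rfl
    simp only [h1]
    rw [integral_inner_conv hs.continuous ((memLp_apply_smul hf4 _).integrable one_le_two)
      ((Lp.memLp _).integrable one_le_two),
      ← integral_steklov_mul h hκ (continuous_corrH hd hf4 i)]
    rfl
  have hV : ∫ x, transport hd f none x *
      inner ℝ (f x) (conv (partialDeriv none (steklov h κ)) f x) =
      ∫ y, κ y * ((2 * h)⁻¹ * (corrV hd f (y - shift none h) - corrV hd f (y + shift none h))) := by
    have h1 : ∀ x, transport hd f none x *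
        inner ℝ (f x) (conv (partialDeriv none (steklov h κ)) f x) =
        inner ℝ (vertVel hd f x • f x) (conv (partialDeriv none (steklov h κ)) f x) := fun x => by
      rw [real_inner_smul_left]; rfl
    simp only [h1]
    have hF : Integrable fun x => vertVel hd f x • f x :=
      (memLp_smul_four_thirds (memLp_vertVel hd f) hf4).integrable Fact.out
    rw [integral_inner_conv (hs.continuous_partialDeriv none) hF hfi]
    have hVc := continuous_corrV hd hf4
    change ∫ y, partialDeriv none (steklov h κ) y * corrV hd f y = _
    simp only [partialDeriv_steklov hκ]
    have e1 : ∫ y, κ (y + shift none h) * corrV hd f y =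
        ∫ y, κ y * corrV hd f (y - shift none h) := by
      rw [← integral_add_right_eq_self (fun y => κ y * corrV hd f (y - shift none h)) (shift none h)]
      simp
    have e2 : ∫ y, κ (y - shift none h) * corrV hd f y =
        ∫ y, κ y * corrV hd f (y + shift none h) := by
      rw [← integral_sub_right_eq_self (fun y => κ y * corrV hd f (y + shift none h)) (shift none h)]
      simp
    have c1 : Continuous fun y => κ (y + shift none h) := hκ.comp (continuous_id.add continuous_const)
    have c2 : Continuous fun y => κ (y - shift none h) := hκ.comp (continuous_id.sub continuous_const)
    have c3 : Continuous fun y => corrV hd f (y - shift none h) :=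
      hVc.comp (continuous_id.sub continuous_const)
    have c4 : Continuous fun y => corrV hd f (y + shift none h) :=
      hVc.comp (continuous_id.add continuous_const)
    calc ∫ y, (2 * h)⁻¹ * (κ (y + shift none h) - κ (y - shift none h)) * corrV hd f y
        = (2 * h)⁻¹ * ((∫ y, κ (y + shift none h) * corrV hd f y) -
            ∫ y, κ (y - shift none h) * corrV hd f y) := by
          rw [← integral_sub (hcm c1 hVc) (hcm c2 hVc), ← integral_const_mul]
          congr 1; funext y; ring
      _ = _ := by
          rw [e1, e2, ← integral_sub (hcm hκ c3) (hcm hκ c4), ← integral_const_mul]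
          congr 1; funext y; ring
  simp only [hH, hV]
  rw [← integral_finsetSum _ fun i _ =>
    hcm hκ (continuous_steklov h (continuous_corrH hd hf4 i)), ← integral_add]
  · refine integral_congr_ae (ae_of_all _ fun y => ?_)
    simp only [corrTransport, mul_add, Finset.mul_sum]
  · exact hci (continuous_finsetSum _ fun i _ =>
      hκ.mul (continuous_steklov h (continuous_corrH hd hf4 i)))
  · exact hci (hκ.mul (continuous_const.mul
      (((continuous_corrV hd hf4).comp (continuous_id.sub continuous_const)).sub
        ((continuous_corrV hd hf4).comp (continuous_id.add continuous_const)))))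

end Transport

end

noncomputable section

/-! ### Two lemmas about functions of time -/

/-- A scalar equation `m' = -n`, `m(0) = m₀` in the weak sense holds in the integrated sense. -/
theorem eq_sub_integral_of_weak {m n : ℝ → ℝ} {m₀ : ℝ} (hm : ContinuousOn m (Ici 0))
    (hn : ∀ R, IntegrableOn n (Ioo 0 R))
    (hw : ∀ θ θ' : ℝ → ℝ, (∀ t, HasDerivAt θ (θ' t) t) → Continuous θ' →
      (∃ R, ∀ t, R ≤ t → θ t = 0) →
      -(∫ τ in Ioi (0 : ℝ), m τ * θ' τ) + ∫ τ in Ioi (0 : ℝ), θ τ * n τ = θ 0 * m₀)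
    {t : ℝ} (ht : 0 ≤ t) : m t = m₀ - ∫ τ in (0 : ℝ)..t, n τ := by
  set R : ℝ := t + 1
  have hR : 0 < R := by positivity
  set n' : ℝ → ℝ := (Ioo 0 R).indicator n with hn'
  have hint : Integrable n' := (integrable_indicator_iff measurableSet_Ioo).2 (hn R)
  set N : ℝ → ℝ := fun τ => ∫ s in (0 : ℝ)..τ, n' s with hN
  have hNc : Continuous N := intervalIntegral.continuous_primitive
    (fun a b => hint.intervalIntegrable) 0
  -- The defect of the claimed identity. The truncation `max τ 0` makes it continuous on all of `ℝ`,
  -- since `m` is controlled only for nonnegative times.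
  set q : ℝ → ℝ := fun τ => m (max τ 0) + N (max τ 0) - m₀ with hq
  have hqc : Continuous q := by
    refine ((hm.comp_continuous (continuous_id.max continuous_const) fun x => ?_).add
      (hNc.comp (continuous_id.max continuous_const))).sub continuous_const
    exact le_max_right x (0 : ℝ)
  -- The test function is chosen with derivative `-(R - τ)₊ q`, so that the weak equation says `∫ (R
  -- - τ)₊ q² = 0`. With `R = t + 1` the weight is positive at `t`, and continuity of `q` gives
  -- `q(t) = 0`.
  set e : ℝ → ℝ := fun τ => max (R - τ) 0 * q τ with he
  have hec : Continuous e := by fun_prop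
  set θ : ℝ → ℝ := fun τ => -∫ s in R..τ, e s with hθ
  have hθd : ∀ τ, HasDerivAt θ (-e τ) τ := fun τ =>
    (intervalIntegral.integral_hasDerivAt_right (hec.intervalIntegrable _ _)
      (hec.stronglyMeasurableAtFilter _ _) hec.continuousAt).neg
  have he0 : ∀ τ, R ≤ τ → e τ = 0 := fun τ h => by
    simp [he, max_eq_right (sub_nonpos.2 h)]
  have hθ0 : ∀ τ, R ≤ τ → θ τ = 0 := fun τ h => by
    simp only [hθ, neg_eq_zero]
    rw [intervalIntegral.integral_congr (g := fun _ => 0), intervalIntegral.integral_zero]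
    intro s hs
    rw [uIcc_of_le h] at hs
    exact he0 s hs.1
  have hθR : θ R = 0 := hθ0 R le_rfl
  have key := hw θ (fun τ => -e τ) hθd hec.neg ⟨R, hθ0⟩
  have hcut : ∀ F : ℝ → ℝ, (∀ τ, R ≤ τ → F τ = 0) →
      ∫ τ in Ioi (0 : ℝ), F τ = ∫ τ in (0 : ℝ)..R, F τ := fun F hF => by
    rw [intervalIntegral.integral_of_le hR.le]
    refine setIntegral_eq_of_subset_of_forall_sdiff_eq_zero measurableSet_Ioi
      Ioc_subset_Ioi_self fun x hx => hF x ?_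
    by_contra h
    exact hx.2 ⟨hx.1, (not_le.1 h).le⟩
  rw [hcut _ fun τ h => by simp [he0 τ h], hcut _ fun τ h => by simp [hθ0 τ h]] at key
  have hnn : ∫ τ in (0 : ℝ)..R, θ τ * n τ = ∫ τ in (0 : ℝ)..R, θ τ * n' τ := by
    rw [intervalIntegral.integral_of_le hR.le, intervalIntegral.integral_of_le hR.le,
      integral_Ioc_eq_integral_Ioo, integral_Ioc_eq_integral_Ioo]
    refine setIntegral_congr_fun measurableSet_Ioo fun x hx => ?_
    simp [hn', indicator_of_mem hx]
  -- The primitive `N` is only absolutely continuous. The boundary terms vanish because `θ(R) = 0`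
  -- and `N(0) = 0`.
  have hparts : ∫ τ in (0 : ℝ)..R, θ τ * n' τ = ∫ τ in (0 : ℝ)..R, e τ * N τ := by
    have hNac : AbsolutelyContinuousOnInterval N 0 R :=
      (hint.intervalIntegrable (a := 0) (b := R)).absolutelyContinuousOnInterval_intervalIntegral
        (by simp)
    have hθac : AbsolutelyContinuousOnInterval θ 0 R := by
      have := ((hec.intervalIntegrable (μ := volume)
        0 R).absolutelyContinuousOnInterval_intervalIntegral (c := R) (by simp)).neg
      exact this
    have hp := hθac.integral_mul_deriv_eq_deriv_mul hNac
    have h1 : ∫ τ in (0 : ℝ)..R, θ τ * deriv N τ = ∫ τ in (0 : ℝ)..R, θ τ * n' τ := by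
      refine intervalIntegral.integral_congr_ae ?_
      filter_upwards [(hint.intervalIntegrable (a := 0) (b := R)).ae_hasDerivAt_integral]
        with τ hτ hτm
      rw [(hτ (uIoc_subset_uIcc hτm) 0 (by simp)).deriv]
    have h2 : ∫ τ in (0 : ℝ)..R, deriv θ τ * N τ = -∫ τ in (0 : ℝ)..R, e τ * N τ := by
      rw [← intervalIntegral.integral_neg]
      refine intervalIntegral.integral_congr fun τ _ => ?_
      simp only [(hθd τ).deriv]
      ring
    rw [h1, h2, hθR] at hp
    rw [hp]
    simp [hN]
  have hθz : θ 0 = ∫ τ in (0 : ℝ)..R, e τ := by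
    simp only [hθ]
    rw [intervalIntegral.integral_symm R 0]
  have hzero : ∫ τ in (0 : ℝ)..R, e τ * q τ = 0 := by
    have hmm : ContinuousOn m (uIcc 0 R) := hm.mono (by rw [uIcc_of_le hR.le]; exact Icc_subset_Ici_self)
    have hsplit : ∫ τ in (0 : ℝ)..R, e τ * q τ = (∫ τ in (0 : ℝ)..R, e τ * m τ) +
        (∫ τ in (0 : ℝ)..R, e τ * N τ) - ∫ τ in (0 : ℝ)..R, e τ * m₀ := by
      rw [← intervalIntegral.integral_add, ← intervalIntegral.integral_sub]
      · refine intervalIntegral.integral_congr fun τ hτ => ?_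
        rw [uIcc_of_le hR.le] at hτ
        simp only [hq, max_eq_left hτ.1]
        ring
      · exact ((hec.continuousOn.mul hmm).add
          (hec.mul hNc).continuousOn).intervalIntegrable
      · exact (hec.mul continuous_const).intervalIntegrable _ _
      · exact (hec.continuousOn.mul hmm).intervalIntegrable
      · exact (hec.mul hNc).intervalIntegrable _ _
    rw [hnn, hparts, hθz, ← intervalIntegral.integral_neg] at key
    rw [hsplit, intervalIntegral.integral_mul_const, ← key]
    have : ∀ τ, -(m τ * -e τ) = e τ * m τ := fun τ => by ring
    simp only [this]
    ring
  have hqt : q t = 0 := by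
    by_contra hne
    have hpos := intervalIntegral.integral_pos (f := fun τ => e τ * q τ) hR
      (hec.mul hqc).continuousOn
      (fun x _ => by
        simp only [he]
        have := le_max_right (R - x) 0
        nlinarith [mul_nonneg this (mul_self_nonneg (q x))])
      ⟨t, ⟨ht, by simp [R]⟩, by
        simp only [he, R]
        rw [max_eq_left (by linarith)]
        have := mul_self_pos.2 hne
        nlinarith⟩
    exact hpos.ne' hzero
  have hNt : N t = ∫ τ in (0 : ℝ)..t, n τ := by
    simp only [hN]
    rw [intervalIntegral.integral_of_le ht, intervalIntegral.integral_of_le ht,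
      integral_Ioc_eq_integral_Ioo, integral_Ioc_eq_integral_Ioo]
    refine setIntegral_congr_fun measurableSet_Ioo fun x hx => ?_
    have : x ∈ Ioo 0 R := ⟨hx.1, hx.2.trans (by simp [R])⟩
    simp [hn', indicator_of_mem this]
  simp only [hq, max_eq_left ht, hNt] at hqt
  linarith

/-- The product rule for a quadratic form along a weakly continuous curve: the symmetric difference
formula for `E` implies that `E' = 2 ⟪u, v⟫`. -/
theorem energy_of_symm_diff {H : Type*} [NormedAddCommGroup H] [InnerProductSpace ℝ H]
    {v u : ℝ → H} {E G : ℝ → ℝ} {t K : ℝ} (ht : 0 < t)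
    (hv : ∀ g, ContinuousOn (fun τ => inner ℝ (v τ) g) (Icc 0 t))
    (hK : ∀ τ ∈ Icc 0 t, ‖v τ‖ ≤ K)
    (hG : IntegrableOn G (Ioc 0 t))
    (hu : ∀ᵐ τ ∂volume.restrict (Ioc 0 t), ‖u τ‖ ≤ G τ)
    (hum : ∀ g, AEStronglyMeasurable (fun τ => inner ℝ (u τ) g) (volume.restrict (Ioc 0 t)))
    (hE : ∀ a b, 0 ≤ a → a ≤ b → b ≤ t → E b - E a = ∫ τ in a..b, inner ℝ (u τ) (v b + v a)) :
    AEStronglyMeasurable (fun τ => inner ℝ (u τ) (v τ)) (volume.restrict (Ioc 0 t)) ∧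
      E t - E 0 = 2 * ∫ τ in (0 : ℝ)..t, inner ℝ (u τ) (v τ) := by
  have hK0 : 0 ≤ K := (norm_nonneg _).trans (hK 0 ⟨le_rfl, ht.le⟩)
  -- The partition of `[0, t]` into `n + 1` equal intervals. Below, `a n τ` and `b n τ` are the left
  -- and right ends of the cell containing `τ`.
  set p : ℕ → ℕ → ℝ := fun n i => i * (t / (n + 1)) with hp
  have hs : ∀ n : ℕ, 0 < t / ((n : ℝ) + 1) := fun n => by positivity
  have hp0 : ∀ n, p n 0 = 0 := fun n => by simp [hp]
  have hpt : ∀ n, p n (n + 1) = t := fun n => by simp only [hp]; push_cast; field_simp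
  have hpm : ∀ n, Monotone (p n) := fun n i j hij => by
    simp only [hp]
    gcongr
  set a : ℕ → ℝ → ℝ := fun n τ => p n ⌊τ / (t / (n + 1))⌋₊ with ha
  set b : ℕ → ℝ → ℝ := fun n τ => p n (⌊τ / (t / (n + 1))⌋₊ + 1) with hb
  set g : ℕ → ℝ → ℝ := fun n τ => inner ℝ (u τ) (v (b n τ) + v (a n τ)) with hg
  have hfl : ∀ n i τ, τ ∈ Ico (p n i) (p n (i + 1)) → ⌊τ / (t / (n + 1))⌋₊ = i := by
    intro n i τ hτ
    have h0 : 0 ≤ τ := le_trans (by simp only [hp]; positivity) hτ.1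
    rw [Nat.floor_eq_iff (div_nonneg h0 (hs n).le)]
    refine ⟨(le_div_iff₀ (hs n)).2 hτ.1, (div_lt_iff₀ (hs n)).2 ?_⟩
    have := hτ.2
    simp only [hp] at this
    exact_mod_cast this
  have haτ : ∀ n τ, 0 ≤ τ → a n τ ≤ τ := fun n τ h => by
    have := Nat.floor_le (div_nonneg h (hs n).le)
    exact (le_div_iff₀ (hs n)).1 this
  have hbτ : ∀ n τ, τ < b n τ := fun n τ => by
    have := Nat.lt_floor_add_one (τ / (t / ((n : ℝ) + 1)))
    rw [div_lt_iff₀ (hs n)] at this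
    simp only [hb, hp]
    exact_mod_cast this
  have hba : ∀ n τ, b n τ = a n τ + t / (n + 1) := fun n τ => by
    simp only [hb, ha, hp]
    push_cast
    ring
  have ha0 : ∀ n τ, 0 ≤ a n τ := fun n τ => by simp only [ha, hp]; positivity
  have hbt : ∀ n τ, 0 ≤ τ → τ < t → b n τ ≤ t := fun n τ h h' => by
    rw [← hpt n]
    refine hpm n ?_
    have : ⌊τ / (t / ((n : ℝ) + 1))⌋₊ < n + 1 := by
      rw [Nat.floor_lt (div_nonneg h (hs n).le), div_lt_iff₀ (hs n)]
      push_cast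
      field_simp
      linarith
    omega
  -- At `τ = t` the right end of the cell would lie beyond `t`, where nothing is assumed, so this
  -- point is discarded.
  have hlt : ∀ᵐ τ ∂volume.restrict (Ioc 0 t), 0 < τ ∧ τ < t := by
    have h1 : ∀ᵐ τ ∂volume.restrict (Ioc 0 t), τ ≠ t :=
      ae_restrict_of_ae (measure_eq_zero_iff_ae_notMem.1 (Real.volume_singleton (a := t)))
    filter_upwards [h1, ae_restrict_mem measurableSet_Ioc] with τ h2 h3
    exact ⟨h3.1, lt_of_le_of_ne h3.2 h2⟩
  have huv : ∀ x y, x ≤ y → 0 ≤ x → y ≤ t → ∀ f : H,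
      IntervalIntegrable (fun τ => inner ℝ (u τ) f) volume x y := by
    intro x y hxy hx hy f
    rw [intervalIntegrable_iff_integrableOn_Ioc_of_le hxy]
    have : IntegrableOn (fun τ => inner ℝ (u τ) f) (Ioc 0 t) := by
      refine (hG.mul_const ‖f‖).mono' (hum f) ?_
      filter_upwards [hu] with τ h
      exact (norm_inner_le_norm _ _).trans (by gcongr)
    exact this.mono_set (Ioc_subset_Ioc hx hy)
  have hcongr : ∀ n i, ∀ᵐ τ : ℝ, τ ∈ uIoc (p n i) (p n (i + 1)) →
      inner ℝ (u τ) (v (p n (i + 1)) + v (p n i)) = g n τ := by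
    intro n i
    have h1 : ∀ᵐ τ : ℝ, τ ≠ p n (i + 1) :=
      measure_eq_zero_iff_ae_notMem.1 (Real.volume_singleton (a := p n (i + 1)))
    filter_upwards [h1] with τ h2 h3
    rw [uIoc_of_le (hpm n (Nat.le_succ i))] at h3
    simp only [hg, ha, hb, hfl n i τ ⟨h3.1.le, lt_of_le_of_ne h3.2 h2⟩]
  have hpnn : ∀ n i, 0 ≤ p n i := fun n i => by simp only [hp]; positivity
  have hgi : ∀ n, ∀ i < n + 1, IntervalIntegrable (g n) volume (p n i) (p n (i + 1)) := by
    intro n i hi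
    refine (huv _ _ (hpm n (Nat.le_succ i)) (hpnn n i)
      (by rw [← hpt n]; exact hpm n hi) (v (p n (i + 1)) + v (p n i))).congr_ae ?_
    rw [EventuallyEq, ae_restrict_iff' measurableSet_uIoc]
    exact hcongr n i
  have hgtot : ∀ n, IntervalIntegrable (g n) volume 0 t := fun n => by
    have := IntervalIntegrable.trans_iterate (hgi n)
    rwa [hp0, hpt] at this
  -- The increments telescope exactly for every `n`, so the limit below identifies a constant
  -- sequence rather than an approximation.
  have hsum : ∀ n, E t - E 0 = ∫ τ in (0 : ℝ)..t, g n τ := fun n => by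
    have h1 := intervalIntegral.sum_integral_adjacent_intervals (hgi n)
    rw [hp0, hpt] at h1
    rw [← h1, ← hp0 n, ← hpt n, ← Finset.sum_range_sub (fun i => E (p n i))]
    refine Finset.sum_congr rfl fun i hi => ?_
    rw [hE _ _ (hpnn n i) (hpm n (Nat.le_succ i))
      (by rw [← hpt n]; exact hpm n (Finset.mem_range.1 hi))]
    exact intervalIntegral.integral_congr_ae (hcongr n i)
  have hlim0 : Tendsto (fun n : ℕ => t / ((n : ℝ) + 1)) atTop (𝓝 0) :=
    tendsto_const_div_atTop_nhds_zero_nat t |>.comp (tendsto_add_atTop_nat 1) |>.congr fun n => by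
      simp
  have hlim : ∀ᵐ τ ∂volume.restrict (Ioc 0 t),
      Tendsto (fun n => g n τ) atTop (𝓝 (2 * inner ℝ (u τ) (v τ))) := by
    filter_upwards [hlt] with τ hτ
    have hat : Tendsto (fun n => a n τ) atTop (𝓝[Icc 0 t] τ) := by
      refine tendsto_nhdsWithin_iff.2 ⟨?_, Eventually.of_forall fun n =>
        ⟨ha0 n τ, (haτ n τ hτ.1.le).trans hτ.2.le⟩⟩
      refine tendsto_of_tendsto_of_tendsto_of_le_of_le (g := fun n : ℕ => τ - t / ((n : ℝ) + 1))
        (by simpa using tendsto_const_nhds.sub hlim0) tendsto_const_nhds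
        (fun n => ?_) (fun n => haτ n τ hτ.1.le)
      have := hbτ n τ
      rw [hba] at this
      simp only
      linarith
    have hbt' : Tendsto (fun n => b n τ) atTop (𝓝[Icc 0 t] τ) := by
      refine tendsto_nhdsWithin_iff.2 ⟨?_, Eventually.of_forall fun n =>
        ⟨hτ.1.le.trans (hbτ n τ).le, hbt n τ hτ.1.le hτ.2⟩⟩
      refine tendsto_of_tendsto_of_tendsto_of_le_of_le (h := fun n : ℕ => τ + t / ((n : ℝ) + 1))
        tendsto_const_nhds (by simpa using tendsto_const_nhds.add hlim0)
        (fun n => (hbτ n τ).le) (fun n => ?_)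
      have := haτ n τ hτ.1.le
      simp only
      rw [hba]
      linarith
    -- Weak continuity is enough here: `u τ` is fixed while the cell ends converge to `τ`.
    have hc := hv (u τ) τ ⟨hτ.1.le, hτ.2.le⟩
    have := (hc.tendsto.comp hbt').add (hc.tendsto.comp hat)
    rw [two_mul, ← real_inner_comm]
    refine this.congr fun n => ?_
    simp only [hg, inner_add_right, Function.comp]
    rw [real_inner_comm, real_inner_comm (v (a n τ))]
  have hgm : ∀ n, AEStronglyMeasurable (g n) (volume.restrict (Ioc 0 t)) := fun n => by
    exact (hgtot n).aestronglyMeasurable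
  have hmeas := aestronglyMeasurable_of_tendsto_ae atTop hgm hlim
  refine ⟨by simpa using hmeas.const_mul (2⁻¹ : ℝ), ?_⟩
  have hconv := tendsto_integral_of_dominated_convergence (μ := volume.restrict (Ioc 0 t))
    (fun τ => G τ * (K + K)) hgm (hG.mul_const _) (fun n => by
      filter_upwards [hu, hlt] with τ h1 h2
      refine (norm_inner_le_norm _ _).trans ?_
      have hb1 := hK (b n τ) ⟨h2.1.le.trans (hbτ n τ).le, hbt n τ h2.1.le h2.2⟩
      have ha1 := hK (a n τ) ⟨ha0 n τ, (haτ n τ h2.1.le).trans h2.2.le⟩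
      gcongr
      · exact (norm_nonneg _).trans h1
      · exact (norm_add_le _ _).trans (add_le_add hb1 ha1)) hlim
  have hconst : ∀ n, ∫ τ in Ioc 0 t, g n τ = E t - E 0 := fun n => by
    rw [hsum n, intervalIntegral.integral_of_le ht.le]
  simp only [hconst] at hconv
  rw [tendsto_nhds_unique tendsto_const_nhds hconv, intervalIntegral.integral_of_le ht.le,
    integral_const_mul]

end

noncomputable section

variable {d : ℕ}

/-! ### Measurability in time of the transporting velocity -/

/-- Elements of `L²` subtract only almost everywhere, whereas the primitive sees a whole vertical
fibre. Fubini makes almost every fibre good. -/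
theorem vertPrim_sub_ae {D G H : Torus d → ℝ} (hG : Integrable G) (hH : Integrable H)
    (hD : D =ᵐ[volume] fun x => G x - H x) :
    vertPrim D =ᵐ[volume] fun x => vertPrim G x - vertPrim H x := by
  have hfib : ∀ᵐ x : HTorus d, ∀ᵐ z : Circle2Pi, D (x, z) = G (x, z) - H (x, z) :=
    ae_ae_of_ae_prod hD
  filter_upwards [ae_comp_fst hfib, ae_comp_fst hG.prod_right_ae, ae_comp_fst hH.prod_right_ae]
    with x h1 h2 h3
  have hz := equivIoc_mem x.2
  simp only [vertPrim]
  rw [← intervalIntegral.integral_sub (intervalIntegrable_coe h2 _ _)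
    (intervalIntegrable_coe h3 _ _)]
  refine intervalIntegral.integral_congr_ae_restrict ?_
  have hq := (AddCircle.measurePreserving_mk (2 * Real.pi) (-Real.pi)).quasiMeasurePreserving.ae h1
  rw [uIoc_of_le hz.2]
  exact ae_restrict_of_ae_restrict_of_subset (Ioc_subset_Ioc hz.1.le (by linarith)) hq

theorem memLp_vertPrim (G : Lp ℝ 2 (volume : Measure (Torus d))) : MemLp (vertPrim G) 2 :=
  ⟨(stronglyMeasurable_vertPrim (Lp.stronglyMeasurable G)).aestronglyMeasurable,
    (eLpNorm_vertPrim_le (Lp.aestronglyMeasurable G)).trans_lt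
      (ENNReal.mul_lt_top ENNReal.ofReal_lt_top (Lp.eLpNorm_lt_top G))⟩

/-- The vertical primitive as a map of `L²`. -/
def vertPrimLp (G : Lp ℝ 2 (volume : Measure (Torus d))) : Lp ℝ 2 (volume : Measure (Torus d)) :=
  (memLp_vertPrim G).toLp _

/-- Provides measurability in time: the vertical velocity is a continuous image in `L²` of the
measurable curve of gradients. -/
theorem lipschitzWith_vertPrimLp :
    LipschitzWith (2 * Real.pi).toNNReal (vertPrimLp (d := d)) := by
  refine LipschitzWith.of_dist_le_mul fun G H => ?_
  have hint : ∀ G : Lp ℝ 2 (volume : Measure (Torus d)), Integrable G := fun G =>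
    (Lp.memLp G).integrable one_le_two
  have h1 : eLpNorm (fun x => vertPrim G x - vertPrim H x) 2 ≤
      ENNReal.ofReal (2 * Real.pi) * eLpNorm (G - H : Lp ℝ 2 (volume : Measure (Torus d))) 2 := by
    rw [← eLpNorm_congr_ae (vertPrim_sub_ae (hint G) (hint H) (Lp.coeFn_sub G H))]
    exact eLpNorm_vertPrim_le (Lp.aestronglyMeasurable _)
  rw [dist_eq_norm, dist_eq_norm, vertPrimLp, vertPrimLp, ← MemLp.toLp_sub, Lp.norm_toLp, Lp.norm_def,
    Real.coe_toNNReal _ Real.two_pi_pos.le]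
  have h2 := ENNReal.toReal_mono
    (ENNReal.mul_ne_top ENNReal.ofReal_ne_top (Lp.eLpNorm_ne_top _)) h1
  rwa [ENNReal.toReal_mul, ENNReal.toReal_ofReal Real.two_pi_pos.le] at h2

/-- The horizontal divergence of the components of a family of `L²` fields. -/
def divLp (hd : d ≤ 2) (g : Fin d → L2 d) : Lp ℝ 2 (volume : Measure (Torus d)) :=
  ∑ i : Fin d, (EuclideanSpace.proj (Fin.castLE hd i) : Vel →L[ℝ] ℝ).compLp (g i)

/-- The components of the transporting velocity as elements of `L²`. -/
def transportLp (hd : d ≤ 2) (f : L2 d) (j : Option (Fin d)) :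
    Lp ℝ 2 (volume : Measure (Torus d)) := (memLp_transport hd f j).toLp _

theorem coeFn_divLp (hd : d ≤ 2) (f : L2 d) :
    divLp hd (fun i => weakPartial (some i) f) =ᵐ[volume] divH hd f := by
  have h1 : ∀ i : Fin d, (EuclideanSpace.proj (Fin.castLE hd i) : Vel →L[ℝ] ℝ).compLp
      (weakPartial (some i) f) =ᵐ[volume] fun x => weakPartial (some i) f x (Fin.castLE hd i) :=
    fun i => (EuclideanSpace.proj (Fin.castLE hd i) : Vel →L[ℝ] ℝ).coeFn_compLp _
  filter_upwards [Lp.coeFn_finsetSum Finset.univ (fun i : Fin d =>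
    (EuclideanSpace.proj (Fin.castLE hd i) : Vel →L[ℝ] ℝ).compLp (weakPartial (some i) f)),
    ae_all_iff.2 h1] with x hx1 hx2
  rw [divLp, hx1]
  simp [divH, hx2]

theorem transportLp_none (hd : d ≤ 2) (f : L2 d) :
    transportLp hd f none = vertPrimLp (divLp hd fun i => weakPartial (some i) f) := by
  refine MemLp.toLp_congr _ _ ?_
  have h := vertPrim_sub_ae (D := divLp hd fun i => weakPartial (some i) f) (H := 0)
    ((memLp_divH hd f).integrable one_le_two) (integrable_zero _ _ _)
    ((coeFn_divLp hd f).trans (by simp))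
  refine EventuallyEq.symm (h.trans (ae_of_all _ fun x => ?_))
  simp only [transport, vertVel, vertPrim, Pi.zero_apply, intervalIntegral.integral_zero, sub_zero]

theorem transportLp_some (hd : d ≤ 2) (f : L2 d) (i : Fin d) :
    transportLp hd f (some i) = (EuclideanSpace.proj (Fin.castLE hd i) : Vel →L[ℝ] ℝ).compLp f := by
  refine Lp.ext ((MemLp.coeFn_toLp _).trans ?_)
  exact EventuallyEq.symm ((EuclideanSpace.proj (Fin.castLE hd i) : Vel →L[ℝ] ℝ).coeFn_compLp f)

theorem norm_transportLp_le (hd : d ≤ 2) (f : L2 d) (j : Option (Fin d)) :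
    ‖transportLp hd f j‖ ≤ ‖f‖ + 2 * Real.pi * gradSum f := by
  rw [transportLp, Lp.norm_toLp]
  rcases j with _ | i
  · have h : (eLpNorm (transport hd f none) 2).toReal ≤ 2 * Real.pi * gradSum f :=
      eLpNorm_vertVel_le hd f
    exact h.trans (le_add_of_nonneg_left (norm_nonneg f))
  · have h := ENNReal.toReal_mono (Lp.eLpNorm_ne_top f) (eLpNorm_apply_le f (Fin.castLE hd i) 2)
    rw [eLpNorm_coe_toReal] at h
    have h2 : (eLpNorm (transport hd f (some i)) 2).toReal ≤ ‖f‖ := h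
    exact h2.trans (le_add_of_nonneg_right (mul_nonneg Real.two_pi_pos.le (gradSum_nonneg f)))

/-! ### Integrability in time of gradient and transport pairings -/

section Time

variable {v : ℝ → L2 d} {μ : Measure ℝ}

theorem memLp_gradSum (hg : ∀ j, MemLp (fun t => weakPartial j (v t)) 2 μ) :
    MemLp (fun t => gradSum (v t)) 2 μ :=
  memLp_finsetSum _ fun j _ => (hg j).norm

theorem memLp_transportLp (hd : d ≤ 2) (hv : MemLp v 2 μ)
    (hg : ∀ j, MemLp (fun t => weakPartial j (v t)) 2 μ) (j : Option (Fin d)) :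
    MemLp (fun t => transportLp hd (v t) j) 2 μ := by
  have hmeas : AEStronglyMeasurable (fun t => transportLp hd (v t) j) μ := by
    rcases j with _ | i
    · simp only [transportLp_none]
      refine lipschitzWith_vertPrimLp.continuous.comp_aestronglyMeasurable ?_
      refine Finset.aestronglyMeasurable_fun_sum _ fun i _ => ?_
      exact ((EuclideanSpace.proj (Fin.castLE hd i) : Vel →L[ℝ] ℝ).compLpL 2
        (volume : Measure (Torus d))).continuous.comp_aestronglyMeasurable (hg (some i)).1
    · simp only [transportLp_some]
      exact ((EuclideanSpace.proj (Fin.castLE hd i) : Vel →L[ℝ] ℝ).compLpL 2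
        (volume : Measure (Torus d))).continuous.comp_aestronglyMeasurable hv.1
  refine (hv.norm.add ((memLp_gradSum hg).const_mul (2 * Real.pi))).mono hmeas
    (ae_of_all _ fun t => (norm_transportLp_le hd (v t) j).trans ?_)
  exact le_abs_self _

theorem integrable_time_grad (hg : ∀ j, MemLp (fun t => weakPartial j (v t)) 2 μ)
    [IsFiniteMeasure μ] {D : Torus d → Vel} (hD : Continuous D) (j : Option (Fin d)) :
    Integrable (fun t => ∫ x, inner ℝ (weakPartial j (v t) x) (D x)) μ := by
  have hDm : MemLp D 2 := hD.memLp_of_hasCompactSupport (HasCompactSupport.of_compactSpace _)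
  have h : ∀ t, ∫ x, inner ℝ (weakPartial j (v t) x) (D x) =
      inner ℝ (weakPartial j (v t)) (hDm.toLp D) := fun t => by
    rw [L2.inner_def]
    refine integral_congr_ae ?_
    filter_upwards [hDm.coeFn_toLp] with x hx
    rw [hx]
  simp only [h]
  exact ((hg j).integrable one_le_two).inner_const _

theorem integrable_time_transport (hd : d ≤ 2) (hv : MemLp v 2 μ)
    (hg : ∀ j, MemLp (fun t => weakPartial j (v t)) 2 μ)
    {D : Torus d → Vel} (hD : Continuous D) (j : Option (Fin d)) :
    Integrable (fun t => ∫ x, transport hd (v t) j x * inner ℝ (v t x) (D x)) μ := by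
  have hDm : MemLp D ⊤ := hD.memLp_of_hasCompactSupport (HasCompactSupport.of_compactSpace _)
  -- Multiplication by the bounded field `D` as an operator on `L²`. The transport integral becomes
  -- a bounded bilinear pairing of two curves that are square integrable in time.
  set Q : Lp ℝ 2 (volume : Measure (Torus d)) →L[ℝ] L2 d :=
    ((ContinuousLinearMap.lsmul ℝ ℝ : ℝ →L[ℝ] Vel →L[ℝ] Vel).holderL volume 2 ⊤ 2).flip
      (hDm.toLp D) with hQ
  have h : ∀ t, ∫ x, transport hd (v t) j x * inner ℝ (v t x) (D x) =
      innerSL ℝ (v t) (Q (transportLp hd (v t) j)) := fun t => by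
    rw [innerSL_apply_apply, L2.inner_def]
    refine integral_congr_ae ?_
    have hco : Q (transportLp hd (v t) j) =ᵐ[volume]
        fun x => (transportLp hd (v t) j x) • (hDm.toLp D x) :=
      (ContinuousLinearMap.lsmul ℝ ℝ : ℝ →L[ℝ] Vel →L[ℝ] Vel).coeFn_holder _ _
    filter_upwards [hDm.coeFn_toLp, hco, (memLp_transport hd (v t) j).coeFn_toLp] with x h1 h2 h3
    rw [h2, h1, inner_smul_right, transportLp, h3]
  simp only [h]
  exact memLp_one_iff_integrable.1 ((innerSL ℝ : L2 d →L[ℝ] L2 d →L[ℝ] ℝ).memLp_of_bilin 1 hv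
    (Q.comp_memLp' (memLp_transportLp hd hv hg j)))

end Time

/-! ### The flux as an element of `L²` -/

/-- The flux `u_j v - ∂_j v`. -/
def flux (hd : d ≤ 2) (f : L2 d) (j : Option (Fin d)) (x : Torus d) : Vel :=
  transport hd f j x • f x - weakPartial j f x

theorem integrable_flux (hd : d ≤ 2) (f : L2 d) (j : Option (Fin d)) :
    Integrable (flux hd f j) :=
  (memLp_one_iff_integrable.1 ((Lp.memLp f).smul (memLp_transport hd f j))).sub
    ((Lp.memLp (weakPartial j f)).integrable one_le_two)

theorem integral_norm_le (g : L2 d) :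
    ∫ x, ‖g x‖ ≤ (eLpNorm (fun _ : Torus d => (1 : ℝ)) 2).toReal * ‖g‖ := by
  have h := abs_integral_inner_le (p := 2) (q := 2) (memLp_const (1 : ℝ)) (Lp.memLp g).norm
  rw [eLpNorm_norm, eLpNorm_coe_toReal] at h
  refine le_trans (le_of_eq ?_) ((le_abs_self _).trans h)
  simp

theorem integral_norm_flux_le (hd : d ≤ 2) (f : L2 d) (j : Option (Fin d)) :
    ∫ x, ‖flux hd f j x‖ ≤ ‖transportLp hd f j‖ * ‖f‖ +
      (eLpNorm (fun _ : Torus d => (1 : ℝ)) 2).toReal * ‖weakPartial j f‖ := by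
  have h1 : Integrable fun x => ‖transport hd f j x • f x‖ :=
    (memLp_one_iff_integrable.1 ((Lp.memLp f).smul (memLp_transport hd f j))).norm
  have h2 : Integrable fun x => ‖weakPartial j f x‖ :=
    ((Lp.memLp (weakPartial j f)).integrable one_le_two).norm
  have h3 := abs_integral_inner_le (p := 2) (q := 2) (memLp_transport hd f j).norm (Lp.memLp f).norm
  rw [eLpNorm_norm, eLpNorm_norm, eLpNorm_coe_toReal] at h3
  calc ∫ x, ‖flux hd f j x‖ ≤ ∫ x, (‖transport hd f j x • f x‖ + ‖weakPartial j f x‖) :=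
        integral_mono (integrable_flux hd f j).norm (h1.add h2) fun x => norm_sub_le _ _
    _ = (∫ x, ‖transport hd f j x • f x‖) + ∫ x, ‖weakPartial j f x‖ := integral_add h1 h2
    _ ≤ _ := by
        refine add_le_add ?_ (integral_norm_le _)
        rw [transportLp, Lp.norm_toLp]
        refine le_trans (le_of_eq ?_) ((le_abs_self _).trans h3)
        refine integral_congr_ae (ae_of_all _ fun x => ?_)
        simp [norm_smul, mul_comm]

/-- The pairing of the flux with the gradient of a mollified field. -/
def fluxPairing (hd : d ≤ 2) (κ : Torus d → ℝ) (f g : L2 d) : ℝ :=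
  ∑ j : Option (Fin d), ∫ x, inner ℝ (flux hd f j x) (conv (partialDeriv j κ) g x)

theorem inner_flux (hd : d ≤ 2) (f : L2 d) (j : Option (Fin d)) (x : Torus d) (D : Vel) :
    inner ℝ (flux hd f j x) D =
      transport hd f j x * inner ℝ (f x) D - inner ℝ (weakPartial j f x) D := by
  rw [flux, inner_sub_left, real_inner_smul_left]

theorem integrable_inner_continuous (g : L2 d) {D : Torus d → Vel} (hD : Continuous D) :
    Integrable fun x => inner ℝ (g x) (D x) :=
  memLp_one_iff_integrable.1 ((innerSL ℝ : Vel →L[ℝ] Vel →L[ℝ] ℝ).memLp_of_bilin 1 (Lp.memLp g)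
    (hD.memLp_of_hasCompactSupport (HasCompactSupport.of_compactSpace _) (p := 2)))

theorem integral_inner_flux (hd : d ≤ 2) (f : L2 d) (j : Option (Fin d)) {D : Torus d → Vel}
    (hD : Continuous D) : ∫ x, inner ℝ (flux hd f j x) (D x) =
      (∫ x, transport hd f j x * inner ℝ (f x) (D x)) -
        ∫ x, inner ℝ (weakPartial j f x) (D x) := by
  simp only [inner_flux]
  exact integral_sub (integrable_transport_mul_inner hd f hD j) (integrable_inner_continuous _ hD)

/-- The function representing `fluxPairing`. -/
def fluxRep (hd : d ≤ 2) (κ : Torus d → ℝ) (f : L2 d) (x : Torus d) : Vel :=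
  ∑ j : Option (Fin d), conv (fun y => partialDeriv j κ (-y)) (flux hd f j) x

section Rep

variable {κ : Torus d → ℝ}

theorem continuous_partialDeriv_neg (hκ : IsSmooth κ) (j : Option (Fin d)) :
    Continuous fun y => partialDeriv j κ (-y) := (hκ.continuous_partialDeriv j).comp continuous_neg

theorem memLp_fluxRep (hκ : IsSmooth κ) (hd : d ≤ 2) (f : L2 d) : MemLp (fluxRep hd κ f) 2 :=
  memLp_finsetSum _ fun j _ => memLp_conv (continuous_partialDeriv_neg hκ j) (integrable_flux hd f j) 2

/-- The element of `L²` representing `fluxPairing`. -/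
def fluxVec (hκ : IsSmooth κ) (hd : d ≤ 2) (f : L2 d) : L2 d := (memLp_fluxRep hκ hd f).toLp _

/-- The convolution is moved to the flux by reflecting the kernel. In this form the pairing is an
inner product with a fixed `L²` vector at each time, as `energy_of_symm_diff` requires. -/
theorem inner_fluxVec (hκ : IsSmooth κ) (hd : d ≤ 2) (f g : L2 d) :
    inner ℝ (fluxVec hκ hd f) g = fluxPairing hd κ f g := by
  have hgi : Integrable g := (Lp.memLp g).integrable one_le_two
  rw [real_inner_comm, L2.inner_def]
  have h1 : ∫ x, inner ℝ (g x) (fluxVec hκ hd f x) = ∫ x, inner ℝ (g x) (fluxRep hd κ f x) := by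
    refine integral_congr_ae ?_
    filter_upwards [(memLp_fluxRep hκ hd f).coeFn_toLp] with x hx
    rw [fluxVec, hx]
  rw [h1]
  simp only [fluxRep, inner_sum, fluxPairing]
  rw [integral_finsetSum _ fun j _ => integrable_inner_continuous g
    (continuous_conv (continuous_partialDeriv_neg hκ j) (integrable_flux hd f j))]
  refine Finset.sum_congr rfl fun j _ => ?_
  rw [integral_inner_conv (continuous_partialDeriv_neg hκ j) hgi (integrable_flux hd f j),
    integral_inner_conv (hκ.continuous_partialDeriv j) (integrable_flux hd f j) hgi,
    ← integral_neg_eq_self]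
  simp [corr_neg]

/-- The flux is only integrable in space, since it contains a product of two `L²` functions, but
convolution with a bounded kernel makes it bounded. The right-hand side is integrable in time for a
weak solution. -/
theorem exists_norm_fluxVec_le (hκ : IsSmooth κ) (hd : d ≤ 2) : ∃ C, 0 ≤ C ∧ ∀ f : L2 d, ‖fluxVec hκ hd f‖ ≤
    C * ∑ j : Option (Fin d), (‖transportLp hd f j‖ * ‖f‖ +
      (eLpNorm (fun _ : Torus d => (1 : ℝ)) 2).toReal * ‖weakPartial j f‖) := by
  choose C hC0 hC using fun j : Option (Fin d) =>
    exists_abs_le_of_continuous (continuous_partialDeriv_neg hκ j)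
  have hCs : ∀ j, C j ≤ ∑ j, C j := fun j =>
    Finset.single_le_sum (fun j _ => hC0 j) (Finset.mem_univ j)
  refine ⟨measureUnivNNReal (volume : Measure (Torus d)) ^ ((2 : ℝ≥0∞).toReal⁻¹) * ∑ j, C j,
    mul_nonneg (by positivity) (Finset.sum_nonneg fun j _ => hC0 j), fun f => ?_⟩
  rw [mul_assoc]
  refine Lp.norm_le_of_ae_bound (mul_nonneg (Finset.sum_nonneg fun j _ => hC0 j)
    (Finset.sum_nonneg fun j _ => by positivity)) ?_
  filter_upwards [(memLp_fluxRep hκ hd f).coeFn_toLp] with x hx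
  rw [fluxVec, hx, fluxRep, Finset.mul_sum]
  refine (norm_sum_le _ _).trans (Finset.sum_le_sum fun j _ => ?_)
  refine (norm_conv_le (hC j) (integrable_flux hd f j) x).trans ?_
  exact mul_le_mul (hCs j) (integral_norm_flux_le hd f j)
    (integral_nonneg fun _ => norm_nonneg _) (Finset.sum_nonneg fun j _ => hC0 j)

end Rep

/-! ### The energy identity of the mollified equation -/

/-- Weak continuity on a compact set gives pointwise bounds for the functionals `⟨v(t), ·⟩`, and the
uniform boundedness principle makes them uniform. -/
theorem exists_norm_le_of_weak_continuous {H : Type*} [NormedAddCommGroup H]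
    [InnerProductSpace ℝ H] [CompleteSpace H] {v : ℝ → H} {s : Set ℝ} (hs : IsCompact s)
    (hv : ∀ g, ContinuousOn (fun t => inner ℝ (v t) g) s) : ∃ K, ∀ t ∈ s, ‖v t‖ ≤ K := by
  obtain ⟨K, hK⟩ := banach_steinhaus (g := fun t : s => innerSL ℝ (v t)) fun g => by
    obtain ⟨C, hC⟩ := hs.exists_bound_of_continuousOn (hv g)
    exact ⟨C, fun t => hC t t.2⟩
  exact ⟨K, fun t ht => by simpa using hK ⟨t, ht⟩⟩

namespace IsWeakSolution

variable {hd : d ≤ 2} {v : ℝ → L2 d} {v₀ : L2 d} {κ : Torus d → ℝ}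

theorem integrable_fluxPairing (hv : IsWeakSolution hd v v₀) (hκ : IsSmooth κ) (f : L2 d) (R : ℝ) :
    IntegrableOn (fun τ => fluxPairing hd κ (v τ) f) (Ioo 0 R) := by
  have hfi : Integrable f := (Lp.memLp f).integrable one_le_two
  have hc : ∀ j, Continuous (conv (partialDeriv j κ) f) := fun j =>
    continuous_conv (hκ.continuous_partialDeriv j) hfi
  unfold fluxPairing
  simp only [fun τ j => integral_inner_flux hd (v τ) j (hc j)]
  exact integrable_finsetSum _ fun j _ =>
    (integrable_time_transport hd (hv.memLp R) (hv.memLp_grad R) (hc j) j).sub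
      (integrable_time_grad (hv.memLp_grad R) (hc j) j)

/-- The equation tested with a mollified solenoidal field. -/
theorem inner_conv_eq (hv : IsWeakSolution hd v v₀) (hκ : IsSmooth κ)
    (hev : ∀ x : Torus d, κ (x.1, -x.2) = κ x) {f : L2 d} (hf : MemSolenoidal hd f) {t : ℝ}
    (ht : 0 ≤ t) : ∫ x, inner ℝ (v t x) (conv κ f x) =
      (∫ x, inner ℝ (v₀ x) (conv κ f x)) + ∫ τ in (0 : ℝ)..t, fluxPairing hd κ (v τ) f := by
  have hfi : Integrable f := (Lp.memLp f).integrable one_le_two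
  have hc : ∀ j, Continuous (conv (partialDeriv j κ) f) := fun j =>
    continuous_conv (hκ.continuous_partialDeriv j) hfi
  set ψ : C(Torus d, Vel) := ⟨conv κ f, continuous_conv hκ.continuous hfi⟩ with hψ
  set Dψ : Option (Fin d) → C(Torus d, Vel) := fun j => ⟨conv (partialDeriv j κ) f, hc j⟩ with hDψ
  have hψm : MemLp (conv κ f) 2 := memLp_conv hκ.continuous hfi 2
  have hm : ∀ g : L2 d, ∫ x, inner ℝ (g x) (conv κ f x) = inner ℝ g (hψm.toLp _) := fun g => by
    rw [L2.inner_def]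
    refine integral_congr_ae ?_
    filter_upwards [hψm.coeFn_toLp] with x hx
    rw [hx]
  have hneg : ∀ τ, -(∫ s in (0 : ℝ)..τ, -fluxPairing hd κ (v s) f) =
      ∫ s in (0 : ℝ)..τ, fluxPairing hd κ (v s) f := fun τ => by
    rw [intervalIntegral.integral_neg, neg_neg]
  rw [← hneg, ← sub_eq_add_neg]
  refine eq_sub_integral_of_weak (m := fun τ => ∫ x, inner ℝ (v τ x) (conv κ f x)) ?_
    (fun R => (hv.integrable_fluxPairing hκ f R).neg) ?_ ht
  · simp only [hm]
    exact hv.weak_cont _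
  intro θ θ' hθ hθ' ⟨R, hR⟩
  have hθc : Continuous θ := continuous_iff_continuousAt.2 fun t => (hθ t).continuousAt
  -- Separated variables: the spatial profile `κ * f` is smooth and solenoidal, so the weak form
  -- reduces to a scalar equation in time tested with `θ`.
  have htest : IsTestFunction hd (fun t => θ t • ψ) (fun t => θ' t • ψ)
      (fun j t => θ t • Dψ j) := by
    refine ⟨fun t _ => ?_, fun t _ => ((hθ t).smul_const ψ).hasDerivWithinAt,
      (hθ'.smul continuous_const).continuousOn, fun j t x _ => ?_,
      fun j => (hθc.smul continuous_const).continuousOn, ⟨R, fun t h => by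
        simp only [hR t h]; exact zero_smul ℝ ψ⟩⟩
    · have hs := memSolenoidal_conv hd hκ.continuous hev hf
      refine ⟨hs.1.const_smul (θ t), ?_, fun p hp => ?_⟩
      · filter_upwards [hs.2.1] with x hx
        simp [hψ, hx]
      · have h0 := hs.2.2 p hp
        have h1 : ∀ x : HTorus d, ∑ i : Fin d,
            (∫ z : Circle2Pi, (θ t • ψ) (x, z) (Fin.castLE hd i)) * partialDerivH i p x =
            θ t * ∑ i : Fin d,
              (∫ z : Circle2Pi, conv κ f (x, z) (Fin.castLE hd i)) * partialDerivH i p x :=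
          fun x => by
            rw [Finset.mul_sum]
            refine Finset.sum_congr rfl fun i _ => ?_
            rw [← mul_assoc, ← integral_const_mul]
            rfl
        simp only [h1]
        rw [integral_const_mul, h0, mul_zero]
    · have h := (hκ.hasDerivAt_conv hfi j x 0).const_smul (θ t)
      rw [shift_zero, add_zero] at h
      exact h
  have key := hv.weak_form _ _ _ htest
  have e1 : ∀ τ, ∫ x, inner ℝ (v τ x) ((θ' τ • ψ) x) =
      (∫ x, inner ℝ (v τ x) (conv κ f x)) * θ' τ := fun τ => by
    rw [← integral_mul_const]
    refine integral_congr_ae (ae_of_all _ fun x => ?_)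
    simp [hψ, inner_smul_right, mul_comm]
  have e2 : ∀ τ, ∫ x, ∑ j : Option (Fin d), inner ℝ (weakPartial j (v τ) x) ((θ τ • Dψ j) x) =
      θ τ * ∑ j, ∫ x, inner ℝ (weakPartial j (v τ) x) (conv (partialDeriv j κ) f x) := fun τ => by
    rw [← integral_finsetSum _ fun j _ => integrable_inner_continuous _ (hc j), ← integral_const_mul]
    refine integral_congr_ae (ae_of_all _ fun x => ?_)
    simp only [hDψ, ContinuousMap.smul_apply, ContinuousMap.coe_mk, inner_smul_right, Finset.mul_sum]
  have e3 : ∀ τ, ∫ x, ∑ j : Option (Fin d),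
      transport hd (v τ) j x * inner ℝ (v τ x) ((θ τ • Dψ j) x) =
      θ τ * ∑ j, ∫ x, transport hd (v τ) j x * inner ℝ (v τ x) (conv (partialDeriv j κ) f x) :=
    fun τ => by
      rw [← integral_finsetSum _ fun j _ => integrable_transport_mul_inner hd _ (hc j) j,
        ← integral_const_mul]
      refine integral_congr_ae (ae_of_all _ fun x => ?_)
      simp only [hDψ, ContinuousMap.smul_apply, ContinuousMap.coe_mk, inner_smul_right,
        Finset.mul_sum, mul_left_comm]
  have e4 : ∫ x, inner ℝ (v₀ x) ((θ 0 • ψ) x) = θ 0 * ∫ x, inner ℝ (v₀ x) (conv κ f x) := by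
    rw [← integral_const_mul]
    refine integral_congr_ae (ae_of_all _ fun x => ?_)
    simp [hψ, inner_smul_right]
  simp only [e1, e2, e3, e4] at key
  have hcut : ∀ F : ℝ → ℝ, IntegrableOn F (Ioo 0 R) →
      IntegrableOn (fun τ => θ τ * F τ) (Ioi 0) := fun F hF => by
    obtain ⟨C, hC⟩ := (isCompact_Icc (a := (0 : ℝ)) (b := R)).exists_bound_of_continuousOn
      hθc.continuousOn
    have h1 : IntegrableOn (fun τ => θ τ * F τ) (Ioo 0 R) := by
      refine Integrable.bdd_mul hF hθc.aestronglyMeasurable (c := C) ?_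
      filter_upwards [ae_restrict_mem measurableSet_Ioo] with τ hτ
      exact hC τ ⟨hτ.1.le, hτ.2.le⟩
    refine h1.of_forall_sdiff_eq_zero measurableSet_Ioi fun τ hτ => ?_
    have : R ≤ τ := by
      by_contra hlt
      exact hτ.2 ⟨hτ.1, not_le.1 hlt⟩
    rw [hR τ this, zero_mul]
  have hi1 := hcut _ (integrable_finsetSum Finset.univ fun j _ =>
    integrable_time_grad (hv.memLp_grad R) (hc j) j)
  have hi2 := hcut _ (integrable_finsetSum Finset.univ fun j _ =>
    integrable_time_transport hd (hv.memLp R) (hv.memLp_grad R) (hc j) j)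
  have e5 : ∫ τ in Ioi (0 : ℝ), θ τ * -fluxPairing hd κ (v τ) f =
      (∫ τ in Ioi (0 : ℝ), θ τ * ∑ j,
        ∫ x, inner ℝ (weakPartial j (v τ) x) (conv (partialDeriv j κ) f x)) -
      ∫ τ in Ioi (0 : ℝ), θ τ * ∑ j,
        ∫ x, transport hd (v τ) j x * inner ℝ (v τ x) (conv (partialDeriv j κ) f x) := by
    rw [← integral_sub hi1 hi2]
    refine integral_congr_ae (ae_of_all _ fun τ => ?_)
    simp only [fluxPairing, fun j => integral_inner_flux hd (v τ) j (hc j),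
      Finset.sum_sub_distrib]
    ring
  simp only [Pi.neg_apply]
  rw [e5]
  linarith [key]

/-- Since `κ` is even, `⟨v(b), κ * v(b)⟩ - ⟨v(a), κ * v(a)⟩ = ⟨v(b) - v(a), κ * (v(b) + v(a))⟩`. The
fields `v(a)` and `v(b)` are fixed and solenoidal, so the mollified equation may be tested with
each. This gives the symmetric difference formula of `energy_of_symm_diff`. -/
theorem energy_conv (hv : IsWeakSolution hd v v₀) (hinit : v 0 = v₀) (hκ : IsSmooth κ)
    (hev : ∀ x, κ (-x) = κ x) (hevz : ∀ x : Torus d, κ (x.1, -x.2) = κ x) {t : ℝ} (ht : 0 < t) :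
    AEStronglyMeasurable (fun τ => fluxPairing hd κ (v τ) (v τ)) (volume.restrict (Ioc 0 t)) ∧
    (∫ x, inner ℝ (v t x) (conv κ (v t) x)) - ∫ x, inner ℝ (v₀ x) (conv κ v₀ x) =
      2 * ∫ τ in (0 : ℝ)..t, fluxPairing hd κ (v τ) (v τ) := by
  have hfi : ∀ f : L2 d, Integrable f := fun f => (Lp.memLp f).integrable one_le_two
  obtain ⟨K, hK⟩ := exists_norm_le_of_weak_continuous (isCompact_Icc (a := (0 : ℝ)) (b := t))
    fun g => (hv.weak_cont g).mono Icc_subset_Ici_self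
  obtain ⟨C, -, hC⟩ := exists_norm_fluxVec_le hκ hd
  have hIoc : volume.restrict (Ioc (0 : ℝ) t) = volume.restrict (Ioo 0 t) :=
    restrict_congr_set Ioo_ae_eq_Ioc.symm
  have hint : ∀ f, IntegrableOn (fun τ => fluxPairing hd κ (v τ) f) (Ioc 0 t) := fun f => by
    rw [IntegrableOn, hIoc]
    exact hv.integrable_fluxPairing hκ f t
  have hG : IntegrableOn (fun τ => C * ∑ j : Option (Fin d), (‖transportLp hd (v τ) j‖ * ‖v τ‖ +
      (eLpNorm (fun _ : Torus d => (1 : ℝ)) 2).toReal * ‖weakPartial j (v τ)‖)) (Ioc 0 t) := by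
    rw [IntegrableOn, hIoc]
    refine (integrable_finsetSum _ fun j _ => ?_).const_mul C
    exact ((memLp_transportLp hd (hv.memLp t) (hv.memLp_grad t) j).norm.integrable_mul
      (hv.memLp t).norm).add (((hv.memLp_grad t j).integrable one_le_two).norm.const_mul _)
  have h := energy_of_symm_diff (v := v) (u := fun τ => fluxVec hκ hd (v τ))
    (E := fun τ => ∫ x, inner ℝ (v τ x) (conv κ (v τ) x)) ht
    (fun g => (hv.weak_cont g).mono Icc_subset_Ici_self) hK hG (ae_of_all _ fun τ => hC (v τ))
    (fun g => by simp only [inner_fluxVec]; exact (hint g).1) ?_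
  · simp only [inner_fluxVec, hinit] at h
    exact h
  intro a b ha hab hb
  have hab' : ∀ f : L2 d, MemSolenoidal hd f → (∫ x, inner ℝ (v b x) (conv κ f x)) -
      ∫ x, inner ℝ (v a x) (conv κ f x) = ∫ τ in a..b, fluxPairing hd κ (v τ) f := fun f hf => by
    have hi : ∀ x y : ℝ, 0 ≤ x → x ≤ y → y ≤ t →
        IntervalIntegrable (fun τ => fluxPairing hd κ (v τ) f) volume x y := fun x y hx hxy hy =>
      (intervalIntegrable_iff_integrableOn_Ioc_of_le hxy).2
        ((hint f).mono_set (Ioc_subset_Ioc hx hy))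
    rw [hv.inner_conv_eq hκ hevz hf (ha.trans hab), hv.inner_conv_eq hκ hevz hf ha,
      ← intervalIntegral.integral_add_adjacent_intervals (hi 0 a le_rfl ha (hab.trans hb))
        (hi a b ha hab hb)]
    ring
  have hA := hab' (v a) (hv.solenoidal a ha)
  have hB := hab' (v b) (hv.solenoidal b (ha.trans hab))
  -- The two mixed terms in `v(a)` and `v(b)` coincide and drop out of the sum of `hA` and `hB`.
  have hsymm := integral_inner_conv_symm hκ.continuous hev (hfi (v b)) (hfi (v a))
  simp only [inner_add_right, inner_fluxVec]
  rw [intervalIntegral.integral_add, ← hA, ← hB]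
  · linarith
  · exact (intervalIntegrable_iff_integrableOn_Ioc_of_le hab).2
      ((hint _).mono_set (Ioc_subset_Ioc ha hb))
  · exact (intervalIntegrable_iff_integrableOn_Ioc_of_le hab).2
      ((hint _).mono_set (Ioc_subset_Ioc ha hb))

end IsWeakSolution

end

noncomputable section

variable {d : ℕ}

/-! ### Removing the mollification -/

theorem continuous_corr_self (f : L2 d) : Continuous (corr f f) :=
  continuous_corr (p := 2) (q := 2) ENNReal.ofNat_ne_top (Lp.memLp f) (Lp.memLp f)

theorem abs_corr_self_le (f : L2 d) (y : Torus d) : |corr f f y| ≤ ‖f‖ ^ 2 := by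
  have h := abs_corr_le (p := 2) (q := 2) (Lp.memLp f) (Lp.memLp f) y
  rwa [eLpNorm_coe_toReal, ← sq] at h

theorem corr_self_zero (f : L2 d) : corr f f 0 = ‖f‖ ^ 2 := by
  rw [← real_inner_self_eq_norm_sq, L2.inner_def]
  simp [corr]

theorem integral_inner_conv_steklov (h : ℝ) (m : ℕ) (f : L2 d) :
    ∫ x, inner ℝ (f x) (conv (steklov h (peakKernel (torusPeak d) m)) f x) =
      ∫ y, peakKernel (torusPeak d) m y * steklov h (corr f f) y := by
  have hκ : Continuous (peakKernel (torusPeak d) m) := isPeak_torusPeak.continuous_peakKernel m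
  have hfi : Integrable f := (Lp.memLp f).integrable one_le_two
  rw [integral_inner_conv (continuous_steklov h hκ) hfi hfi,
    integral_steklov_mul h hκ (continuous_corr_self f)]

/-- The energy production seen by the kernel at displacement `y`. -/
def energyRate (hd : d ≤ 2) (f : L2 d) (h : ℝ) (y : Torus d) : ℝ :=
  corrTransport hd f h y -
    ∑ j : Option (Fin d), steklov h (corr (weakPartial j f) (weakPartial j f)) y

section Rate

variable (hd : d ≤ 2) {f : L2 d}

theorem continuous_energyRate (hf4 : MemLp f 4) (h : ℝ) : Continuous (energyRate hd f h) :=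
  (continuous_corrTransport hd hf4 h).sub
    (continuous_finsetSum _ fun _ _ => continuous_steklov h (continuous_corr_self _))

/-- Transport and dissipation are both averages of continuous functions of the displacement against
the same peak kernel, so the limit in `m` is evaluation at zero. -/
theorem fluxPairing_self (hf1 : MemH1 f) (hf4 : MemLp f 4) (h : ℝ) (m : ℕ) :
    fluxPairing hd (steklov h (peakKernel (torusPeak d) m)) f f =
      ∫ y, peakKernel (torusPeak d) m y * energyRate hd f h y := by
  have hκ : Continuous (peakKernel (torusPeak d) m) := isPeak_torusPeak.continuous_peakKernel m
  have hs : IsSmooth (steklov h (peakKernel (torusPeak d) m)) := isSmooth_steklov_peakKernel h m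
  have hfi : Integrable f := (Lp.memLp f).integrable one_le_two
  have hc : ∀ j, Continuous (conv (partialDeriv j (steklov h (peakKernel (torusPeak d) m))) f) :=
    fun j => continuous_conv (hs.continuous_partialDeriv j) hfi
  have hci : ∀ {u : Torus d → ℝ}, Continuous u →
      Integrable fun y => peakKernel (torusPeak d) m y * u y := fun {u} hu =>
    (hκ.mul hu).integrable_of_hasCompactSupport (HasCompactSupport.of_compactSpace _)
  have hst : ∀ j : Option (Fin d), Continuous
      (steklov h (corr (weakPartial j f) (weakPartial j f))) := fun j =>
    continuous_steklov h (continuous_corr_self _)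
  simp only [fluxPairing, fun j => integral_inner_flux hd f j (hc j), Finset.sum_sub_distrib]
  rw [← integral_finsetSum _ fun j _ => integrable_transport_mul_inner hd f (hc j) j,
    integral_transport_conv hd hf1 hf4]
  simp only [fun j => hs.conv_partialDeriv (hf1.isWeakPartial j), integral_inner_conv_steklov]
  rw [← integral_finsetSum _ fun j _ => hci (hst j),
    ← integral_sub (hci (continuous_corrTransport hd hf4 h))
      (integrable_finsetSum _ fun j _ => hci (hst j))]
  simp only [energyRate, mul_sub, Finset.mul_sum]

theorem abs_sum_steklov_le {h : ℝ} (hh : 0 < h) (f : L2 d) (y : Torus d) :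
    |∑ j : Option (Fin d), steklov h (corr (weakPartial j f) (weakPartial j f)) y| ≤
      gradNormSq f :=
  (Finset.abs_sum_le_sum_abs _ _).trans (Finset.sum_le_sum fun _ _ =>
    abs_steklov_le hh (abs_corr_self_le _) y)

theorem abs_energyRate_le (hf4 : MemLp f 4) {h : ℝ} (hh : 0 < h) (y : Torus d) :
    |energyRate hd f h y| ≤ (d + 2 * Real.pi * h⁻¹) * (gradSum f * (eLpNorm f 4).toReal ^ 2) +
      gradNormSq f :=
  (abs_sub _ _).trans (add_le_add (abs_corrTransport_le hd hf4 hh y) (abs_sum_steklov_le hh f y))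

theorem abs_energyRate_zero_le (hf : MemSolenoidal hd f) (hf1 : MemH1 f) (hf4 : MemLp f 4)
    {h : ℝ} (hh : 0 < h) :
    |energyRate hd f h 0| ≤ (d + 1) * (gradSum f * (eLpNorm f 4).toReal ^ 2) + gradNormSq f :=
  (abs_sub _ _).trans (add_le_add (abs_corrTransport_zero_le hd hf hf1 hf4 hh)
    (abs_sum_steklov_le hh f 0))

theorem tendsto_energyRate (hf : MemSolenoidal hd f) (hf1 : MemH1 f) (hf4 : MemLp f 4) :
    Tendsto (fun h => energyRate hd f h 0) (𝓝[>] 0) (𝓝 (-gradNormSq f)) := by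
  have h1 : Tendsto (fun h => ∑ j : Option (Fin d),
      steklov h (corr (weakPartial j f) (weakPartial j f)) 0) (𝓝[>] 0) (𝓝 (gradNormSq f)) := by
    refine tendsto_finsetSum _ fun j _ => ?_
    rw [← corr_self_zero]
    exact tendsto_steklov (continuous_corr_self _) 0
  have h2 := (tendsto_corrTransport hd hf hf1 hf4).sub h1
  rwa [zero_sub] at h2

end Rate

theorem gradSum_sq_le (f : L2 d) : gradSum f ^ 2 ≤ (d + 1) * gradNormSq f := by
  have h := sq_sum_le_card_mul_sum_sq (s := (Finset.univ : Finset (Option (Fin d))))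
    (f := fun j => ‖weakPartial j f‖)
  rwa [Finset.card_univ, Fintype.card_option, Fintype.card_fin, Nat.cast_add, Nat.cast_one] at h

/-- A weak solution in `L⁴` satisfies the energy equality. -/
theorem IsWeakSolution.energy_eq {hd : d ≤ 2} {v : ℝ → L2 d} {v₀ : L2 d}
    (hv : IsWeakSolution hd v v₀) (hinit : v 0 = v₀) {t : ℝ} (ht : 0 < t) {A : ℝ → ℝ}
    (hA : IntegrableOn A (Ioc 0 t))
    (h4 : ∀ᵐ τ ∂volume.restrict (Ioc 0 t), MemLp (v τ) 4 ∧ (eLpNorm (v τ) 4).toReal ^ 4 ≤ A τ) :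
    1 / 2 * ‖v t‖ ^ 2 + (∫ τ in (0 : ℝ)..t, gradNormSq (v τ)) = 1 / 2 * ‖v₀‖ ^ 2 := by
  have hIoc : volume.restrict (Ioc (0 : ℝ) t) = volume.restrict (Ioo 0 t) :=
    restrict_congr_set Ioo_ae_eq_Ioc.symm
  have hgn : IntegrableOn (fun τ => gradNormSq (v τ)) (Ioc 0 t) := by
    rw [IntegrableOn, hIoc]
    exact integrable_finsetSum _ fun j _ => (hv.memLp_grad t j).integrable_norm_pow two_ne_zero
  -- Majorant of `‖∇v‖₂ ‖v‖₄²` by Young's inequality. The factor `d + 1` counts the partial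
  -- derivatives when the sum of norms is squared.
  set B : ℝ → ℝ := fun τ => (d + 1) * gradNormSq (v τ) + A τ with hB
  have hBi : IntegrableOn B (Ioc 0 t) := (hgn.const_mul _).add hA
  have hH1 : ∀ᵐ τ ∂volume.restrict (Ioc 0 t), MemH1 (v τ) := by
    filter_upwards [ae_restrict_of_ae hv.mem_H1, ae_restrict_mem measurableSet_Ioc] with τ h1 h2
    exact h1 h2.1
  have hmem : ∀ᵐ τ ∂volume.restrict (Ioc 0 t), MemH1 (v τ) ∧ MemLp (v τ) 4 ∧
      MemSolenoidal hd (v τ) ∧ gradSum (v τ) * (eLpNorm (v τ) 4).toReal ^ 2 ≤ B τ := by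
    filter_upwards [h4, hH1, ae_restrict_mem measurableSet_Ioc] with τ h1 h2 h3
    refine ⟨h2, h1.1, hv.solenoidal τ h3.1.le, ?_⟩
    have h5 := gradSum_sq_le (v τ)
    have h6 : (eLpNorm (v τ) 4).toReal ^ 4 = ((eLpNorm (v τ) 4).toReal ^ 2) ^ 2 := by ring
    simp only [hB]
    nlinarith [sq_nonneg (gradSum (v τ) - (eLpNorm (v τ) 4).toReal ^ 2), h1.2,
      sq_nonneg (gradSum (v τ)), sq_nonneg ((eLpNorm (v τ) 4).toReal ^ 2)]
  -- First limit, `m → ∞` at fixed width `h`. The majorant may depend on `h`.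
  have hstep : ∀ h : ℝ, 0 < h →
      AEStronglyMeasurable (fun τ => energyRate hd (v τ) h 0) (volume.restrict (Ioc 0 t)) ∧
      steklov h (corr (v t) (v t)) 0 - steklov h (corr v₀ v₀) 0 =
        2 * ∫ τ in Ioc 0 t, energyRate hd (v τ) h 0 := by
    intro h hh
    have hE := fun m => hv.energy_conv hinit (isSmooth_steklov_peakKernel h m)
      (steklov_neg h (isPeak_torusPeak.peakKernel_neg m))
      (steklov_neg_snd h fun x => by simp only [peakKernel, torusPeak_neg_snd]) ht
    have hlim : ∀ᵐ τ ∂volume.restrict (Ioc 0 t), Tendsto (fun m =>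
        fluxPairing hd (steklov h (peakKernel (torusPeak d) m)) (v τ) (v τ)) atTop
        (𝓝 (energyRate hd (v τ) h 0)) := by
      filter_upwards [hmem] with τ hτ
      simp only [fluxPairing_self hd hτ.1 hτ.2.1]
      exact isPeak_torusPeak.tendsto_peakKernel (continuous_energyRate hd hτ.2.1 h)
    refine ⟨aestronglyMeasurable_of_tendsto_ae atTop (fun m => (hE m).1) hlim, ?_⟩
    have hdct := tendsto_integral_of_dominated_convergence
      (fun τ => (d + 2 * Real.pi * h⁻¹) * B τ + gradNormSq (v τ)) (fun m => (hE m).1)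
      ((hBi.const_mul _).add hgn) (fun m => by
        filter_upwards [hmem] with τ hτ
        rw [fluxPairing_self hd hτ.1 hτ.2.1, Real.norm_eq_abs]
        refine isPeak_torusPeak.abs_integral_peakKernel_mul_le m fun y => ?_
        refine (abs_energyRate_le hd hτ.2.1 hh y).trans ?_
        gcongr
        exact hτ.2.2.2) hlim
    have hl : ∀ f : L2 d, Tendsto (fun m => ∫ x, inner ℝ (f x)
        (conv (steklov h (peakKernel (torusPeak d) m)) f x)) atTop
        (𝓝 (steklov h (corr f f) 0)) := fun f => by
      simp only [integral_inner_conv_steklov]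
      exact isPeak_torusPeak.tendsto_peakKernel (continuous_steklov h (continuous_corr_self f))
    refine tendsto_nhds_unique ((hl (v t)).sub (hl v₀)) ?_
    refine (hdct.const_mul 2).congr fun m => ?_
    rw [(hE m).2, intervalIntegral.integral_of_le ht.le]
  -- Second limit, along the widths `h = 1/(k + 1)`. The majorant is now the one uniform in `h`.
  set s : ℕ → ℝ := fun k => 1 / ((k : ℝ) + 1) with hs
  have hs0 : ∀ k, 0 < s k := fun k => by positivity
  have hst : Tendsto s atTop (𝓝[>] 0) := tendsto_nhdsWithin_iff.2
    ⟨tendsto_one_div_add_atTop_nhds_zero_nat, Eventually.of_forall hs0⟩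
  have hdct := tendsto_integral_of_dominated_convergence (μ := volume.restrict (Ioc 0 t))
    (F := fun k τ => energyRate hd (v τ) (s k) 0) (f := fun τ => -gradNormSq (v τ))
    (fun τ => (d + 1) * B τ + gradNormSq (v τ)) (fun k => (hstep (s k) (hs0 k)).1)
    ((hBi.const_mul _).add hgn) (fun k => by
      filter_upwards [hmem] with τ hτ
      rw [Real.norm_eq_abs]
      refine (abs_energyRate_zero_le hd hτ.2.2.1 hτ.1 hτ.2.1 (hs0 k)).trans ?_
      gcongr
      exact hτ.2.2.2)
    (by
      filter_upwards [hmem] with τ hτ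
      exact (tendsto_energyRate hd hτ.2.2.1 hτ.1 hτ.2.1).comp hst)
  have hl : ∀ f : L2 d, Tendsto (fun k => steklov (s k) (corr f f) 0) atTop (𝓝 (‖f‖ ^ 2)) :=
    fun f => by
      rw [← corr_self_zero]
      exact (tendsto_steklov (continuous_corr_self f) 0).comp hst
  have hfin := tendsto_nhds_unique ((hl (v t)).sub (hl v₀))
    ((hdct.const_mul 2).congr fun k => ((hstep (s k) (hs0 k)).2).symm)
  rw [integral_neg] at hfin
  rw [intervalIntegral.integral_of_le ht.le]
  linarith

end

noncomputable section

/-! ### Associativity of the convolution and the `L⁴` contraction property -/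

section Group

variable {G : Type*} [AddCommGroup G] [TopologicalSpace G] [IsTopologicalAddGroup G]
  [CompactSpace G] [SecondCountableTopology G] [MeasureSpace G] [BorelSpace G]
  [IsAddHaarMeasure (volume : Measure G)] [Regular (volume : Measure G)]
  {E : Type*} [NormedAddCommGroup E] [InnerProductSpace ℝ E] [CompleteSpace E]

theorem conv_conv {k φ : G → ℝ} (hk : Continuous k) (hφ : Continuous φ) {g : G → E}
    (hg : Integrable g) (x : G) : conv k (conv φ g) x = conv (conv k φ) g x := by
  have hc : Continuous fun q : G × G => k (x - q.1) * φ (q.1 - q.2) := by fun_prop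
  obtain ⟨C, -, hC⟩ := exists_abs_le_of_continuous hc
  have hi : Integrable (Function.uncurry fun y w => (k (x - y) * φ (y - w)) • g w)
      ((volume : Measure G).prod volume) :=
    (hg.comp_snd (volume : Measure G)).bdd_smul C hc.aestronglyMeasurable (ae_of_all _ fun q => hC q)
  calc conv k (conv φ g) x = ∫ y, ∫ w, (k (x - y) * φ (y - w)) • g w := by
        simp only [conv, ← integral_smul, smul_smul]
    _ = ∫ w, ∫ y, (k (x - y) * φ (y - w)) • g w := integral_integral_swap hi
    _ = conv (conv k φ) g x := by
        refine integral_congr_ae (ae_of_all _ fun w => ?_)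
        simp only [integral_smul_const]
        congr 1
        rw [← integral_add_right_eq_self _ w, conv]
        refine integral_congr_ae (ae_of_all _ fun y => ?_)
        simp only [add_sub_cancel_right, smul_eq_mul, sub_sub, add_comm w y]

/-- Jensen's inequality for the probability measure `k(x - y) dy` at each `x`, then Tonelli. -/
theorem eLpNorm_four_conv_le {k : G → ℝ} (hk : Continuous k) (h0 : ∀ x, 0 ≤ k x)
    (h1 : ∫ x, k x = 1) {g : G → E} (hg : Integrable g) : eLpNorm (conv k g) 4 ≤ eLpNorm g 4 := by
  have hki : Integrable k := hk.integrable_of_hasCompactSupport (HasCompactSupport.of_compactSpace _)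
  have hl1 : ∫⁻ x, ENNReal.ofReal (k x) = 1 := by
    rw [← ofReal_integral_eq_lintegral_ofReal hki (ae_of_all _ h0), h1, ENNReal.ofReal_one]
  have hm : ∀ x, Measurable fun y => ENNReal.ofReal (k (x - y)) := fun x =>
    (ENNReal.continuous_ofReal.comp (hk.comp (continuous_const.sub continuous_id))).measurable
  have hpt : ∀ x, ‖conv k g x‖ₑ ^ 4 ≤ ∫⁻ y, ENNReal.ofReal (k (x - y)) * ‖g y‖ₑ ^ 4 := fun x => by
    set μ : Measure G := volume.withDensity fun y => ENNReal.ofReal (k (x - y)) with hμ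
    have : IsProbabilityMeasure μ := ⟨by
      rw [hμ, withDensity_apply _ MeasurableSet.univ, setLIntegral_univ,
        lintegral_sub_left_eq_self (fun y => ENNReal.ofReal (k y)) x, hl1]⟩
    have hgμ : AEStronglyMeasurable g μ := hg.1.mono_ac (withDensity_absolutelyContinuous _ _)
    have h2 := eLpNorm_le_eLpNorm_of_exponent_le (μ := μ) (p := 1) (q := 4) (by norm_num) hgμ
    rw [eLpNorm_one_eq_lintegral_enorm] at h2
    have h3 : ‖conv k g x‖ₑ ≤ ∫⁻ y, ‖g y‖ₑ ∂μ := by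
      rw [hμ, lintegral_withDensity_eq_lintegral_mul₀ (hm x).aemeasurable hg.1.enorm]
      refine (enorm_integral_le_lintegral_enorm _).trans_eq ?_
      refine lintegral_congr fun y => ?_
      rw [enorm_smul, Real.enorm_of_nonneg (h0 _), Pi.mul_apply]
    calc ‖conv k g x‖ₑ ^ 4 ≤ eLpNorm g 4 μ ^ 4 := by gcongr; exact h3.trans h2
      _ = _ := by
        rw [eLpNorm_four_pow, hμ,
          lintegral_withDensity_eq_lintegral_mul₀ (hm x).aemeasurable (hg.1.enorm.pow_const 4)]
        rfl
  have h4 : eLpNorm (conv k g) 4 ^ 4 ≤ eLpNorm g 4 ^ 4 := by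
    rw [eLpNorm_four_pow, eLpNorm_four_pow]
    calc ∫⁻ x, ‖conv k g x‖ₑ ^ 4 ≤ ∫⁻ x, ∫⁻ y, ENNReal.ofReal (k (x - y)) * ‖g y‖ₑ ^ 4 :=
          lintegral_mono hpt
      _ = ∫⁻ y, ∫⁻ x, ENNReal.ofReal (k (x - y)) * ‖g y‖ₑ ^ 4 := by
          refine lintegral_lintegral_swap (AEMeasurable.mul (f := fun q : G × G =>
            ENNReal.ofReal (k (q.1 - q.2))) (g := fun q : G × G => ‖g q.2‖ₑ ^ 4) ?_ ?_)
          · exact (ENNReal.continuous_ofReal.comp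
              (hk.comp (continuous_fst.sub continuous_snd))).measurable.aemeasurable
          · exact (hg.1.enorm.pow_const 4).comp_snd
      _ = ∫⁻ y, ‖g y‖ₑ ^ 4 := by
          refine lintegral_congr fun y => ?_
          have hmx : Measurable fun x => ENNReal.ofReal (k (x - y)) :=
            (ENNReal.continuous_ofReal.comp (hk.comp (continuous_id.sub continuous_const))).measurable
          rw [lintegral_mul_const _ hmx,
            lintegral_sub_right_eq_self (fun x => ENNReal.ofReal (k x)) y, hl1, one_mul]
  exact (ENNReal.pow_le_pow_left_iff four_ne_zero).1 h4

end Group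

/-! ### Trigonometric polynomials on the circle -/

theorem fourier_eq_zpow (n : ℤ) (z : Circle2Pi) : fourier n z = (fourier 1 z : ℂ) ^ n := by
  obtain ⟨y, rfl⟩ := QuotientAddGroup.mk_surjective z
  rw [fourier_coe_apply, fourier_coe_apply, ← Complex.exp_int_mul]
  congr 1
  push_cast
  ring

theorem fourier_sub_apply (n : ℤ) (x y : Circle2Pi) :
    (fourier n (x - y) : ℂ) = fourier n x * fourier (-n) y := by
  rw [fourier_apply, fourier_apply, fourier_apply, smul_sub, sub_eq_add_neg, AddCircle.toCircle_add,
    neg_smul, Circle.coe_mul]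

theorem integral_fourier (n : ℤ) :
    ∫ z : Circle2Pi, (fourier n z : ℂ) = if n = 0 then 2 * (Real.pi : ℂ) else 0 := by
  have h := congrFun (fourierCoeff_fourier (T := 2 * Real.pi) n) 0
  rw [fourierCoeff, AddCircle.integral_haarAddCircle] at h
  have hpi : ((2 * Real.pi : ℝ) : ℂ) ≠ 0 := by exact_mod_cast Real.two_pi_pos.ne'
  simp only [neg_zero, fourier_zero, one_smul] at h
  rw [Complex.real_smul, Complex.ofReal_inv, inv_mul_eq_iff_eq_mul₀ hpi] at h
  rw [h]
  split_ifs with h0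
  · subst h0; simp
  · rw [Pi.single_eq_of_ne (Ne.symm h0), mul_zero]

theorem integral_fourier_sub_mul (l k : ℤ) (z : Circle2Pi) :
    ∫ w : Circle2Pi, (fourier l (z - w) : ℂ) * fourier k w =
      if l = k then 2 * (Real.pi : ℂ) * fourier l z else 0 := by
  have h : ∀ w : Circle2Pi, (fourier l (z - w) : ℂ) * fourier k w =
      fourier l z * fourier (k - l) w := fun w => by
    rw [fourier_sub_apply, mul_assoc, ← fourier_add, neg_add_eq_sub]
  simp only [h, integral_const_mul, integral_fourier, sub_eq_zero, @eq_comm _ k l]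
  split_ifs <;> ring

/-- The complex trigonometric polynomial `∑ c_k e^{ikz}`. -/
def trigPolyC (s : Finset ℤ) (c : ℤ → ℂ) (z : Circle2Pi) : ℂ := ∑ k ∈ s, c k * fourier k z

/-- The real part of the trigonometric polynomial `∑ c_k e^{ikz}`. -/
def trigPoly (s : Finset ℤ) (c : ℤ → ℂ) (z : Circle2Pi) : ℝ := (trigPolyC s c z).re

theorem continuous_trigPolyC (s : Finset ℤ) (c : ℤ → ℂ) : Continuous (trigPolyC s c) :=
  continuous_finsetSum _ fun k _ => continuous_const.mul (fourier k).continuous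

theorem continuous_trigPoly (s : Finset ℤ) (c : ℤ → ℂ) : Continuous (trigPoly s c) :=
  Complex.continuous_re.comp (continuous_trigPolyC s c)

theorem integrable_of_continuous_circle {E : Type*} [NormedAddCommGroup E] {u : Circle2Pi → E}
    (hu : Continuous u) : Integrable u :=
  hu.integrable_of_hasCompactSupport (HasCompactSupport.of_compactSpace _)

theorem integral_norm_trigPolyC_sq (s : Finset ℤ) (c : ℤ → ℂ) :
    ∫ z, ‖trigPolyC s c z‖ ^ 2 = 2 * Real.pi * ∑ k ∈ s, ‖c k‖ ^ 2 := by
  have h1 : ∀ z, ((‖trigPolyC s c z‖ ^ 2 : ℝ) : ℂ) =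
      ∑ k ∈ s, ∑ l ∈ s, (starRingEnd ℂ (c k) * c l) * fourier (l - k) z := fun z => by
    push_cast
    rw [← Complex.conj_mul' (trigPolyC s c z), trigPolyC, _root_.map_sum, Finset.sum_mul_sum]
    refine Finset.sum_congr rfl fun k _ => Finset.sum_congr rfl fun l _ => ?_
    rw [map_mul, ← fourier_neg, sub_eq_neg_add, fourier_add]
    ring
  have h2 : ((∫ z, ‖trigPolyC s c z‖ ^ 2 : ℝ) : ℂ) = ((2 * Real.pi * ∑ k ∈ s, ‖c k‖ ^ 2 : ℝ) : ℂ) := by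
    rw [← integral_complex_ofReal]
    have hi : ∀ k l, Integrable fun z : Circle2Pi =>
        (starRingEnd ℂ (c k) * c l) * (fourier (l - k) z : ℂ) := fun k l =>
      integrable_of_continuous_circle (continuous_const.mul (fourier (l - k)).continuous)
    refine (integral_congr_ae (ae_of_all _ h1)).trans ?_
    rw [integral_finsetSum _ fun k _ => integrable_finsetSum _ fun l _ => hi k l]
    simp only [integral_finsetSum s fun l _ => hi _ l, integral_const_mul, integral_fourier,
      sub_eq_zero]
    push_cast
    rw [Finset.mul_sum]
    refine Finset.sum_congr rfl fun k hk => ?_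
    rw [Finset.sum_eq_single k (fun l _ hlk => by rw [if_neg hlk, mul_zero])
      (fun h => (h hk).elim), if_pos rfl, Complex.conj_mul']
    ring
  exact_mod_cast h2

theorem integral_trigPoly_sq_le (s : Finset ℤ) (c : ℤ → ℂ) :
    ∫ z, trigPoly s c z ^ 2 ≤ 2 * Real.pi * ∑ k ∈ s, ‖c k‖ ^ 2 := by
  rw [← integral_norm_trigPolyC_sq]
  refine integral_mono (integrable_of_continuous_circle ((continuous_trigPoly s c).pow 2))
    (integrable_of_continuous_circle ((continuous_trigPolyC s c).norm.pow 2)) fun z => ?_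
  simp only [trigPoly]
  rw [← sq_abs]
  gcongr
  exact Complex.abs_re_le_norm _

theorem hasDerivAt_trigPoly (s : Finset ℤ) (c : ℤ → ℂ) (y : ℝ) :
    HasDerivAt (fun y : ℝ => trigPoly s c (y : Circle2Pi))
      (trigPoly s (fun k => Complex.I * k * c k) (y : Circle2Pi)) y := by
  have hpi : (Real.pi : ℂ) ≠ 0 := by exact_mod_cast Real.pi_ne_zero
  have h1 : HasDerivAt (fun y : ℝ => trigPolyC s c (y : Circle2Pi))
      (trigPolyC s (fun k => Complex.I * k * c k) (y : Circle2Pi)) y := by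
    refine HasDerivAt.fun_sum fun k _ => ?_
    refine ((hasDerivAt_fourier (2 * Real.pi) k y).const_mul (c k)).congr_deriv ?_
    push_cast
    field_simp
  exact Complex.reCLM.hasFDerivAt.comp_hasDerivAt y h1

theorem contDiff_trigPoly (s : Finset ℤ) (c : ℤ → ℂ) :
    ContDiff ℝ ∞ fun y : ℝ => trigPoly s c (y : Circle2Pi) := by
  refine Complex.reCLM.contDiff.comp (ContDiff.sum fun k _ => contDiff_const.mul ?_)
  simp only [fourier_coe_apply]
  exact ((contDiff_const.mul Complex.ofRealCLM.contDiff).div_const _).cexp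

end

noncomputable section

/-! ### Littlewood–Paley kernels -/

section Kernel

variable {χ : ℝ → ℝ}

theorem lpSymbol_natCast (χ : ℝ → ℝ) (j : ℕ) (ξ : ℝ) :
    lpSymbol χ j ξ = χ (ξ / 2 ^ (j + 1)) - χ (ξ / 2 ^ j) := by
  have h : (2 : ℝ) ^ (-(j : ℤ)) = (2 ^ j)⁻¹ := by rw [zpow_neg, zpow_natCast]
  rw [lpSymbol, h]
  congr 2 <;> field_simp
  ring

theorem IsCutoff.exists_abs_le (hχ : IsCutoff χ) : ∃ B, 0 ≤ B ∧ ∀ ξ, |χ ξ| ≤ B := by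
  obtain ⟨B, hB⟩ := (isCompact_Icc (a := (-1 : ℝ)) (b := 1)).exists_bound_of_continuousOn
    hχ.smooth.continuous.continuousOn
  refine ⟨max B 0, le_max_right _ _, fun ξ => ?_⟩
  by_cases h : |ξ| ≤ 1
  · exact (hB ξ (abs_le.1 h)).trans (le_max_left _ _)
  · rw [hχ.eq_zero ξ (not_le.1 h).le, abs_zero]
    exact le_max_right _ _

theorem IsCutoff.lpSymbol_eq_zero_of_le (hχ : IsCutoff χ) {j : ℕ} {ξ : ℝ}
    (h : 2 ^ (j + 1) ≤ |ξ|) : lpSymbol χ j ξ = 0 := by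
  have h1 : (2 : ℝ) ^ j ≤ |ξ| := le_trans (pow_le_pow_right₀ one_le_two (Nat.le_succ j)) h
  rw [lpSymbol_natCast, hχ.eq_zero, hχ.eq_zero, sub_zero]
  · rw [abs_div, abs_of_pos (by positivity : (0 : ℝ) < 2 ^ j), le_div_iff₀ (by positivity), one_mul]
    exact h1
  · rw [abs_div, abs_of_pos (by positivity : (0 : ℝ) < 2 ^ (j + 1)), le_div_iff₀ (by positivity),
      one_mul]
    exact h

theorem IsCutoff.lpSymbol_eq_zero_of_ge (hχ : IsCutoff χ) {j : ℕ} {ξ : ℝ}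
    (h : |ξ| ≤ 2 ^ j / 2) : lpSymbol χ j ξ = 0 := by
  have h2 : (2 : ℝ) ^ (j + 1) = 2 * 2 ^ j := pow_succ' 2 j
  have h3 : (0 : ℝ) < 2 ^ j := by positivity
  rw [lpSymbol_natCast, hχ.eq_one, hχ.eq_one, sub_self]
  · rw [abs_div, abs_of_pos h3, div_le_iff₀ h3]
    linarith
  · rw [abs_div, abs_of_pos (by positivity : (0 : ℝ) < 2 ^ (j + 1)), div_le_iff₀ (by positivity), h2]
    linarith [abs_nonneg ξ]

/-- The sum telescopes to `χ(k / 2^(N+1)) - χ(k)`. Starting at `j = 0` loses nothing but the mean,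
because `χ` vanishes at every nonzero integer and equals one at zero. -/
theorem IsCutoff.sum_lpSymbol (hχ : IsCutoff χ) {N : ℕ} {k : ℤ} (hk : |k| ≤ 2 ^ N) :
    ∑ j ∈ Finset.range (N + 1), lpSymbol χ j k = if k = 0 then 0 else 1 := by
  simp only [lpSymbol_natCast]
  rw [Finset.sum_range_sub (fun j => χ ((k : ℝ) / 2 ^ j))]
  have hk' : |(k : ℝ)| ≤ 2 ^ N := by exact_mod_cast hk
  have h1 : χ ((k : ℝ) / 2 ^ (N + 1)) = 1 := by
    refine hχ.eq_one _ ?_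
    rw [abs_div, abs_of_pos (by positivity : (0 : ℝ) < 2 ^ (N + 1)), div_le_iff₀ (by positivity),
      pow_succ']
    linarith
  rw [h1, pow_zero, div_one]
  split_ifs with h0
  · rw [h0, Int.cast_zero, hχ.eq_one 0 (by norm_num), sub_self]
  · rw [hχ.eq_zero, sub_zero]
    exact_mod_cast Int.one_le_abs h0

/-- A finite set of frequencies containing the support of `lpSymbol χ j`. -/
def lpFreq (j : ℕ) : Finset ℤ := Finset.Icc (-2 ^ (j + 1)) (2 ^ (j + 1))

theorem IsCutoff.lpSymbol_eq_zero_of_notMem (hχ : IsCutoff χ) {j : ℕ} {k : ℤ} (hk : k ∉ lpFreq j) :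
    lpSymbol χ j k = 0 := by
  refine hχ.lpSymbol_eq_zero_of_le ?_
  have h : (2 : ℤ) ^ (j + 1) < |k| := by
    by_contra h
    exact hk (Finset.mem_Icc.2 (abs_le.1 (not_lt.1 h)))
  exact_mod_cast h.le

theorem IsCutoff.lpKernel_eq (hχ : IsCutoff χ) (j : ℕ) :
    lpKernel χ j = trigPoly (lpFreq j) (fun k => (lpSymbol χ j k : ℂ)) := by
  funext z
  rw [lpKernel, trigPoly, trigPolyC, tsum_eq_sum (s := lpFreq j) fun k hk => ?_]
  rw [hχ.lpSymbol_eq_zero_of_notMem hk, Complex.ofReal_zero, zero_mul]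

theorem IsCutoff.continuous_lpKernel (hχ : IsCutoff χ) (j : ℕ) : Continuous (lpKernel χ j) := by
  rw [hχ.lpKernel_eq]
  exact continuous_trigPoly _ _

theorem sum_lpFreq_le {j : ℕ} {c : ℤ → ℂ} {b : ℝ} (hb : ∀ k, ‖c k‖ ^ 2 ≤ b) (hb0 : 0 ≤ b) :
    ∑ k ∈ lpFreq j, ‖c k‖ ^ 2 ≤ 5 * 2 ^ j * b := by
  have hcard : ((lpFreq j).card : ℝ) = 2 * 2 ^ (j + 1) + 1 := by
    have h : ((lpFreq j).card : ℤ) = 2 * 2 ^ (j + 1) + 1 := by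
      rw [lpFreq, Int.card_Icc_of_le _ _ (by linarith [pow_pos (two_pos : (0 : ℤ) < 2) (j + 1)])]
      ring
    exact_mod_cast h
  refine (Finset.sum_le_card_nsmul _ _ b fun k _ => hb k).trans ?_
  rw [nsmul_eq_mul, hcard, pow_succ]
  have h1 : (1 : ℝ) ≤ 2 ^ j := one_le_pow₀ one_le_two
  refine mul_le_mul_of_nonneg_right ?_ hb0
  linarith

/-- Size of the Littlewood–Paley kernel and of its primitive. -/
theorem IsCutoff.exists_kernel_bound (hχ : IsCutoff χ) : ∃ C : ℝ, 0 ≤ C ∧ ∀ j : ℕ,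
    ∫ z, lpKernel χ j z ^ 2 ≤ C * 2 ^ j ∧
    ∃ Φ : Circle2Pi → ℝ, Continuous Φ ∧ ContDiff ℝ ∞ (fun y : ℝ => Φ (y : Circle2Pi)) ∧
      (∀ y : ℝ, HasDerivAt (fun y : ℝ => Φ (y : Circle2Pi)) (lpKernel χ j (y : Circle2Pi)) y) ∧
      ∫ z, Φ z ^ 2 ≤ C * (2 ^ j)⁻¹ := by
  obtain ⟨B, hB0, hB⟩ := hχ.exists_abs_le
  have hρ : ∀ (j : ℕ) (ξ : ℝ), |lpSymbol χ j ξ| ≤ 2 * B := fun j ξ => by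
    rw [lpSymbol_natCast]
    refine (abs_sub _ _).trans ?_
    linarith [hB (ξ / 2 ^ (j + 1)), hB (ξ / 2 ^ j)]
  have hpi := Real.two_pi_pos
  -- Parseval: at most `5 · 2^j` frequencies, since `2 · 2^(j+1) + 1 ≤ 5 · 2^j`. The coefficients
  -- are bounded by `4B` for the kernel and by `4B / 2^j` for the primitive, because `|ρ_j| ≤ 2B`
  -- and only `|k| > 2^j / 2` contributes.
  refine ⟨2 * Real.pi * (5 * (4 * B) ^ 2), by positivity, fun j => ⟨?_, ?_⟩⟩
  · rw [hχ.lpKernel_eq]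
    refine (integral_trigPoly_sq_le _ _).trans ?_
    have h := sum_lpFreq_le (j := j) (c := fun k => (lpSymbol χ j k : ℂ)) (b := (4 * B) ^ 2)
      (fun k => by
        rw [Complex.norm_real, Real.norm_eq_abs]
        have := hρ j k
        gcongr
        linarith) (sq_nonneg _)
    refine (mul_le_mul_of_nonneg_left h hpi.le).trans_eq ?_
    ring
  -- Fourier coefficients of the primitive. The symbol vanishes near zero, so the quotient at `k =
  -- 0`, which is zero by convention, is harmless and the primitive is periodic.
  · set c : ℤ → ℂ := fun k => (lpSymbol χ j k : ℂ) / (Complex.I * k) with hc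
    have hder : (fun k : ℤ => Complex.I * k * c k) = fun k : ℤ => (lpSymbol χ j k : ℂ) := by
      funext k
      by_cases hk : k = 0
      · rw [hk, Int.cast_zero, hχ.lpSymbol_eq_zero_of_ge (by rw [Int.cast_zero, abs_zero]; positivity)]
        simp
      · have : (k : ℂ) ≠ 0 := by exact_mod_cast hk
        simp only [hc]
        field_simp [Complex.I_ne_zero]
    refine ⟨trigPoly (lpFreq j) c, continuous_trigPoly _ _, contDiff_trigPoly _ _, fun y => ?_, ?_⟩
    · have h := hasDerivAt_trigPoly (lpFreq j) c y
      rw [hder] at h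
      rw [hχ.lpKernel_eq]
      exact h
    · refine (integral_trigPoly_sq_le _ _).trans ?_
      have h2 : (0 : ℝ) < 2 ^ j := by positivity
      have h := sum_lpFreq_le (j := j) (c := c) (b := (4 * B / 2 ^ j) ^ 2)
        (fun k => by
          by_cases hk : |(k : ℝ)| ≤ 2 ^ j / 2
          · simp only [hc, hχ.lpSymbol_eq_zero_of_ge hk]
            rw [Complex.ofReal_zero, zero_div, norm_zero, zero_pow two_ne_zero]
            exact sq_nonneg _
          · have hk' := not_le.1 hk
            have h3 : ‖c k‖ = |lpSymbol χ j k| / |(k : ℝ)| := by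
              simp [hc]
            rw [h3]
            refine pow_le_pow_left₀ (by positivity) ?_ 2
            rw [div_le_div_iff₀ (by linarith) h2]
            nlinarith [hρ j k, abs_nonneg (k : ℝ)]) (sq_nonneg _)
      refine (mul_le_mul_of_nonneg_left h hpi.le).trans_eq ?_
      field_simp

end Kernel

/-! ### Littlewood–Paley decomposition on the circle -/

/-- The function `1 + cos z` on the circle. -/
def circlePeak (z : Circle2Pi) : ℝ := 1 + cosC z

theorem isPeak_circlePeak : IsPeak circlePeak where
  cont := continuous_const.add continuous_cosC
  nonneg z := by linarith [neg_one_le_cosC z, show circlePeak z = 1 + cosC z from rfl]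
  pos := by rw [circlePeak, cosC_zero]; norm_num
  lt z hz := by rw [circlePeak, circlePeak, cosC_zero]; linarith [cosC_lt_one hz]
  even z := by rw [circlePeak, cosC_neg, circlePeak]

/-- With `e = e^{iz}` one has `1 + cos z = (1 + e)² / (2e)`, and the binomial theorem applies. What
matters is that only frequencies of size at most `m` occur. -/
theorem circlePeak_pow (m : ℕ) (z : Circle2Pi) : ((circlePeak z ^ m : ℝ) : ℂ) =
    ∑ l ∈ Finset.range (2 * m + 1),
      ((2 * m).choose l : ℂ) / 2 ^ m * fourier ((l : ℤ) - m) z := by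
  set e : ℂ := fourier 1 z with he
  have he0 : e ≠ 0 := by
    rw [he, fourier_apply]
    exact Circle.coe_ne_zero _
  have h1 : ((circlePeak z : ℝ) : ℂ) = (1 + e) ^ 2 / (2 * e) := by
    obtain ⟨y, rfl⟩ := QuotientAddGroup.mk_surjective z
    have hy : e = Complex.exp (y * Complex.I) := by
      have hpi : (Real.pi : ℂ) ≠ 0 := by exact_mod_cast Real.pi_ne_zero
      refine (fourier_coe_apply (T := 2 * Real.pi) (n := 1) (x := y)).trans ?_
      congr 1
      push_cast
      field_simp
    have hc : ((circlePeak (y : Circle2Pi) : ℝ) : ℂ) = 1 + Complex.cos y := by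
      rw [circlePeak, cosC_coe]
      push_cast
      ring
    refine hc.trans ?_
    rw [Complex.cos, neg_mul, Complex.exp_neg, ← hy]
    field_simp
    ring
  rw [Complex.ofReal_pow, h1, div_pow, ← pow_mul, add_comm 1 e, add_pow, Finset.sum_div]
  refine Finset.sum_congr rfl fun l _ => ?_
  rw [fourier_eq_zpow, ← he, zpow_sub₀ he0, zpow_natCast, zpow_natCast, one_pow, mul_pow]
  field_simp

theorem conv_circlePeak_lpKernel {χ : ℝ → ℝ} (hχ : IsCutoff χ) (m j : ℕ) (z : Circle2Pi) :
    conv (peakKernel circlePeak m) (lpKernel χ j) z =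
      (∑ l ∈ Finset.range (2 * m + 1), (((∫ y, circlePeak y ^ m)⁻¹ : ℝ) : ℂ) *
        (((2 * m).choose l : ℂ) / 2 ^ m) *
        (lpSymbol χ j ((l : ℤ) - m : ℤ) * (2 * Real.pi * fourier ((l : ℤ) - m) z))).re := by
  set a : ℕ → ℂ := fun l => (((∫ y, circlePeak y ^ m)⁻¹ : ℝ) : ℂ) *
        (((2 * m).choose l : ℂ) / 2 ^ m) with ha
  have hk : ∀ y, ((peakKernel circlePeak m y : ℝ) : ℂ) =
      ∑ l ∈ Finset.range (2 * m + 1), a l * fourier ((l : ℤ) - m) y := fun y => by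
    rw [peakKernel, Complex.ofReal_mul, circlePeak_pow, Finset.mul_sum]
    simp only [ha, mul_assoc]
  have hkc : Continuous (peakKernel circlePeak m) := isPeak_circlePeak.continuous_peakKernel m
  set P := trigPolyC (lpFreq j) (fun k => (lpSymbol χ j k : ℂ)) with hP
  have h1 : conv (peakKernel circlePeak m) (lpKernel χ j) z =
      (∫ w, ((peakKernel circlePeak m (z - w) : ℝ) : ℂ) * P w).re := by
    have hi : Integrable fun w => ((peakKernel circlePeak m (z - w) : ℝ) : ℂ) * P w :=
      integrable_of_continuous_circle ((Complex.continuous_ofReal.comp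
        (hkc.comp (continuous_const.sub continuous_id))).mul (continuous_trigPolyC _ _))
    rw [← Complex.reCLM_apply, ← Complex.reCLM.integral_comp_comm hi, conv]
    refine integral_congr_ae (ae_of_all _ fun w => ?_)
    simp only [smul_eq_mul, Complex.reCLM_apply, Complex.re_ofReal_mul]
    rw [hχ.lpKernel_eq]
    rfl
  rw [h1]
  congr 1
  have h2 : ∀ w, ((peakKernel circlePeak m (z - w) : ℝ) : ℂ) * P w =
      ∑ l ∈ Finset.range (2 * m + 1), ∑ k ∈ lpFreq j, a l * lpSymbol χ j k *
        (fourier ((l : ℤ) - m) (z - w) * fourier k w) := fun w => by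
    rw [hk, hP, trigPolyC, Finset.sum_mul_sum]
    refine Finset.sum_congr rfl fun l _ => Finset.sum_congr rfl fun k _ => ?_
    ring
  have hi : ∀ (l : ℕ) (k : ℤ), Integrable fun w : Circle2Pi => a l * lpSymbol χ j k *
        ((fourier ((l : ℤ) - m) (z - w) : ℂ) * fourier k w) := fun l k =>
    integrable_of_continuous_circle (continuous_const.mul
      (((fourier ((l : ℤ) - m)).continuous.comp (continuous_const.sub continuous_id)).mul
        (fourier k).continuous))
  simp only [h2]
  rw [integral_finsetSum _ fun l _ => integrable_finsetSum _ fun k _ => hi l k]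
  refine Finset.sum_congr rfl fun l _ => ?_
  rw [integral_finsetSum _ fun k _ => hi l k]
  simp only [integral_const_mul, integral_fourier_sub_mul, mul_ite, mul_zero]
  rw [Finset.sum_ite_eq]
  split_ifs with hmem
  · ring
  · rw [hχ.lpSymbol_eq_zero_of_notMem hmem]
    simp

/-- The first `N + 1` symbols sum to one on the nonzero frequencies of the peak kernel and to zero
at the mean, so the blocks reproduce the kernel minus its mean. The factor `2π` arises because `φ_j`
carries no normalisation. -/
theorem sum_conv_circlePeak_lpKernel {χ : ℝ → ℝ} (hχ : IsCutoff χ) {m N : ℕ} (hm : m ≤ 2 ^ N)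
    (z : Circle2Pi) : ∑ j ∈ Finset.range (N + 1), conv (peakKernel circlePeak m) (lpKernel χ j) z =
      2 * Real.pi * peakKernel circlePeak m z - 1 := by
  set a : ℕ → ℂ := fun l => (((∫ y, circlePeak y ^ m)⁻¹ : ℝ) : ℂ) *
        (((2 * m).choose l : ℂ) / 2 ^ m) with ha
  have hk : ∀ y, ((peakKernel circlePeak m y : ℝ) : ℂ) =
      ∑ l ∈ Finset.range (2 * m + 1), a l * fourier ((l : ℤ) - m) y := fun y => by
    rw [peakKernel, Complex.ofReal_mul, circlePeak_pow, Finset.mul_sum]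
    simp only [ha, mul_assoc]
  have hmr : m ∈ Finset.range (2 * m + 1) := Finset.mem_range.2 (by omega)
  have hlm : ∀ l : ℕ, ((l : ℤ) - m = 0) ↔ l = m := fun l => by omega
  -- The index `l = m` is frequency zero, and its coefficient is fixed by the unit mass of the
  -- kernel.
  have hmean : a m * (2 * Real.pi) = 1 := by
    have h1 : ((∫ y, peakKernel circlePeak m y : ℝ) : ℂ) = 1 := by
      rw [isPeak_circlePeak.integral_peakKernel, Complex.ofReal_one]
    rw [← integral_complex_ofReal] at h1
    simp only [hk] at h1
    have hi : ∀ l : ℕ, Integrable fun y : Circle2Pi => a l * (fourier ((l : ℤ) - m) y : ℂ) :=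
      fun l => integrable_of_continuous_circle
        (continuous_const.mul (fourier ((l : ℤ) - m)).continuous)
    rw [integral_finsetSum _ fun l _ => hi l] at h1
    simp only [integral_const_mul, integral_fourier, hlm, mul_ite, mul_zero] at h1
    rwa [Finset.sum_ite_eq' _ m, if_pos hmr] at h1
  simp only [conv_circlePeak_lpKernel hχ]
  rw [← Complex.re_sum, Finset.sum_comm]
  have h3 : ∀ l ∈ Finset.range (2 * m + 1), ∑ j ∈ Finset.range (N + 1), a l *
      ((lpSymbol χ j ((l : ℤ) - m : ℤ) : ℂ) * (2 * Real.pi * fourier ((l : ℤ) - m) z)) =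
      2 * Real.pi * (a l * fourier ((l : ℤ) - m) z) -
        if l = m then a m * (2 * Real.pi) else 0 := by
    intro l hl
    have hb : |(l : ℤ) - m| ≤ 2 ^ N := by
      have h4 := Finset.mem_range.1 hl
      have h5 : (m : ℤ) ≤ 2 ^ N := by exact_mod_cast hm
      rw [abs_le]
      constructor <;> omega
    have h6 := congrArg (fun r : ℝ => (r : ℂ)) (hχ.sum_lpSymbol hb)
    simp only [Complex.ofReal_sum, hlm] at h6
    rw [← Finset.mul_sum, ← Finset.sum_mul, h6]
    split_ifs with h7
    · subst h7
      simp
      ring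
    · simp
      ring
  rw [Finset.sum_congr rfl h3, Finset.sum_sub_distrib, ← Finset.mul_sum, ← hk,
    Finset.sum_ite_eq' _ m, if_pos hmr, hmean]
  simp

section Decomposition

variable {E : Type*} [NormedAddCommGroup E] [InnerProductSpace ℝ E] [CompleteSpace E]

theorem conv_circlePeak_eq {χ : ℝ → ℝ} (hχ : IsCutoff χ) {m N : ℕ} (hm : m ≤ 2 ^ N)
    {g : Circle2Pi → E} (hg : Integrable g) (z : Circle2Pi) :
    conv (peakKernel circlePeak m) g z = (2 * Real.pi)⁻¹ • ((∫ w, g w) +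
      ∑ j ∈ Finset.range (N + 1), conv (peakKernel circlePeak m) (conv (lpKernel χ j) g) z) := by
  have hkc : Continuous (peakKernel circlePeak m) := isPeak_circlePeak.continuous_peakKernel m
  have hpi := Real.two_pi_pos.ne'
  have hcc : ∀ j : ℕ, Continuous (conv (peakKernel circlePeak m) (lpKernel χ j)) := fun j =>
    continuous_conv hkc (integrable_of_continuous_circle (hχ.continuous_lpKernel j))
  rw [eq_inv_smul_iff₀ hpi]
  simp only [fun j : ℕ => conv_conv hkc (hχ.continuous_lpKernel j) hg z]
  have hsum : ∑ j ∈ Finset.range (N + 1),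
      conv (conv (peakKernel circlePeak m) (lpKernel χ j)) g z = ∫ w, ∑ j ∈ Finset.range (N + 1),
        conv (peakKernel circlePeak m) (lpKernel χ j) (z - w) • g w :=
    (integral_finsetSum _ fun j _ => integrable_kernel_smul (hcc j) hg z).symm
  rw [hsum, ← integral_add hg
    (integrable_finsetSum _ fun j _ => integrable_kernel_smul (hcc j) hg z), conv, ← integral_smul]
  refine integral_congr_ae (ae_of_all _ fun w => ?_)
  have h := sum_conv_circlePeak_lpKernel hχ hm (z - w)
  simp only [← Finset.sum_smul]
  rw [h, sub_smul, one_smul, smul_smul]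
  abel

/-- Convergence of the Littlewood–Paley series is never needed. After convolution with a peak kernel
the decomposition is a finite exact identity, the convolution contracts `L⁴`, and the uniform bound
passes to the `L²` limit. -/
theorem eLpNorm_four_le_tsum {χ : ℝ → ℝ} (hχ : IsCutoff χ) {g : Circle2Pi → E} (hg : MemLp g 2) :
    eLpNorm g 4 ≤ ENNReal.ofReal (2 * Real.pi)⁻¹ * (eLpNorm (fun _ : Circle2Pi => ∫ w, g w) 4 +
      ∑' j : ℕ, eLpNorm (conv (lpKernel χ j) g) 4) := by
  have hgi : Integrable g := hg.integrable one_le_two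
  refine eLpNorm_le_of_tendsto_eLpNorm_two
    (u := fun m => conv (peakKernel circlePeak m) g) (fun m =>
      (continuous_conv (isPeak_circlePeak.continuous_peakKernel m) hgi).aestronglyMeasurable)
    hg.1 (isPeak_circlePeak.tendsto_eLpNorm_conv_sub hg) fun m => ?_
  have hkc : Continuous (peakKernel circlePeak m) := isPeak_circlePeak.continuous_peakKernel m
  have hci : ∀ j : ℕ, Continuous (conv (lpKernel χ j) g) := fun j =>
    continuous_conv (hχ.continuous_lpKernel j) hgi
  have hcc : ∀ j : ℕ, Continuous (conv (peakKernel circlePeak m) (conv (lpKernel χ j) g)) := fun j =>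
    continuous_conv hkc (integrable_of_continuous_circle (hci j))
  have heq : conv (peakKernel circlePeak m) g = (2 * Real.pi)⁻¹ • ((fun _ => ∫ w, g w) +
      ∑ j ∈ Finset.range (m + 1), conv (peakKernel circlePeak m) (conv (lpKernel χ j) g)) := by
    funext z
    -- The number of blocks is taken as `N = m`, which is ample since `m ≤ 2^m`.
    rw [conv_circlePeak_eq hχ (Nat.lt_two_pow_self (n := m)).le hgi z]
    simp
  rw [heq, eLpNorm_const_smul, Real.enorm_of_nonneg (inv_nonneg.2 Real.two_pi_pos.le)]
  gcongr
  refine (eLpNorm_add_le aestronglyMeasurable_const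
    (Finset.aestronglyMeasurable_sum _ fun j _ => (hcc j).aestronglyMeasurable) (by norm_num)).trans ?_
  gcongr
  refine (eLpNorm_sum_le (fun j _ => (hcc j).aestronglyMeasurable) (by norm_num)).trans ?_
  refine le_trans (Finset.sum_le_sum fun j _ => ?_) (ENNReal.sum_le_tsum (Finset.range (m + 1)))
  exact eLpNorm_four_conv_le hkc (isPeak_circlePeak.peakKernel_nonneg m)
    (isPeak_circlePeak.integral_peakKernel m) (integrable_of_continuous_circle (hci j))

end Decomposition

end

noncomputable section

variable {d : ℕ}

/-! ### Littlewood–Paley blocks on the torus -/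

/-- The convolution in the vertical variable. -/
def vertConv (Φ : Circle2Pi → ℝ) (g : Torus d → Vel) (x : Torus d) : Vel :=
  ∫ ζ : Circle2Pi, Φ (x.2 - ζ) • g (x.1, ζ)

theorem lpBlock_eq_vertConv (χ : ℝ → ℝ) (j : ℤ) (f : Torus d → Vel) :
    lpBlock χ j f = vertConv (lpKernel χ j) f := rfl

theorem stronglyMeasurable_vertConv {Φ : Circle2Pi → ℝ} (hΦ : Continuous Φ) {g : Torus d → Vel}
    (hg : StronglyMeasurable g) : StronglyMeasurable (vertConv Φ g) := by
  refine StronglyMeasurable.integral_prod_right' (ν := (volume : Measure Circle2Pi))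
    (f := fun q : Torus d × Circle2Pi => Φ (q.1.2 - q.2) • g (q.1.1, q.2)) ?_
  have h1 : StronglyMeasurable fun q : Torus d × Circle2Pi => Φ (q.1.2 - q.2) :=
    (hΦ.comp ((continuous_snd.comp continuous_fst).sub continuous_snd)).stronglyMeasurable
  have h2 : StronglyMeasurable fun q : Torus d × Circle2Pi => g (q.1.1, q.2) :=
    hg.comp_measurable ((measurable_fst.comp measurable_fst).prodMk measurable_snd)
  exact h1.smul h2

theorem memLp_kernel_smul {Φ : Circle2Pi → ℝ} (hΦ : Continuous Φ) (g : L2 d) (z : Circle2Pi) :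
    MemLp (fun y : Torus d => Φ (z - y.2) • g y) 2 := by
  have hc : Continuous fun y : Torus d => Φ (z - y.2) :=
    hΦ.comp (continuous_const.sub continuous_snd)
  obtain ⟨C, -, hC⟩ := exists_abs_le_of_continuous hc
  refine MemLp.of_le_mul (c := C) (Lp.memLp g)
    (hc.aestronglyMeasurable.smul (Lp.aestronglyMeasurable g)) (ae_of_all _ fun y => ?_)
  rw [norm_smul]
  exact mul_le_mul_of_nonneg_right (hC y) (norm_nonneg _)

/-- Cauchy–Schwarz in the vertical variable for each horizontal point. The bound holds at every
height `z`, so it controls a supremum in `z`, as in Bernstein's inequality. -/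
theorem lintegral_vertConv_sq_le {Φ : Circle2Pi → ℝ} (hΦ : Continuous Φ) (g : L2 d)
    (z : Circle2Pi) : ∫⁻ x : HTorus d, ‖vertConv Φ g (x, z)‖ₑ ^ 2 ≤
      ENNReal.ofReal (∫ w, Φ w ^ 2) * eLpNorm g 2 ^ 2 := by
  have hΦ2 : eLpNorm (fun ζ => Φ (z - ζ)) 2 ^ 2 = ENNReal.ofReal (∫ w, Φ w ^ 2) := by
    have hi : Integrable fun w => Φ w ^ 2 := integrable_of_continuous_circle (hΦ.pow 2)
    rw [eLpNorm_two_sq, ofReal_integral_eq_lintegral_ofReal hi (ae_of_all _ fun w => sq_nonneg _),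
      lintegral_sub_left_eq_self (fun w => ‖Φ w‖ₑ ^ 2) z]
    refine lintegral_congr fun w => ?_
    rw [← Real.enorm_of_nonneg (sq_nonneg (Φ w)), enorm_pow]
  have hm : StronglyMeasurable g := Lp.stronglyMeasurable g
  rw [eLpNorm_two_sq, lintegral_torus (hm.enorm.pow_const 2).aemeasurable, ← hΦ2,
    ← lintegral_const_mul' _ _ (by rw [hΦ2]; exact ENNReal.ofReal_ne_top)]
  refine lintegral_mono fun x => ?_
  have hgx : AEStronglyMeasurable (fun ζ : Circle2Pi => g (x, ζ)) :=
    (hm.comp_measurable measurable_prodMk_left).aestronglyMeasurable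
  have h1 := eLpNorm_smul_le_mul_eLpNorm (μ := volume) (p := 2) (q := 2) (r := 1) hgx
    (hΦ.comp (continuous_const.sub continuous_id) :
      Continuous fun ζ => Φ (z - ζ)).aestronglyMeasurable
  rw [eLpNorm_one_eq_lintegral_enorm] at h1
  rw [← eLpNorm_two_sq, ← mul_pow]
  gcongr
  exact (enorm_integral_le_lintegral_enorm _).trans h1

theorem isSmooth_hPeakKernel_mul (m : ℕ) {Φ : Circle2Pi → ℝ}
    (hΦ : ContDiff ℝ ∞ fun y : ℝ => Φ (y : Circle2Pi)) :
    IsSmooth fun y : Torus d => peakKernel (hPeak d) m y.1 * Φ y.2 := by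
  refine isSmooth_peak_mul m (∫ y, hPeak d y ^ m)⁻¹ hΦ fun y => ?_
  simp only [peakKernel, hPeak, coverMap, cosC_coe]

/-- Integration by parts in the vertical convolution. -/
theorem ae_vertConv_eq {f g : L2 d} (hfg : IsWeakPartial none f g) {Φ φ : Circle2Pi → ℝ}
    (hΦc : Continuous Φ) (hφc : Continuous φ) (hΦ : ContDiff ℝ ∞ fun y : ℝ => Φ (y : Circle2Pi))
    (hder : ∀ y : ℝ, HasDerivAt (fun y : ℝ => Φ (y : Circle2Pi)) (φ (y : Circle2Pi)) y)
    (z : Circle2Pi) : ∀ᵐ x : HTorus d, vertConv φ f (x, z) = vertConv Φ g (x, z) := by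
  have hA := memLp_integral_snd (memLp_kernel_smul hφc f z)
  have hB := memLp_integral_snd (memLp_kernel_smul hΦc g z)
  -- At fixed height the identity is tested by horizontal convolution. The product of a horizontal
  -- peak kernel with `Φ` is a smooth kernel on the torus, so the weak derivative in `z` applies to
  -- it.
  have h0 := isPeak_hPeak.ae_eq_zero_of_conv_eq_zero (hA.sub hB) fun m x => ?_
  · filter_upwards [h0] with x hx
    exact sub_eq_zero.1 hx
  have hK := (isPeak_hPeak (d := d)).continuous_peakKernel m
  have hs := isSmooth_hPeakKernel_mul (d := d) m hΦ
  have hpd : partialDeriv none (fun y : Torus d => peakKernel (hPeak d) m y.1 * Φ y.2) =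
      fun y => peakKernel (hPeak d) m y.1 * φ y.2 := by
    funext y
    obtain ⟨y1, y2⟩ := y
    obtain ⟨b, rfl⟩ := QuotientAddGroup.mk_surjective y2
    refine HasDerivAt.deriv ?_
    have h1 : HasDerivAt (fun s : ℝ => Φ ((b + s : ℝ) : Circle2Pi)) (φ (b : Circle2Pi)) 0 := by
      have h2 := hder (b + 0)
      have h3 := h2.comp_const_add b 0
      rwa [add_zero] at h3
    have h4 := h1.const_mul (peakKernel (hPeak d) m y1)
    refine h4.congr_of_eventuallyEq (Eventually.of_forall fun s => ?_)
    simp [shift]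
  have hcv : ∀ {Ψ : Circle2Pi → ℝ}, Continuous Ψ → ∀ k : L2 d,
      conv (fun y : Torus d => peakKernel (hPeak d) m y.1 * Ψ y.2) k (x, z) =
      conv (peakKernel (hPeak d) m) (fun x => ∫ ζ : Circle2Pi, Ψ (z - ζ) • k (x, ζ)) x :=
    fun {Ψ} hΨ k => by
      rw [conv_integral_snd (G := fun y : Torus d => Ψ (z - y.2) • k y)
        ((memLp_kernel_smul hΨ k z).integrable one_le_two) hK x]
      simp only [conv, smul_smul]
      rfl
  have key := hs.conv_partialDeriv hfg (x, z)
  rw [hpd, hcv hφc, hcv hΦc] at key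
  have hsub : conv (peakKernel (hPeak d) m)
      ((fun x => ∫ ζ : Circle2Pi, φ (z - ζ) • f (x, ζ)) -
        fun x => ∫ ζ : Circle2Pi, Φ (z - ζ) • g (x, ζ)) x =
      conv (peakKernel (hPeak d) m) (fun x => ∫ ζ : Circle2Pi, φ (z - ζ) • f (x, ζ)) x -
      conv (peakKernel (hPeak d) m) (fun x => ∫ ζ : Circle2Pi, Φ (z - ζ) • g (x, ζ)) x := by
    simp only [conv, Pi.sub_apply, smul_sub]
    exact integral_sub (integrable_kernel_smul hK (hA.integrable one_le_two) x)
      (integrable_kernel_smul hK (hB.integrable one_le_two) x)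
  exact hsub.trans (sub_eq_zero.2 key)

/-- At each height two powers of `|F|` are replaced by the horizontal supremum. The other two
integrate to at most `A`, and the remaining integral in `z` is the mixed norm. -/
theorem lintegral_four_le_mixedNorm {F : Torus d → Vel} (hF : StronglyMeasurable F) {A : ℝ≥0∞}
    (hA : A ≠ ⊤) (hFA : ∀ z, ∫⁻ x : HTorus d, ‖F (x, z)‖ₑ ^ 2 ≤ A) :
    ∫⁻ x, ‖F x‖ₑ ^ 4 ≤ A * mixedNorm 2 F ^ 2 := by
  have h2 : ENNReal.ofReal 2 = 2 := by norm_num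
  rw [volume_eq_prod, lintegral_prod_symm' _ (hF.enorm.pow_const 4), mixedNorm, h2, eLpNorm_two_sq,
    ← lintegral_const_mul' _ _ hA]
  refine lintegral_mono fun z => ?_
  set s := eLpNorm (fun x : HTorus d => F (x, z)) ⊤ with hs
  have hle : ∀ᵐ x : HTorus d, ‖F (x, z)‖ₑ ≤ s := by
    rw [hs, eLpNorm_exponent_top]
    exact enorm_ae_le_eLpNormEssSup _ _
  have hm : Measurable fun x : HTorus d => ‖F (x, z)‖ₑ ^ 2 :=
    ((hF.comp_measurable measurable_prodMk_right).enorm).pow_const 2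
  calc ∫⁻ x : HTorus d, ‖F (x, z)‖ₑ ^ 4 ≤ ∫⁻ x : HTorus d, ‖F (x, z)‖ₑ ^ 2 * s ^ 2 := by
        refine lintegral_mono_ae ?_
        filter_upwards [hle] with x hx
        calc ‖F (x, z)‖ₑ ^ 4 = ‖F (x, z)‖ₑ ^ 2 * ‖F (x, z)‖ₑ ^ 2 := by ring
          _ ≤ _ := by gcongr
    _ = (∫⁻ x : HTorus d, ‖F (x, z)‖ₑ ^ 2) * s ^ 2 := lintegral_mul_const _ hm
    _ ≤ A * ‖s‖ₑ ^ 2 := by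
        gcongr
        · exact hFA z
        · exact le_rfl

/-- The `L⁴` norm of a single block. -/
theorem IsCutoff.exists_block_bound {χ : ℝ → ℝ} (hχ : IsCutoff χ) {γ : ℝ} (hγ : 2 < γ) :
    ∃ C : ℝ≥0∞, C ≠ ⊤ ∧ ∀ (f : L2 d), MemH1 f → ∀ j : ℕ,
      ∫⁻ x, ‖lpBlock χ j f x‖ₑ ^ 4 ≤ C * (2 ^ j)⁻¹ *
        (eLpNorm f 2 ^ 2 * besovNorm χ (2 / γ) 2 f ^ γ + eLpNorm (weakPartial none f) 2 ^ 2) := by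
  obtain ⟨C, hC0, hC⟩ := hχ.exists_kernel_bound
  refine ⟨ENNReal.ofReal C, ENNReal.ofReal_ne_top, fun f hf j => ?_⟩
  obtain ⟨hk, Φ, hΦc, hΦ, hder, hΦi⟩ := hC j
  have hφc := hχ.continuous_lpKernel j
  set q : ℝ≥0∞ := 2 ^ j with hq
  have hq0 : q ≠ 0 := pow_ne_zero _ two_ne_zero
  have hqt : q ≠ ⊤ := ENNReal.pow_ne_top ENNReal.ofNat_ne_top
  have hqr : ENNReal.ofReal ((2 : ℝ) ^ j) = q := by
    rw [ENNReal.ofReal_pow zero_le_two, ENNReal.ofReal_ofNat]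
  set M := mixedNorm 2 (lpBlock χ j f) with hM
  set N := besovNorm χ (2 / γ) 2 f with hN
  set F2 := eLpNorm f 2 ^ 2 with hF2
  set D2 := eLpNorm (weakPartial none f) 2 ^ 2 with hD2
  have hF2t : F2 ≠ ⊤ := ENNReal.pow_ne_top (Lp.eLpNorm_ne_top f)
  have hD2t : D2 ≠ ⊤ := ENNReal.pow_ne_top (Lp.eLpNorm_ne_top _)
  have hmeas : StronglyMeasurable (lpBlock χ j f) :=
    stronglyMeasurable_vertConv hφc (Lp.stronglyMeasurable f)
  have hb1 : ∀ z, ∫⁻ x : HTorus d, ‖lpBlock χ j f (x, z)‖ₑ ^ 2 ≤ ENNReal.ofReal C * q * F2 :=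
    fun z => by
      refine (lintegral_vertConv_sq_le hφc f z).trans ?_
      rw [← hqr, ← ENNReal.ofReal_mul hC0]
      gcongr
  -- Integration by parts moves the vertical derivative to `f`. The primitive of the kernel is
  -- smaller than the kernel by `2^{-2j}` in the squared norm.
  have hb2 : ∀ z, ∫⁻ x : HTorus d, ‖lpBlock χ j f (x, z)‖ₑ ^ 2 ≤ ENNReal.ofReal C * q⁻¹ * D2 :=
    fun z => by
      have h1 : ∫⁻ x : HTorus d, ‖lpBlock χ j f (x, z)‖ₑ ^ 2 =
          ∫⁻ x : HTorus d, ‖vertConv Φ (weakPartial none f) (x, z)‖ₑ ^ 2 := by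
        refine lintegral_congr_ae ?_
        filter_upwards [ae_vertConv_eq (hf.isWeakPartial none) hΦc hφc hΦ hder z] with x hx
        rw [lpBlock_eq_vertConv, hx]
      rw [h1]
      refine (lintegral_vertConv_sq_le hΦc _ z).trans ?_
      rw [← hqr, ← ENNReal.ofReal_inv_of_pos (by positivity), ← ENNReal.ofReal_mul hC0]
      gcongr
  have hMN : q ^ (2 / γ) * M ≤ N := by
    have h1 := le_iSup (fun j : ℤ => ENNReal.ofReal ((2 : ℝ) ^ (2 / γ * (j : ℝ))) *
      mixedNorm 2 (lpBlock χ j f)) j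
    refine le_trans (le_of_eq ?_) h1
    congr 1
    rw [mul_comm (2 / γ), Real.rpow_mul zero_le_two, Int.cast_natCast, Real.rpow_natCast,
      ← ENNReal.ofReal_rpow_of_pos (by positivity), hqr]
  -- The two bounds are complementary. For small blocks the `∂_z f` bound already decays. For large
  -- ones `M² ≤ M^γ`, and the weight `2^{2j/γ}` raised to the power `γ` turns the growth `2^j` into
  -- the decay `2^{-j}`.
  by_cases hM1 : M ≤ 1
  · refine (lintegral_four_le_mixedNorm hmeas (ENNReal.mul_ne_top (ENNReal.mul_ne_top
      ENNReal.ofReal_ne_top (ENNReal.inv_ne_top.2 hq0)) hD2t) hb2).trans ?_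
    calc ENNReal.ofReal C * q⁻¹ * D2 * M ^ 2 ≤ ENNReal.ofReal C * q⁻¹ * D2 * 1 ^ 2 := by gcongr
      _ ≤ _ := by rw [one_pow, mul_one]; gcongr; exact le_add_self
  · refine (lintegral_four_le_mixedNorm hmeas (ENNReal.mul_ne_top (ENNReal.mul_ne_top
      ENNReal.ofReal_ne_top hqt) hF2t) hb1).trans ?_
    have hMγ : M ^ 2 ≤ M ^ γ := by
      rw [← ENNReal.rpow_two]
      exact ENNReal.rpow_le_rpow_of_exponent_le (not_le.1 hM1).le hγ.le
    have hNγ : q * M ^ γ ≤ q⁻¹ * N ^ γ := by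
      have h1 := ENNReal.rpow_le_rpow hMN (by linarith : 0 ≤ γ)
      rw [ENNReal.mul_rpow_of_nonneg _ _ (by linarith : 0 ≤ γ), ← ENNReal.rpow_mul,
        div_mul_cancel₀ _ (by linarith : γ ≠ 0), ENNReal.rpow_two] at h1
      calc q * M ^ γ = q⁻¹ * (q ^ 2 * M ^ γ) := by
            rw [sq, mul_assoc q q, ← mul_assoc q⁻¹, ENNReal.inv_mul_cancel hq0 hqt, one_mul]
        _ ≤ _ := by gcongr
    calc ENNReal.ofReal C * q * F2 * M ^ 2 ≤ ENNReal.ofReal C * q * F2 * M ^ γ := by gcongr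
      _ = ENNReal.ofReal C * F2 * (q * M ^ γ) := by ring
      _ ≤ ENNReal.ofReal C * F2 * (q⁻¹ * N ^ γ) := by gcongr
      _ = ENNReal.ofReal C * q⁻¹ * (F2 * N ^ γ) := by ring
      _ ≤ _ := by gcongr; exact le_self_add

/-! ### Summation of the blocks -/

/-- Minkowski's inequality for finite sums, extended to series by Fatou's lemma. -/
theorem eLpNorm_four_tsum_le {α : Type*} [MeasurableSpace α] {μ : Measure α}
    {a : ℕ → α → ℝ≥0∞} (ha : ∀ j, Measurable (a j)) :
    eLpNorm (fun x => ∑' j, a j x) 4 μ ≤ ∑' j, eLpNorm (a j) 4 μ := by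
  have hpart : ∀ n, ∫⁻ x, (∑ j ∈ Finset.range n, a j x) ^ 4 ∂μ ≤ (∑' j, eLpNorm (a j) 4 μ) ^ 4 := by
    intro n
    have h1 := eLpNorm_sum_le (μ := μ) (p := 4) (s := Finset.range n) (f := a)
      (fun j _ => (ha j).aestronglyMeasurable) (by norm_num)
    have h2 := eLpNorm_four_pow (μ := μ) (∑ j ∈ Finset.range n, a j)
    simp only [Finset.sum_apply, enorm_eq_self] at h2
    rw [← h2]
    gcongr
    exact h1.trans (ENNReal.sum_le_tsum _)
  have hlim : ∀ x, liminf (fun n => (∑ j ∈ Finset.range n, a j x) ^ 4) atTop =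
      (∑' j, a j x) ^ 4 := fun x =>
    ((ENNReal.continuous_pow 4).tendsto _ |>.comp
      (ENNReal.tendsto_nat_tsum fun j => a j x)).liminf_eq
  refine (ENNReal.pow_le_pow_left_iff four_ne_zero).1 ?_
  rw [eLpNorm_four_pow]
  simp only [enorm_eq_self, ← hlim]
  refine (lintegral_liminf_le fun n => (Finset.measurable_fun_sum _ fun j _ => ha j).pow_const 4).trans ?_
  exact liminf_le_of_le (by isBoundedDefault) fun b hb => by
    obtain ⟨n, hn⟩ := hb.exists
    exact hn.trans (hpart n)

theorem eLpNorm_four_eq {α ε : Type*} [MeasurableSpace α] {μ : Measure α} [ENorm ε] (f : α → ε) :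
    eLpNorm f 4 μ = (∫⁻ x, ‖f x‖ₑ ^ 4 ∂μ) ^ (1 / 4 : ℝ) := by
  rw [← eLpNorm_four_pow, ← ENNReal.rpow_natCast, ← ENNReal.rpow_mul]
  norm_num

theorem measurable_eLpNorm_four_snd {F : Torus d → Vel} (hF : StronglyMeasurable F) :
    Measurable fun x : HTorus d => eLpNorm (fun z : Circle2Pi => F (x, z)) 4 := by
  simp only [eLpNorm_four_eq]
  exact (hF.enorm.pow_const 4).lintegral_prod_right'.pow_const _

theorem eLpNorm_four_eLpNorm_four {F : Torus d → Vel} (hF : StronglyMeasurable F) :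
    eLpNorm (fun x : HTorus d => eLpNorm (fun z : Circle2Pi => F (x, z)) 4) 4 = eLpNorm F 4 := by
  rw [eLpNorm_four_eq, eLpNorm_four_eq F, lintegral_torus (hF.enorm.pow_const 4).aemeasurable]
  simp only [enorm_eq_self, eLpNorm_four_pow]

/-- The vertical integral, as a function on the torus. -/
def vertMean (f : Torus d → Vel) (x : Torus d) : Vel := ∫ w : Circle2Pi, f (x.1, w)

theorem stronglyMeasurable_vertMean {f : Torus d → Vel} (hf : StronglyMeasurable f) :
    StronglyMeasurable (vertMean f) :=
  (hf.integral_prod_right' (ν := (volume : Measure Circle2Pi))).comp_measurable measurable_fst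

/-- The estimate on the circle is applied on almost every vertical line. Taking the `L⁴` norm over
the horizontal variable then gives full norms, since the exponents agree. -/
theorem eLpNorm_four_le_sum_blocks {χ : ℝ → ℝ} (hχ : IsCutoff χ) (f : L2 d) :
    eLpNorm f 4 ≤ ENNReal.ofReal (2 * Real.pi)⁻¹ * (eLpNorm (vertMean f) 4 +
      ∑' j : ℕ, eLpNorm (lpBlock χ j f) 4) := by
  have hm : StronglyMeasurable f := Lp.stronglyMeasurable f
  have hbm : ∀ j : ℕ, StronglyMeasurable (lpBlock χ j f) := fun j =>
    stronglyMeasurable_vertConv (hχ.continuous_lpKernel j) hm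
  have hmm := stronglyMeasurable_vertMean hm
  have hL2 : ∀ᵐ x : HTorus d, MemLp (fun z : Circle2Pi => f (x, z)) 2 := by
    have h1 : ∫⁻ x : HTorus d, ∫⁻ z : Circle2Pi, ‖f (x, z)‖ₑ ^ 2 ≠ ⊤ := by
      rw [← lintegral_torus (hm.enorm.pow_const 2).aemeasurable, ← eLpNorm_two_sq]
      exact ENNReal.pow_ne_top (Lp.eLpNorm_ne_top f)
    filter_upwards [ae_lt_top (hm.enorm.pow_const 2).lintegral_prod_right' h1] with x hx
    refine ⟨(hm.comp_measurable measurable_prodMk_left).aestronglyMeasurable, ?_⟩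
    by_contra hne
    rw [not_lt, top_le_iff] at hne
    rw [← eLpNorm_two_sq, hne] at hx
    simp at hx
  set c := ENNReal.ofReal (2 * Real.pi)⁻¹ with hc
  set a : HTorus d → ℝ≥0∞ := fun x => eLpNorm (fun z : Circle2Pi => vertMean f (x, z)) 4 with ha
  set b : ℕ → HTorus d → ℝ≥0∞ := fun j x => eLpNorm (fun z : Circle2Pi => lpBlock χ j f (x, z)) 4
    with hb
  have hbmeas : ∀ j, Measurable (b j) := fun j => measurable_eLpNorm_four_snd (hbm j)
  have hptw : ∀ᵐ x : HTorus d, eLpNorm (fun z : Circle2Pi => f (x, z)) 4 ≤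
      c * (a x + ∑' j, b j x) := by
    filter_upwards [hL2] with x hx
    exact eLpNorm_four_le_tsum hχ hx
  have h1 : eLpNorm f 4 ≤ c * eLpNorm (fun x => a x + ∑' j, b j x) 4 := by
    rw [← eLpNorm_four_eLpNorm_four hm]
    refine (ENNReal.pow_le_pow_left_iff four_ne_zero).1 ?_
    rw [mul_pow, eLpNorm_four_pow, eLpNorm_four_pow,
      ← lintegral_const_mul' _ _ (ENNReal.pow_ne_top ENNReal.ofReal_ne_top)]
    refine lintegral_mono_ae ?_
    filter_upwards [hptw] with x hx
    simp only [enorm_eq_self, ← mul_pow]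
    gcongr
  refine h1.trans ?_
  gcongr
  have h2 := eLpNorm_add_le (μ := volume) (p := 4) (f := a) (g := fun x => ∑' j, b j x)
    (measurable_eLpNorm_four_snd hmm).aestronglyMeasurable
    (Measurable.tsum hbmeas).aestronglyMeasurable (by norm_num)
  refine h2.trans ?_
  rw [ha, eLpNorm_four_eLpNorm_four hmm]
  gcongr
  refine (eLpNorm_four_tsum_le hbmeas).trans (le_of_eq ?_)
  simp only [hb, fun j => eLpNorm_four_eLpNorm_four (hbm j)]

/-- Fourth roots turn the decay `2^{-j}` into a geometric series of ratio `2^{-1/4}`. -/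
theorem tsum_pow_four_le {a : ℕ → ℝ≥0∞} {Y : ℝ≥0∞} (h : ∀ j, a j ^ 4 ≤ (2 ^ j)⁻¹ * Y) :
    (∑' j, a j) ^ 4 ≤ ((1 - (2⁻¹ : ℝ≥0∞) ^ (1 / 4 : ℝ))⁻¹) ^ 4 * Y := by
  have h4 : ∀ y : ℝ≥0∞, (y ^ (1 / 4 : ℝ)) ^ 4 = y := fun y => by
    rw [← ENNReal.rpow_natCast, ← ENNReal.rpow_mul]
    norm_num
  have h1 : ∀ j : ℕ, a j ≤ ((2⁻¹ : ℝ≥0∞) ^ (1 / 4 : ℝ)) ^ j * Y ^ (1 / 4 : ℝ) := fun j => by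
    refine (ENNReal.pow_le_pow_left_iff four_ne_zero).1 ?_
    rw [mul_pow, h4, ← pow_mul, mul_comm j, pow_mul, h4, ← ENNReal.inv_pow]
    exact h j
  calc (∑' j, a j) ^ 4 ≤ (∑' j : ℕ, ((2⁻¹ : ℝ≥0∞) ^ (1 / 4 : ℝ)) ^ j * Y ^ (1 / 4 : ℝ)) ^ 4 := by
        gcongr with j
        exact h1 j
    _ = _ := by rw [ENNReal.tsum_mul_right, ENNReal.tsum_geometric, mul_pow, h4]

theorem IsCutoff.exists_sum_blocks_bound {χ : ℝ → ℝ} (hχ : IsCutoff χ) {γ : ℝ} (hγ : 2 < γ) :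
    ∃ C : ℝ≥0∞, C ≠ ⊤ ∧ ∀ (f : L2 d), MemH1 f →
      (∑' j : ℕ, eLpNorm (lpBlock χ j f) 4) ^ 4 ≤ C *
        (eLpNorm f 2 ^ 2 * besovNorm χ (2 / γ) 2 f ^ γ + eLpNorm (weakPartial none f) 2 ^ 2) := by
  obtain ⟨C, hC, hb⟩ := hχ.exists_block_bound (d := d) hγ
  have hr1 : (2⁻¹ : ℝ≥0∞) ^ (1 / 4 : ℝ) < 1 := ENNReal.rpow_lt_one (by norm_num) (by norm_num)
  refine ⟨((1 - (2⁻¹ : ℝ≥0∞) ^ (1 / 4 : ℝ))⁻¹) ^ 4 * C, ENNReal.mul_ne_top (ENNReal.pow_ne_top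
    (ENNReal.inv_ne_top.2 (tsub_pos_of_lt hr1).ne')) hC, fun f hf => ?_⟩
  rw [mul_assoc]
  refine tsum_pow_four_le fun j => ?_
  rw [eLpNorm_four_pow]
  refine (hb f hf j).trans (le_of_eq ?_)
  rw [mul_left_comm, mul_assoc]

end

noncomputable section

variable {d : ℕ}

/-! ### Ladyzhenskaya's inequality on the horizontal torus -/

/-- By the fundamental theorem `‖u(0)‖²` exceeds `‖u(s)‖²` by at most the integral of `2‖u‖‖u'‖`.
Integrating in `s` over an interval of length `2π ≥ 1` gives the claim with constant one. -/
theorem norm_sq_le_integral_period {E : Type*} [NormedAddCommGroup E] [InnerProductSpace ℝ E]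
    {u u' : ℝ → E} (hu : ∀ s, HasDerivAt u (u' s) s) (hu' : Continuous u') :
    ‖u 0‖ ^ 2 ≤ ∫ s in (0 : ℝ)..0 + 2 * Real.pi, (‖u s‖ ^ 2 + 2 * ‖u s‖ * ‖u' s‖) := by
  have hpi := Real.two_pi_pos
  have hc : Continuous u := continuous_iff_continuousAt.2 fun s => (hu s).continuousAt
  have hd : ∀ s, HasDerivAt (fun s => ‖u s‖ ^ 2) (2 * inner ℝ (u s) (u' s)) s := fun s =>
    (hu s).norm_sq
  have hdc : Continuous fun s => 2 * inner ℝ (u s) (u' s) := continuous_const.mul (hc.inner hu')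
  have hHc : Continuous fun s => 2 * ‖u s‖ * ‖u' s‖ :=
    (continuous_const.mul hc.norm).mul hu'.norm
  have hGc : Continuous fun s => ‖u s‖ ^ 2 := hc.norm.pow 2
  set J := ∫ s in (0 : ℝ)..0 + 2 * Real.pi, 2 * ‖u s‖ * ‖u' s‖ with hJ
  have hpt : ∀ s ∈ Icc (0 : ℝ) (0 + 2 * Real.pi), ‖u 0‖ ^ 2 - J ≤ ‖u s‖ ^ 2 := fun s hs => by
    have h1 := intervalIntegral.integral_eq_sub_of_hasDerivAt (a := 0) (b := s)
      (fun r _ => hd r) (hdc.intervalIntegrable _ _)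
    have h2 : |∫ r in (0 : ℝ)..s, 2 * inner ℝ (u r) (u' r)| ≤
        ∫ r in (0 : ℝ)..s, 2 * ‖u r‖ * ‖u' r‖ := by
      have hle : ∀ r, ‖2 * inner ℝ (u r) (u' r)‖ ≤ 2 * ‖u r‖ * ‖u' r‖ := fun r => by
        rw [norm_mul, Real.norm_ofNat, mul_assoc]
        gcongr
        exact norm_inner_le_norm _ _
      exact intervalIntegral.norm_integral_le_of_norm_le hs.1 (ae_of_all _ fun r _ => hle r)
        (hHc.intervalIntegrable _ _)
    have h3 : ∫ r in (0 : ℝ)..s, 2 * ‖u r‖ * ‖u' r‖ ≤ J :=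
      intervalIntegral.integral_mono_interval le_rfl hs.1 hs.2
        (ae_of_all _ fun r => by simp only [Pi.zero_apply]; positivity)
        (hHc.intervalIntegrable _ _)
    have h4 := (abs_le.1 (h2.trans h3)).1
    linarith
  have h5 : ∫ _s in (0 : ℝ)..0 + 2 * Real.pi, (‖u 0‖ ^ 2 - J) ≤
      ∫ s in (0 : ℝ)..0 + 2 * Real.pi, ‖u s‖ ^ 2 :=
    intervalIntegral.integral_mono_on (by linarith) (by simp) (hGc.intervalIntegrable _ _) hpt
  have h6 : 0 ≤ ∫ s in (0 : ℝ)..0 + 2 * Real.pi, ‖u s‖ ^ 2 :=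
    intervalIntegral.integral_nonneg (by linarith) fun s _ => by positivity
  rw [intervalIntegral.integral_add (hGc.intervalIntegrable _ _) (hHc.intervalIntegrable _ _), ← hJ]
  rw [intervalIntegral.integral_const, smul_eq_mul, zero_add, sub_zero] at h5
  rw [zero_add] at h6 ⊢
  have h7 : (1 : ℝ) ≤ 2 * Real.pi := by linarith [Real.pi_gt_three]
  by_contra hlt
  push Not at hlt
  nlinarith

/-- Only the derivative in direction `i` is needed. The sum over all directions makes the integrand
the same function for every `i`, as the grid-line inequality requires. -/
theorem enorm_sq_le_lintegral_update {M : HTorus d → Vel} {DM : Fin d → HTorus d → Vel}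
    (hM : Continuous M) (hDM : ∀ i, Continuous (DM i))
    (hder : ∀ (i : Fin d) (x : HTorus d) (t : ℝ), HasDerivAt
      (fun s : ℝ => M (x + Pi.single i (s : Circle2Pi))) (DM i (x + Pi.single i (t : Circle2Pi))) t)
    (x : HTorus d) (i : Fin d) :
    ‖M x‖ₑ ^ 2 ≤ ∫⁻ w : Circle2Pi, (‖M (Function.update x i w)‖ₑ ^ 2 +
      2 * ‖M (Function.update x i w)‖ₑ * ∑ k, ‖DM k (Function.update x i w)‖ₑ) := by
  have hsc : Continuous fun w : Circle2Pi => x + Pi.single i w :=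
    continuous_const.add (continuous_single (A := fun _ : Fin d => Circle2Pi) i)
  set F : HTorus d → ℝ := fun y => ‖M y‖ ^ 2 + 2 * ‖M y‖ * ‖DM i y‖ with hF
  have hFc : Continuous F :=
    (hM.norm.pow 2).add ((continuous_const.mul hM.norm).mul (hDM i).norm)
  have hF0 : ∀ y, 0 ≤ F y := fun y => by positivity
  have h1 := norm_sq_le_integral_period (hder i x)
    ((hDM i).comp (hsc.comp (AddCircle.continuous_mk' _)))
  have h2 := AddCircle.intervalIntegral_preimage (2 * Real.pi) 0 fun w => F (x + Pi.single i w)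
  have h3 : ‖M x‖ ^ 2 ≤ ∫ w : Circle2Pi, F (x + Pi.single i w) := by
    rw [← h2]
    simpa using h1
  have h4 : ‖M x‖ₑ ^ 2 ≤ ∫⁻ w : Circle2Pi, ENNReal.ofReal (F (x + Pi.single i w)) := by
    have hi : Integrable fun w : Circle2Pi => F (x + Pi.single i w) :=
      integrable_of_continuous_circle (hFc.comp hsc)
    rw [← ofReal_integral_eq_lintegral_ofReal hi (ae_of_all _ fun w => hF0 _), ← ofReal_norm,
      ← ENNReal.ofReal_pow (norm_nonneg _)]
    exact ENNReal.ofReal_le_ofReal h3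
  have h5 : ∀ w : Circle2Pi, x + Pi.single i w = Function.update x i (x i + w) := fun w => by
    funext k
    by_cases hk : k = i
    · subst hk; simp
    · simp [hk]
  simp only [h5] at h4
  rw [lintegral_add_left_eq_self (fun w => ENNReal.ofReal (F (Function.update x i w))) (x i)] at h4
  refine h4.trans (lintegral_mono fun w => ?_)
  simp only [hF]
  rw [ENNReal.ofReal_add (by positivity) (by positivity), ENNReal.ofReal_pow (norm_nonneg _),
    ENNReal.ofReal_mul (by positivity), ENNReal.ofReal_mul zero_le_two, ofReal_norm, ofReal_norm,
    ENNReal.ofReal_ofNat]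
  gcongr
  exact Finset.single_le_sum (f := fun k => ‖DM k (Function.update x i w)‖ₑ)
    (fun _ _ => zero_le) (Finset.mem_univ i)

/-- Ladyzhenskaya's argument: in two dimensions `|M|⁴` is at most the product of line integrals in
the two directions, whose integral is the square of the full integral. Cauchy–Schwarz then bounds
that integral. -/
theorem eLpNorm_four_le_of_hasDerivAt (hd₁ : 1 ≤ d) (hd : d ≤ 2) {M : HTorus d → Vel}
    {DM : Fin d → HTorus d → Vel} (hM : Continuous M) (hDM : ∀ i, Continuous (DM i))
    (hder : ∀ (i : Fin d) (x : HTorus d) (t : ℝ), HasDerivAt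
      (fun s : ℝ => M (x + Pi.single i (s : Circle2Pi)))
      (DM i (x + Pi.single i (t : Circle2Pi))) t) :
    eLpNorm M 4 ^ 4 ≤ (eLpNorm M 2 ^ 2 + 2 * (eLpNorm M 2 * ∑ k, eLpNorm (DM k) 2)) ^ 2 := by
  set F : HTorus d → ℝ≥0∞ := fun y => ‖M y‖ₑ ^ 2 + 2 * ‖M y‖ₑ * ∑ k, ‖DM k y‖ₑ with hF
  have hm2 : Measurable fun y => ‖M y‖ₑ ^ 2 := (hM.enorm.measurable).pow_const 2
  have hprod : ∀ k, Measurable fun y => ‖M y‖ₑ * ‖DM k y‖ₑ := fun k =>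
    hM.enorm.measurable.mul (hDM k).enorm.measurable
  have hFm : Measurable F := hm2.add ((measurable_const.mul hM.enorm.measurable).mul
    (Finset.measurable_fun_sum _ fun k _ => (hDM k).enorm.measurable))
  have hline := enorm_sq_le_lintegral_update hM hDM hder
  have hself : ∀ x, ‖M x‖ₑ ^ 2 ≤ F x := fun x => le_self_add
  have hFint : ∫⁻ x, F x ≤ eLpNorm M 2 ^ 2 + 2 * (eLpNorm M 2 * ∑ k, eLpNorm (DM k) 2) := by
    simp only [hF]
    rw [lintegral_add_left hm2, ← eLpNorm_two_sq]
    gcongr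
    simp only [mul_assoc, Finset.mul_sum]
    rw [lintegral_finsetSum _ fun k _ => (hprod k).const_mul 2]
    gcongr with k
    rw [lintegral_const_mul _ (hprod k)]
    gcongr
    have h1 := eLpNorm_smul_le_mul_eLpNorm (μ := volume) (p := 2) (q := 2) (r := 1)
      (hDM k).aestronglyMeasurable hM.norm.aestronglyMeasurable
    rw [eLpNorm_one_eq_lintegral_enorm, eLpNorm_norm] at h1
    refine le_trans (le_of_eq (lintegral_congr fun x => ?_)) h1
    simp [enorm_smul]
  -- The exponent `p = 1` is admissible precisely because `(d - 1) p ≤ 1` for `d ≤ 2`.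
  have hgrid := lintegral_mul_prod_lintegral_pow_le (fun _ : Fin d => (volume : Measure Circle2Pi))
    (p := 1) zero_le_one (by
      have : (d : ℝ) ≤ 2 := by exact_mod_cast hd
      rw [Fintype.card_fin]; linarith) hFm
  have hpow : (∫⁻ x, F x) ^ ((1 : ℝ) + 1) = (∫⁻ x, F x) ^ 2 := by
    rw [← ENNReal.rpow_two]; norm_num
  rw [eLpNorm_four_pow]
  refine le_trans ?_ ((hgrid.trans_eq hpow).trans (by gcongr))
  refine lintegral_mono fun x => ?_
  have hsq : ‖M x‖ₑ ^ 4 = ‖M x‖ₑ ^ 2 * ‖M x‖ₑ ^ 2 := by ring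
  simp only [ENNReal.rpow_one, hsq]
  -- For `d = 1` one factor `F` survives outside the single line integral and absorbs `|M|²`. For `d
  -- = 2` its exponent is zero and each `|M|²` uses one direction.
  interval_cases d
  · simp only [Fintype.card_fin, Nat.cast_one, sub_self, zero_mul, sub_zero, ENNReal.rpow_one,
      Finset.univ_unique, Finset.prod_singleton]
    exact mul_le_mul' (hself x) (hline x _)
  · rw [Fintype.card_fin, Fin.prod_univ_two]
    norm_num
    exact mul_le_mul' (hline x 0) (hline x 1)

/-! ### The vertical mean -/

theorem isSmooth_hPeakKernel (m : ℕ) : IsSmooth fun y : Torus d => peakKernel (hPeak d) m y.1 := by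
  have h := isSmooth_hPeakKernel_mul (d := d) m (Φ := fun _ => 1) contDiff_const
  simpa using h

theorem hasDerivAt_conv_integral_snd {f g : L2 d} {i : Fin d} (hfg : IsWeakPartial (some i) f g)
    (m : ℕ) (x : HTorus d) (t : ℝ) : HasDerivAt
      (fun s : ℝ => conv (peakKernel (hPeak d) m) (fun x => ∫ z : Circle2Pi, f (x, z))
        (x + Pi.single i (s : Circle2Pi)))
      (conv (peakKernel (hPeak d) m) (fun x => ∫ z : Circle2Pi, g (x, z))
        (x + Pi.single i (t : Circle2Pi))) t := by
  have hK := (isPeak_hPeak (d := d)).continuous_peakKernel m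
  have hcv : ∀ (k : L2 d) (y : HTorus d),
      conv (peakKernel (hPeak d) m) (fun x => ∫ z : Circle2Pi, k (x, z)) y =
      conv (fun y : Torus d => peakKernel (hPeak d) m y.1) k (y, 0) := fun k y =>
    conv_integral_snd ((Lp.memLp k).integrable one_le_two) hK y
  have h := (isSmooth_hPeakKernel (d := d) m).hasDerivAt_conv ((Lp.memLp f).integrable one_le_two)
    (some i) (x, 0) t
  rw [(isSmooth_hPeakKernel m).conv_partialDeriv hfg] at h
  simp only [hcv]
  simpa [shift] using h

theorem eLpNorm_integral_snd_le (f : L2 d) :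
    eLpNorm (fun x : HTorus d => ∫ z : Circle2Pi, f (x, z)) 2 ≤
      ENNReal.ofReal (√(2 * Real.pi)) * eLpNorm f 2 := by
  refine (ENNReal.pow_le_pow_left_iff two_ne_zero).1 ?_
  rw [mul_pow, ← ENNReal.ofReal_pow (Real.sqrt_nonneg _), Real.sq_sqrt Real.two_pi_pos.le]
  exact eLpNorm_integral_snd_sq_le (Lp.aestronglyMeasurable f)

/-- The vertical mean inherits weak horizontal derivatives. Ladyzhenskaya's inequality is applied to
its mollifications, whose `L²` norms and those of their derivatives are controlled uniformly, and
the bound passes to the limit. -/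
theorem eLpNorm_four_vertMean_le (hd₁ : 1 ≤ d) (hd : d ≤ 2) {f : L2 d} (hf : MemH1 f) :
    eLpNorm (vertMean f) 4 ^ 4 ≤ ENNReal.ofReal (2 * Real.pi) ^ 3 *
      (eLpNorm f 2 ^ 2 + 2 * (eLpNorm f 2 * ∑ k, eLpNorm (weakPartial (some k) f) 2)) ^ 2 := by
  have hpeak := isPeak_hPeak (d := d)
  set M₀ : HTorus d → Vel := fun x => ∫ z : Circle2Pi, f (x, z) with hM₀
  have hmem : ∀ g : L2 d, MemLp (fun x : HTorus d => ∫ z : Circle2Pi, g (x, z)) 2 := fun g =>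
    memLp_integral_snd (Lp.memLp g)
  have hcont : ∀ (m : ℕ) (g : L2 d), Continuous
      (conv (peakKernel (hPeak d) m) fun x => ∫ z : Circle2Pi, g (x, z)) := fun m g =>
    continuous_conv (hpeak.continuous_peakKernel m) ((hmem g).integrable one_le_two)
  have hL2 : ∀ (m : ℕ) (g : L2 d), eLpNorm (conv (peakKernel (hPeak d) m)
      fun x => ∫ z : Circle2Pi, g (x, z)) 2 ≤ ENNReal.ofReal (√(2 * Real.pi)) * eLpNorm g 2 :=
    fun m g => (hpeak.eLpNorm_conv_le m (hmem g)).trans (eLpNorm_integral_snd_le g)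
  set c := ENNReal.ofReal (√(2 * Real.pi)) with hc
  set a := eLpNorm f 2
  set b : Fin d → ℝ≥0∞ := fun k => eLpNorm (weakPartial (some k) f) 2
  have hbound : ∀ m, eLpNorm (conv (peakKernel (hPeak d) m) M₀) 4 ≤
      (((c ^ 2) ^ 2 * (a ^ 2 + 2 * (a * ∑ k, b k)) ^ 2) ^ (1 / 4 : ℝ)) := fun m => by
    rw [eLpNorm_four_eq, ← eLpNorm_four_pow]
    refine ENNReal.rpow_le_rpow ?_ (by norm_num)
    refine (eLpNorm_four_le_of_hasDerivAt hd₁ hd (hcont m f) (fun k => hcont m _)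
      fun k => hasDerivAt_conv_integral_snd (hf.isWeakPartial (some k)) m).trans ?_
    rw [← mul_pow]
    gcongr
    calc _ ≤ (c * a) ^ 2 + 2 * ((c * a) * ∑ k, c * b k) := by
          gcongr with k
          · exact hL2 m f
          · exact hL2 m f
          · exact hL2 m _
      _ = _ := by rw [← Finset.mul_sum]; ring
  have hlim := eLpNorm_le_of_tendsto_eLpNorm_two (fun m => (hcont m f).aestronglyMeasurable)
    (hmem f).1 (hpeak.tendsto_eLpNorm_conv_sub (hmem f)) hbound
  have hc2 : c ^ 2 = ENNReal.ofReal (2 * Real.pi) := by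
    rw [hc, ← ENNReal.ofReal_pow (Real.sqrt_nonneg _), Real.sq_sqrt Real.two_pi_pos.le]
  -- One factor `2π` comes from integrating a function constant in `z`. The other two are `c⁴`, the
  -- cost of taking vertical means in `L²`.
  have hv : eLpNorm (vertMean f) 4 ^ 4 = ENNReal.ofReal (2 * Real.pi) * eLpNorm M₀ 4 ^ 4 := by
    rw [eLpNorm_four_pow, eLpNorm_four_pow]
    exact lintegral_comp_fst ((hmem f).1.enorm.pow_const 4)
  rw [hv, pow_succ' _ 2, mul_assoc]
  gcongr
  refine (pow_le_pow_left₀ (zero_le) hlim 4).trans (le_of_eq ?_)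
  rw [← ENNReal.rpow_natCast, ← ENNReal.rpow_mul, hc2]
  norm_num

end

noncomputable section

variable {d : ℕ}

/-! ### The `L⁴` bound -/

theorem pow_four_le_of_le_mul_add {F c A B e C X Y : ℝ≥0∞} (hF : F ≤ c * (A + B))
    (hA : A ^ 4 ≤ e * X) (hB : B ^ 4 ≤ C * Y) :
    F ^ 4 ≤ c ^ 4 * 2 ^ 4 * (e + C) * (X + Y) := by
  have hAB : (A + B) ^ 4 ≤ 2 ^ 4 * (A ^ 4 + B ^ 4) := by
    rcases le_total A B with h | h
    · calc (A + B) ^ 4 ≤ (B + B) ^ 4 := by gcongr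
        _ = 2 ^ 4 * B ^ 4 := by rw [← two_mul, mul_pow]
        _ ≤ _ := by gcongr; exact le_add_self
    · calc (A + B) ^ 4 ≤ (A + A) ^ 4 := by gcongr
        _ = 2 ^ 4 * A ^ 4 := by rw [← two_mul, mul_pow]
        _ ≤ _ := by gcongr; exact le_self_add
  calc F ^ 4 ≤ (c * (A + B)) ^ 4 := by gcongr
    _ = c ^ 4 * (A + B) ^ 4 := mul_pow _ _ _
    _ ≤ c ^ 4 * (2 ^ 4 * (e * X + C * Y)) := by
        gcongr
        exact hAB.trans (by gcongr)
    _ ≤ c ^ 4 * (2 ^ 4 * ((e + C) * X + (e + C) * Y)) := by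
        gcongr
        · exact le_self_add
        · exact le_add_self
    _ = _ := by rw [← mul_add, mul_assoc, mul_assoc]

theorem IsCutoff.exists_eLpNorm_four_bound {χ : ℝ → ℝ} (hχ : IsCutoff χ) {γ : ℝ} (hγ : 2 < γ)
    (hd₁ : 1 ≤ d) (hd : d ≤ 2) : ∃ C : ℝ≥0∞, C ≠ ⊤ ∧ ∀ f : L2 d, MemH1 f →
      eLpNorm f 4 ^ 4 ≤ C *
        ((eLpNorm f 2 ^ 2 + 2 * (eLpNorm f 2 * ∑ k, eLpNorm (weakPartial (some k) f) 2)) ^ 2 +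
        (eLpNorm f 2 ^ 2 * besovNorm χ (2 / γ) 2 f ^ γ + eLpNorm (weakPartial none f) 2 ^ 2)) := by
  obtain ⟨C, hC, hb⟩ := hχ.exists_sum_blocks_bound (d := d) hγ
  exact ⟨ENNReal.ofReal (2 * Real.pi)⁻¹ ^ 4 * 2 ^ 4 * (ENNReal.ofReal (2 * Real.pi) ^ 3 + C),
    ENNReal.mul_ne_top (ENNReal.mul_ne_top (ENNReal.pow_ne_top ENNReal.ofReal_ne_top)
      (ENNReal.pow_ne_top ENNReal.ofNat_ne_top))
      (ENNReal.add_ne_top.2 ⟨ENNReal.pow_ne_top ENNReal.ofReal_ne_top, hC⟩),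
    fun f hf => pow_four_le_of_le_mul_add (eLpNorm_four_le_sum_blocks hχ f)
      (eLpNorm_four_vertMean_le hd₁ hd hf) (hb f hf)⟩

theorem eLpNorm_coe_eq_ofReal (f : L2 d) : eLpNorm f 2 = ENNReal.ofReal ‖f‖ := by
  rw [← eLpNorm_coe_toReal, ENNReal.ofReal_toReal (Lp.eLpNorm_ne_top f)]

theorem sum_eLpNorm_weakPartial_le (f : L2 d) :
    ∑ k, eLpNorm (weakPartial (some k) f) 2 ≤ ENNReal.ofReal (gradSum f) := by
  simp only [eLpNorm_coe_eq_ofReal]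
  rw [← ENNReal.ofReal_sum_of_nonneg fun _ _ => norm_nonneg _]
  refine ENNReal.ofReal_le_ofReal ?_
  rw [gradSum, Fintype.sum_option]
  linarith [norm_nonneg (weakPartial none f)]

/-- The form needed in time: with `K` uniform on the time interval, the gradients square integrable
and the Besov norm in `L^γ`, every term on the right is integrable. -/
theorem IsCutoff.exists_memLp_four_bound {χ : ℝ → ℝ} (hχ : IsCutoff χ) {γ : ℝ} (hγ : 2 < γ)
    (hd₁ : 1 ≤ d) (hd : d ≤ 2) : ∃ C : ℝ, ∀ (f : L2 d) (K : ℝ), MemH1 f → ‖f‖ ≤ K →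
      besovNorm χ (2 / γ) 2 f ≠ ⊤ → MemLp f 4 ∧ (eLpNorm f 4).toReal ^ 4 ≤
        C * ((K ^ 2 + 2 * (K * gradSum f)) ^ 2 +
          (K ^ 2 * (besovNorm χ (2 / γ) 2 f).toReal ^ γ + gradSum f ^ 2)) := by
  obtain ⟨C, hC, hb⟩ := hχ.exists_eLpNorm_four_bound hγ hd₁ hd
  refine ⟨C.toReal, fun f K hf hK hN => ?_⟩
  set N := besovNorm χ (2 / γ) 2 f with hNdef
  have hK0 : 0 ≤ K := (norm_nonneg f).trans hK
  have hg := gradSum_nonneg f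
  have h1 : eLpNorm f 4 ^ 4 ≤ ENNReal.ofReal (C.toReal * ((K ^ 2 + 2 * (K * gradSum f)) ^ 2 +
      (K ^ 2 * N.toReal ^ γ + gradSum f ^ 2))) := by
    rw [ENNReal.ofReal_mul ENNReal.toReal_nonneg, ENNReal.ofReal_toReal hC,
      ENNReal.ofReal_add (by positivity) (by positivity), ENNReal.ofReal_pow (by positivity),
      ENNReal.ofReal_add (by positivity) (by positivity),
      ENNReal.ofReal_add (by positivity) (by positivity), ENNReal.ofReal_mul (by positivity),
      ENNReal.ofReal_mul hK0, ENNReal.ofReal_mul (by positivity), ENNReal.ofReal_pow hK0,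
      ENNReal.ofReal_pow hg, ENNReal.toReal_rpow, ENNReal.ofReal_toReal
        (ENNReal.rpow_ne_top_of_nonneg (by linarith) hN), ENNReal.ofReal_ofNat]
    refine (hb f hf).trans ?_
    have hf2 : eLpNorm f 2 ≤ ENNReal.ofReal K := by
      rw [eLpNorm_coe_eq_ofReal]; exact ENNReal.ofReal_le_ofReal hK
    have hn2 : eLpNorm (weakPartial none f) 2 ≤ ENNReal.ofReal (gradSum f) := by
      rw [eLpNorm_coe_eq_ofReal]; exact ENNReal.ofReal_le_ofReal (norm_weakPartial_le f none)
    gcongr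
    exact sum_eLpNorm_weakPartial_le f
  have hlt : eLpNorm f 4 ^ 4 < ⊤ := h1.trans_lt ENNReal.ofReal_lt_top
  have hlt' : eLpNorm f 4 < ⊤ := by
    by_contra hne
    rw [not_lt, top_le_iff] at hne
    rw [hne] at hlt
    simp at hlt
  refine ⟨⟨Lp.aestronglyMeasurable f, hlt'⟩, ?_⟩
  rw [← ENNReal.toReal_pow]
  exact ENNReal.toReal_le_of_le_ofReal (by positivity) h1

theorem integrable_toReal_rpow_of_memLp {α : Type*} [MeasurableSpace α] {μ : Measure α}
    {N : α → ℝ≥0∞} {γ : ℝ} (hγ : 0 < γ) (hN : MemLp N (ENNReal.ofReal γ) μ) :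
    (∀ᵐ t ∂μ, N t ≠ ⊤) ∧ Integrable (fun t => (N t).toReal ^ γ) μ := by
  have h0 : ENNReal.ofReal γ ≠ 0 := (ENNReal.ofReal_pos.2 hγ).ne'
  have h1 := (eLpNorm_lt_top_iff_lintegral_rpow_enorm_lt_top h0 ENNReal.ofReal_ne_top).1 hN.2
  rw [ENNReal.toReal_ofReal hγ.le] at h1
  simp only [enorm_eq_self] at h1
  have hm : AEMeasurable N μ := hN.1.aemeasurable
  refine ⟨?_, ?_⟩
  · filter_upwards [ae_lt_top' (hm.pow_const γ) h1.ne] with t ht h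
    rw [h, ENNReal.top_rpow_of_pos hγ] at ht
    exact lt_irrefl _ ht
  · simp only [ENNReal.toReal_rpow]
    exact integrable_toReal_of_lintegral_ne_top (hm.pow_const γ) h1.ne

/-- Weak continuity supplies the uniform `L²` bound `K`. The fixed-time `L⁴` estimate is then a
time-integrable majorant, and the `L⁴` energy equality applies on `[0, t]`. -/
theorem IsWeakSolution.energy_eq_of_memLpBesov {hd : d ≤ 2} {v : ℝ → L2 d} {v₀ : L2 d}
    (hv : IsWeakSolution hd v v₀) (hinit : v 0 = v₀) (hd₁ : 1 ≤ d) {χ : ℝ → ℝ} (hχ : IsCutoff χ)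
    {γ T : ℝ} (hγ : 2 < γ) (hvγ : MemLpBesov χ γ T (2 / γ) 2 v) {t : ℝ} (ht : 0 < t)
    (htT : t ≤ T) :
    1 / 2 * ‖v t‖ ^ 2 + (∫ τ in (0 : ℝ)..t, gradNormSq (v τ)) = 1 / 2 * ‖v₀‖ ^ 2 := by
  have hres : (volume.restrict (Ioc 0 t) : Measure ℝ) = volume.restrict (Ioo 0 t) :=
    restrict_congr_set Ioo_ae_eq_Ioc.symm
  obtain ⟨C, hC⟩ := hχ.exists_memLp_four_bound hγ hd₁ hd
  obtain ⟨K, hK⟩ := exists_norm_le_of_weak_continuous (isCompact_Icc (a := 0) (b := t))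
    fun g => (hv.weak_cont g).mono Icc_subset_Ici_self
  obtain ⟨hNt, hNi⟩ := integrable_toReal_rpow_of_memLp (by linarith)
    (hvγ.mono_measure (restrict_mono (Ioo_subset_Ioo_right htT) le_rfl))
  have hg2 := memLp_gradSum (hv.memLp_grad t)
  have hg1 := hg2.integrable one_le_two
  have hgsq := hg2.integrable_sq
  refine hv.energy_eq hinit ht (A := fun τ => C * ((K ^ 2 + 2 * (K * gradSum (v τ))) ^ 2 +
    (K ^ 2 * (besovNorm χ (2 / γ) 2 (v τ)).toReal ^ γ + gradSum (v τ) ^ 2))) ?_ ?_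
  · rw [IntegrableOn, hres]
    refine Integrable.const_mul (Integrable.add ?_ ((hNi.const_mul _).add hgsq)) C
    -- The expansion of `(K² + 2K g)²`: only the first and second powers of the gradient norm occur,
    -- so `L²` in time suffices.
    have h := ((integrable_const (K ^ 4)).add (hg1.const_mul (4 * K ^ 3))).add
      (hgsq.const_mul (4 * K ^ 2))
    refine h.congr (ae_of_all _ fun τ => ?_)
    simp only [Pi.add_apply]
    ring
  · have hH1 : ∀ᵐ τ ∂volume.restrict (Ioc 0 t), MemH1 (v τ) := by
      rw [ae_restrict_iff' measurableSet_Ioc]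
      filter_upwards [hv.mem_H1] with τ hτ h using hτ h.1
    filter_upwards [hH1, hres ▸ hNt, ae_restrict_mem measurableSet_Ioc] with τ h1 h2 h3
    exact hC (v τ) K h1 (hK τ ⟨h3.1.le, h3.2⟩) h2

end

end PrimitiveEq

theorem theorem1p3 {d : ℕ} (hd₁ : 1 ≤ d) (hd : d ≤ 2)
    (χ : ℝ → ℝ) (hχ : PrimitiveEq.IsCutoff χ)
    (v : ℝ → PrimitiveEq.L2 d) (v₀ : PrimitiveEq.L2 d)
    (hv₀ : PrimitiveEq.MemSolenoidal hd v₀)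
    (hv : PrimitiveEq.IsWeakSolution hd v v₀) (hinit : v 0 = v₀)
    (T : ℝ) (hT : 0 < T)
    (β p γ : ℝ) (hβ : 2 < β) (hp : 2 < p) (hβp : 2 / β + 2 / p = 1) (hγ : 2 < γ)
    (hvβ : PrimitiveEq.MemLpBesov χ β T (-1 / p) p v)
    (hvγ : PrimitiveEq.MemLpBesov χ γ T (2 / γ) 2 v) :
    ∀ t : ℝ, 0 < t → t ≤ T →
      1 / 2 * ‖v t‖ ^ 2 + (∫ τ in (0 : ℝ)..t, PrimitiveEq.gradNormSq (v τ))
        = 1 / 2 * ‖v₀‖ ^ 2 :=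
  fun _ ht htT => hv.energy_eq_of_memLpBesov hinit hd₁ hχ hγ hvγ ht htT
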